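/- **Setting.** Let $\omega:[0,\infty)\to[0,\infty)$ be a non-quasianalytic subadditive weight function, i.e. continuous, increasing, with $\omega(t_1+t_2)\le\omega(t_1)+\omega(t_2)$, $\int_1^\infty \omega(t)t^{-2}\,dt<\infty$, $\omega(t)\ge A+B\log(1+t)$ for some $A\in\mathbb R$, $B>0$, and $t\mapsto\omega(e^t)$ convex; put $\omega(x)=\omega(|x|)$ for vectors $x$. Let $\hat u(\xi)=\int u(y)e^{-iy\cdot\xi}\,dy$, and let $\mathcal S_\omega(\mathbb R^d)$ be the space of all $u\in L^1(\mathbb R^d)$ with $u,\hat u\in C^\infty$ and $$\sup_x e^{\lambda\omega(x)}|D^\alpha u(x)|<\infty,\qquad \sup_\xi e^{\lambda\omega(\xi)}|D^\alpha\hat u(\xi)|<\infty\qquad(\lambda>0,\ \alpha\in\mathbb N_0^d),$$ with the topology given by these seminorms; $\mathcal S'_\omega(\mathbb R^d)$ is its dual. For $\varphi\in\mathcal S_\omega$ and $f\in\mathcal S'_\omega$ let $$V_\varphi f(x,\xi)=\langle f,M_\xi T_x\varphi\rangle=f\bigl(y\mapsto e^{-iy\cdot\xi}\,\overline{\varphi(y-x)}\bigr).$$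 For a weight $m>0$ on $\mathbb R^{2d}$, $1\le p,q\le\infty$ and a window $\varphi\in\mathcal S_\omega\setminus\{0\}$ put $$\|f\|_{\mathbf M^{p,q}_m;\varphi}=\Bigl(\int\Bigl(\int|V_\varphi f(x,\xi)|^p m(x,\xi)^p\,dx\Bigr)^{q/p}d\xi\Bigr)^{1/q}$$ (usual changes if $p$ or $q$ is $\infty$), and let $\mathbf M^{p,q}_m(\mathbb R^d)$ be the set of all $f\in\mathcal S'_\omega$ for which this is finite. For $\lambda\in\mathbb R$ and $z\in\mathbb R^{2d}$ let $m_\lambda(z)=e^{\lambda\omega(z)}$, $v_\lambda(z)=e^{|\lambda|\omega(z)}$, $m_{\lambda,1}(x)=m_\lambda(x,0)$, $m_{\lambda,2}(\xi)=m_\lambda(0,\xi)$, $v_{\lambda,1}(x)=v_\lambda(x,0)$, $v_{\lambda,2}(\xi)=v_\lambda(0,\xi)$. For $f,h,u\in\mathcal S'_\omega$ write $u=f*h$ if for all $\varphi,\psi\in\mathcal S_\omega$ the functions $f*\varphi$ and $h*\psi$, where $(f*\varphi)(x)=f(\varphi(x-\cdot))$, can be convolved at every point (absolutely convergent integral) and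 $(f*\varphi)*(h*\psi)=(u*\varphi)*\psi$. **Proposition.** Let $1\le p,q,r,s,t,t'\le\infty$ with $\frac1p+\frac1q-1=\frac1r$ and $\frac1t+\frac1{t'}=1$, let $\lambda,\mu\in\mathbb R$, and put $$X=\mathbf M^{p,st}_{m_{\lambda,1}\otimes m_{\mu,2}}(\mathbb R^d),\qquad Y=\mathbf M^{q,st'}_{v_{\lambda,1}\otimes v_{\lambda,2}m_{-\mu,2}}(\mathbb R^d)$$ (for $\lambda\ge0$, $v_{\lambda,1}=m_{\lambda,1}$). Let $\varphi_1,\varphi_2\in\mathcal S_\omega\setminus\{0\}$ be the windows used for $X$ and $Y$. Then: 1. for all $f\in X$ and $h\in Y$ the convolution $f*h\in\mathcal S'_\omega$ exists and is unique; 2. $X*Y\hookrightarrow\mathbf M^{r,s}_{m_\lambda}(\mathbb R^d)$ continuously: for every window $\varphi_3\in\mathcal S_\omega\setminus\{0\}$ there is a constant $C$, independent of $f$ and $h$, such that for all $f\in X$, $h\in Y$ one has $f*h\in\mathbf M^{r,s}_{m_\lambda}$ (with window $\varphi_3$) and $$\|f*h\|_{\mathbf M^{r,s}_{m_\lambda};\varphi_3}\le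 C\,\|f\|_{X;\varphi_1}\,\|h\|_{Y;\varphi_2};$$ 3. if $\varphi_3=\varphi_1*\varphi_2\neq0$, this holds with constant one: for all $f\in X$, $h\in Y$, $$\|f*h\|_{\mathbf M^{r,s}_{m_\lambda};\varphi_3}\le\|f\|_{X;\varphi_1}\,\|h\|_{Y;\varphi_2}.$$ -/

import Mathlib

open MeasureTheory
open scoped ENNReal NNReal

namespace OmegaTempered

/-- The Euclidean space `ℝ^d`. -/
abbrev E (d : ℕ) : Type := EuclideanSpace ℝ (Fin d)

/-- A non-quasianalytic subadditive weight function `ω : [0, ∞) → [0, ∞)`; the values of `toFun`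
at negative numbers are irrelevant. -/
structure WeightFunction where
  toFun : ℝ → ℝ
  nonneg : ∀ t, 0 ≤ t → 0 ≤ toFun t
  cont : ContinuousOn toFun (Set.Ici 0)
  mono : MonotoneOn toFun (Set.Ici 0)
  subadd : ∀ t₁ t₂, 0 ≤ t₁ → 0 ≤ t₂ → toFun (t₁ + t₂) ≤ toFun t₁ + toFun t₂
  nonquasianalytic : IntegrableOn (fun t : ℝ => toFun t / t ^ 2) (Set.Ioi 1)
  log_le : ∃ A B : ℝ, 0 < B ∧ ∀ t, 0 ≤ t → A + B * Real.log (1 + t) ≤ toFun t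
  convex : ConvexOn ℝ Set.univ (fun t : ℝ => toFun (Real.exp t))

instance : CoeFun WeightFunction (fun _ => ℝ → ℝ) := ⟨WeightFunction.toFun⟩

/-- The Fourier transform `û(ξ) = ∫ u(y) e^{-i y · ξ} dy`. -/
noncomputable def hat {d : ℕ} (u : E d → ℂ) (ξ : E d) : ℂ :=
  ∫ y : E d, Complex.exp (-(Complex.I * ((inner ℝ y ξ : ℝ) : ℂ))) * u y

/-- `u` is smooth, and all its derivatives decay faster than `e^{-λ ω(|x|)}` for every `λ > 0`. -/
def RapidDecay {d : ℕ} (ω : WeightFunction) (u : E d → ℂ) : Prop :=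
  ContDiff ℝ (⊤ : ℕ∞) u ∧ ∀ lam : ℝ, 0 < lam → ∀ n : ℕ,
    BddAbove (Set.range fun x : E d => Real.exp (lam * ω ‖x‖) * ‖iteratedFDeriv ℝ n u x‖)

/-! ### Stability of rapid decay under elementary operations -/

section decay

variable {d : ℕ} {ω : WeightFunction}

theorem rapidDecay_of_le {u : E d → ℂ} (hu : ContDiff ℝ (⊤ : ℕ∞) u)
    (h : ∀ lam : ℝ, 0 < lam → ∀ n : ℕ, ∃ C : ℝ, ∀ x : E d,
      Real.exp (lam * ω ‖x‖) * ‖iteratedFDeriv ℝ n u x‖ ≤ C) : RapidDecay ω u :=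
  ⟨hu, fun lam hl n => by
    obtain ⟨C, hC⟩ := h lam hl n
    exact ⟨C, by rintro _ ⟨x, rfl⟩; exact hC x⟩⟩

theorem RapidDecay.bound {u : E d → ℂ} (hu : RapidDecay ω u) {lam : ℝ} (hl : 0 < lam) (n : ℕ) :
    ∃ C : ℝ, 0 ≤ C ∧ ∀ x : E d, Real.exp (lam * ω ‖x‖) * ‖iteratedFDeriv ℝ n u x‖ ≤ C := by
  obtain ⟨C, hC⟩ := hu.2 lam hl n
  have h : ∀ x : E d, Real.exp (lam * ω ‖x‖) * ‖iteratedFDeriv ℝ n u x‖ ≤ C :=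
    fun x => hC ⟨x, rfl⟩
  exact ⟨C, le_trans (by positivity) (h 0), h⟩

theorem rapidDecay_zero : RapidDecay ω (0 : E d → ℂ) := by
  refine rapidDecay_of_le contDiff_const fun lam _ n => ⟨0, fun x => ?_⟩
  have : iteratedFDeriv ℝ n (0 : E d → ℂ) = 0 := iteratedFDeriv_fun_zero
  simp [this]

theorem RapidDecay.add {u v : E d → ℂ} (hu : RapidDecay ω u) (hv : RapidDecay ω v) :
    RapidDecay ω (u + v) := by
  refine rapidDecay_of_le (hu.1.add hv.1) fun lam hl n => ?_
  obtain ⟨C, -, hC⟩ := hu.bound hl n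
  obtain ⟨D, -, hD⟩ := hv.bound hl n
  refine ⟨C + D, fun x => ?_⟩
  have h : iteratedFDeriv ℝ n (u + v) x = iteratedFDeriv ℝ n u x + iteratedFDeriv ℝ n v x :=
    iteratedFDeriv_add_apply (hu.1.contDiffAt.of_le (mod_cast le_top))
      (hv.1.contDiffAt.of_le (mod_cast le_top))
  rw [h]
  calc _ ≤ Real.exp (lam * ω ‖x‖) * (‖iteratedFDeriv ℝ n u x‖ + ‖iteratedFDeriv ℝ n v x‖) := by
        gcongr; exact norm_add_le _ _
    _ ≤ C + D := by rw [mul_add]; exact add_le_add (hC x) (hD x)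

theorem RapidDecay.smul {u : E d → ℂ} (c : ℂ) (hu : RapidDecay ω u) : RapidDecay ω (c • u) := by
  refine rapidDecay_of_le (contDiff_const.smul hu.1) fun lam hl n => ?_
  obtain ⟨C, -, hC⟩ := hu.bound hl n
  refine ⟨‖c‖ * C, fun x => ?_⟩
  have h : iteratedFDeriv ℝ n (c • u) x = c • iteratedFDeriv ℝ n u x :=
    iteratedFDeriv_const_smul_apply (hu.1.contDiffAt.of_le (mod_cast le_top))
  rw [h, norm_smul, mul_left_comm]
  gcongr
  exact hC x

theorem weight_le (ω : WeightFunction) (x a : E d) : ω ‖x‖ ≤ ω ‖x - a‖ + ω ‖a‖ := by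
  refine le_trans (ω.mono (norm_nonneg x) (Set.mem_Ici.2 (by positivity)) ?_)
    (ω.subadd _ _ (norm_nonneg (x - a)) (norm_nonneg a))
  simpa using norm_add_le (x - a) a

theorem RapidDecay.translate {u : E d → ℂ} (hu : RapidDecay ω u) (a : E d) :
    RapidDecay ω (fun y => u (y - a)) := by
  refine rapidDecay_of_le (hu.1.comp (contDiff_id.sub contDiff_const)) fun lam hl n => ?_
  obtain ⟨C, hC0, hC⟩ := hu.bound hl n
  refine ⟨Real.exp (lam * ω ‖a‖) * C, fun x => ?_⟩
  rw [iteratedFDeriv_comp_sub]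
  calc _ ≤ Real.exp (lam * (ω ‖x - a‖ + ω ‖a‖)) * ‖iteratedFDeriv ℝ n u (x - a)‖ := by
        gcongr; exact weight_le ω x a
    _ = Real.exp (lam * ω ‖a‖)
          * (Real.exp (lam * ω ‖x - a‖) * ‖iteratedFDeriv ℝ n u (x - a)‖) := by
        rw [mul_add, Real.exp_add]; ring
    _ ≤ _ := by gcongr; exact hC _

theorem RapidDecay.reflect {u : E d → ℂ} (hu : RapidDecay ω u) :
    RapidDecay ω (fun y => u (-y)) := by
  refine rapidDecay_of_le (hu.1.comp contDiff_neg) fun lam hl n => ?_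
  obtain ⟨C, -, hC⟩ := hu.bound hl n
  refine ⟨C, fun x => ?_⟩
  have h := (LinearIsometryEquiv.neg ℝ (E := E d)).norm_iteratedFDeriv_comp_right u x n
  have h2 : (u ∘ (LinearIsometryEquiv.neg ℝ (E := E d))) = fun y => u (-y) := rfl
  rw [h2] at h
  rw [h]
  simpa using hC (-x)

theorem RapidDecay.conj {u : E d → ℂ} (hu : RapidDecay ω u) :
    RapidDecay ω (fun y => (starRingEnd ℂ) (u y)) := by
  refine rapidDecay_of_le (Complex.conjLIE.contDiff.comp hu.1) fun lam hl n => ?_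
  obtain ⟨C, -, hC⟩ := hu.bound hl n
  refine ⟨C, fun x => ?_⟩
  have h := Complex.conjLIE.norm_iteratedFDeriv_comp_left u x n
  have h2 : (Complex.conjLIE ∘ u) = fun y => (starRingEnd ℂ) (u y) := rfl
  rw [h2] at h
  rw [h]
  exact hC x

/-- The character `y ↦ e^{i y · ξ}`. -/
noncomputable def character (ξ y : E d) : ℂ := Complex.exp (Complex.I * ((inner ℝ y ξ : ℝ) : ℂ))

theorem norm_character (ξ y : E d) : ‖character ξ y‖ = 1 := by
  rw [character, mul_comm]; exact Complex.norm_exp_ofReal_mul_I _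

theorem contDiff_character (ξ : E d) : ContDiff ℝ (⊤ : ℕ∞) (character ξ) := by
  exact (contDiff_const.mul (Complex.ofRealCLM.contDiff.comp
    (contDiff_id.inner ℝ contDiff_const))).cexp

theorem iteratedDeriv_exp_I (n : ℕ) :
    iteratedDeriv n (fun t : ℝ => Complex.exp (Complex.I * (t : ℂ)))
      = fun t : ℝ => Complex.I ^ n * Complex.exp (Complex.I * (t : ℂ)) := by
  induction n with
  | zero => simp
  | succ n ih =>
    rw [iteratedDeriv_succ, ih]
    funext t
    have h : HasDerivAt (fun t : ℝ => Complex.exp (Complex.I * (t : ℂ)))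
        (Complex.exp (Complex.I * (t : ℂ)) * (Complex.I * 1)) t :=
      (((Complex.ofRealCLM.hasDerivAt (x := t)).const_mul Complex.I)).cexp
    rw [(h.const_mul _).deriv]
    ring

theorem norm_iteratedFDeriv_character_le (ξ y : E d) (n : ℕ) :
    ‖iteratedFDeriv ℝ n (character ξ) y‖ ≤ ‖ξ‖ ^ n := by
  have h : character ξ = (fun t : ℝ => Complex.exp (Complex.I * (t : ℂ))) ∘ (innerSL ℝ ξ) := by
    funext y; simp [character, real_inner_comm]
  have hc : ContDiff ℝ n (fun t : ℝ => Complex.exp (Complex.I * (t : ℂ))) :=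
    (contDiff_const.mul Complex.ofRealCLM.contDiff).cexp
  rw [h, (innerSL ℝ ξ).iteratedFDeriv_comp_right hc y le_rfl]
  refine (ContinuousMultilinearMap.norm_compContinuousLinearMap_le _ _).trans ?_
  rw [norm_iteratedFDeriv_eq_norm_iteratedDeriv, iteratedDeriv_exp_I]
  simp [mul_comm Complex.I, Complex.norm_exp_ofReal_mul_I]

theorem RapidDecay.modulate {u : E d → ℂ} (hu : RapidDecay ω u) (ξ : E d) :
    RapidDecay ω (fun y => character ξ y * u y) := by
  refine rapidDecay_of_le ((contDiff_character ξ).mul hu.1) fun lam hl n => ?_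
  choose C hC0 hC using fun n => hu.bound hl n
  refine ⟨∑ i ∈ Finset.range (n + 1), (n.choose i : ℝ) * ‖ξ‖ ^ i * C (n - i), fun x => ?_⟩
  calc _ ≤ Real.exp (lam * ω ‖x‖) * ∑ i ∈ Finset.range (n + 1), (n.choose i : ℝ)
          * ‖iteratedFDeriv ℝ i (character ξ) x‖ * ‖iteratedFDeriv ℝ (n - i) u x‖ := by
        gcongr
        exact norm_iteratedFDeriv_mul_le (contDiff_character ξ) hu.1 x (mod_cast le_top)
    _ = ∑ i ∈ Finset.range (n + 1), (n.choose i : ℝ) * ‖iteratedFDeriv ℝ i (character ξ) x‖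
          * (Real.exp (lam * ω ‖x‖) * ‖iteratedFDeriv ℝ (n - i) u x‖) := by
        rw [Finset.mul_sum]; exact Finset.sum_congr rfl fun i _ => by ring
    _ ≤ _ := by
        gcongr with i _
        · exact norm_iteratedFDeriv_character_le ξ x i
        · exact hC _ x

end decay

/-! ### The Fourier transform of elementary operations -/

section fourier

variable {d : ℕ}

theorem hat_eq (u : E d → ℂ) (ξ : E d) : hat u ξ = ∫ y : E d, character (-ξ) y * u y := by
  simp [hat, character]

theorem character_add (ξ η y : E d) : character (ξ + η) y = character ξ y * character η y := by
  simp only [character, ← Complex.exp_add, inner_add_right]; push_cast; ring_nf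

theorem character_add_right (ξ y z : E d) :
    character ξ (y + z) = character ξ y * character ξ z := by
  simp only [character, ← Complex.exp_add, inner_add_left]; push_cast; ring_nf

theorem integrable_character_mul {u : E d → ℂ} (hu : Integrable u) (ξ : E d) :
    Integrable fun y => character ξ y * u y :=
  hu.bdd_mul (c := 1) (contDiff_character ξ).continuous.aestronglyMeasurable
    (Filter.Eventually.of_forall fun y => (norm_character ξ y).le)

theorem hat_add {u v : E d → ℂ} (hu : Integrable u) (hv : Integrable v) :
    hat (u + v) = hat u + hat v := by
  funext ξ
  simp only [hat_eq, Pi.add_apply, mul_add]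
  exact integral_add (integrable_character_mul hu _) (integrable_character_mul hv _)

theorem hat_smul (c : ℂ) (u : E d → ℂ) : hat (c • u) = c • hat u := by
  funext ξ
  simp only [hat_eq, Pi.smul_apply, smul_eq_mul, mul_left_comm _ c]
  exact integral_const_mul _ _

theorem hat_translate (u : E d → ℂ) (a : E d) :
    hat (fun y => u (y - a)) = fun ξ => character (-a) ξ * hat u ξ := by
  funext ξ
  rw [hat_eq, hat_eq, ← integral_add_right_eq_self _ a, ← integral_const_mul]
  refine integral_congr_ae (Filter.Eventually.of_forall fun y => ?_)
  have : character (-ξ) a = character (-a) ξ := by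
    simp [character, real_inner_comm]
  simp only [add_sub_cancel_right, character_add_right, this]
  ring

theorem hat_reflect (u : E d → ℂ) : hat (fun y => u (-y)) = fun ξ => hat u (-ξ) := by
  funext ξ
  rw [hat_eq, hat_eq, ← integral_neg_eq_self]
  refine integral_congr_ae (Filter.Eventually.of_forall fun y => ?_)
  simp [character]

theorem hat_conj (u : E d → ℂ) :
    hat (fun y => (starRingEnd ℂ) (u y)) = fun ξ => (starRingEnd ℂ) (hat u (-ξ)) := by
  funext ξ
  rw [hat_eq, hat_eq, ← integral_conj]
  refine integral_congr_ae (Filter.Eventually.of_forall fun y => ?_)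
  simp [character, ← Complex.exp_conj]

theorem hat_modulate (u : E d → ℂ) (ξ : E d) :
    hat (fun y => character ξ y * u y) = fun η => hat u (η - ξ) := by
  funext η
  rw [hat_eq, hat_eq]
  refine integral_congr_ae (Filter.Eventually.of_forall fun y => ?_)
  simp only [← mul_assoc, ← character_add]
  congr 2
  abel

end fourier

/-! ### The test function space and its dual -/

/-- The vector space `𝒮_ω(ℝ^d)`: all `u ∈ L¹` such that `u` and `û` are smooth and all their
derivatives decay faster than `e^{-λ ω(|x|)}` for every `λ > 0`. -/
def testSubmodule (d : ℕ) (ω : WeightFunction) : Submodule ℂ (E d → ℂ) where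
  carrier := {u | Integrable u ∧ RapidDecay ω u ∧ RapidDecay ω (hat u)}
  zero_mem' := by
    refine ⟨integrable_zero _ _ _, rapidDecay_zero, ?_⟩
    have : hat (0 : E d → ℂ) = 0 := by funext ξ; simp [hat]
    rw [this]; exact rapidDecay_zero
  add_mem' := by
    rintro u v ⟨hu, hu1, hu2⟩ ⟨hv, hv1, hv2⟩
    exact ⟨hu.add hv, hu1.add hv1, by rw [hat_add hu hv]; exact hu2.add hv2⟩
  smul_mem' := by
    rintro c u ⟨hu, hu1, hu2⟩
    exact ⟨hu.smul c, hu1.smul c, by rw [hat_smul]; exact hu2.smul c⟩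

/-- The space `𝒮_ω(ℝ^d)`, as a type of its own: it carries the topology defined below, not that of
pointwise convergence. -/
def TestSpace (d : ℕ) (ω : WeightFunction) : Type := testSubmodule d ω

section test

variable {d : ℕ} {ω : WeightFunction}

noncomputable instance : AddCommGroup (TestSpace d ω) :=
  inferInstanceAs (AddCommGroup (testSubmodule d ω))

noncomputable instance : Module ℂ (TestSpace d ω) :=
  inferInstanceAs (Module ℂ (testSubmodule d ω))

instance : CoeFun (TestSpace d ω) (fun _ => E d → ℂ) := ⟨fun u => u.1⟩

/-- The seminorm `sup_x e^{λ ω(|x|)} |D^n u(x)|`. -/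
noncomputable def decaySeminorm (d : ℕ) (ω : WeightFunction) (lam : ℝ) (hl : 0 < lam) (n : ℕ) :
    Seminorm ℂ (TestSpace d ω) :=
  Seminorm.ofSMulLE
    (fun u => ⨆ x : E d, Real.exp (lam * ω ‖x‖) * ‖iteratedFDeriv ℝ n u.1 x‖)
    (by
      have : iteratedFDeriv ℝ n (0 : E d → ℂ) = 0 := iteratedFDeriv_fun_zero
      show (⨆ x : E d, Real.exp (lam * ω ‖x‖) * ‖iteratedFDeriv ℝ n (0 : E d → ℂ) x‖) = 0
      simp [this])
    (fun u v => by
      refine ciSup_le fun x => ?_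
      have h : iteratedFDeriv ℝ n (u + v).1 x
          = iteratedFDeriv ℝ n u.1 x + iteratedFDeriv ℝ n v.1 x :=
        iteratedFDeriv_add_apply (u.2.2.1.1.contDiffAt.of_le (mod_cast le_top))
          (v.2.2.1.1.contDiffAt.of_le (mod_cast le_top))
      rw [h]
      refine le_trans (mul_le_mul_of_nonneg_left (norm_add_le _ _) (Real.exp_pos _).le) ?_
      rw [mul_add]
      exact add_le_add (le_ciSup (u.2.2.1.2 lam hl n) x) (le_ciSup (v.2.2.1.2 lam hl n) x))
    (fun c u => by
      refine ciSup_le fun x => ?_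
      have h : iteratedFDeriv ℝ n (c • u).1 x = c • iteratedFDeriv ℝ n u.1 x :=
        iteratedFDeriv_const_smul_apply (u.2.2.1.1.contDiffAt.of_le (mod_cast le_top))
      rw [h, norm_smul, mul_left_comm]
      exact mul_le_mul_of_nonneg_left (le_ciSup (u.2.2.1.2 lam hl n) x) (norm_nonneg c))

/-- The seminorm `sup_ξ e^{λ ω(|ξ|)} |D^n û(ξ)|`. -/
noncomputable def hatSeminorm (d : ℕ) (ω : WeightFunction) (lam : ℝ) (hl : 0 < lam) (n : ℕ) :
    Seminorm ℂ (TestSpace d ω) :=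
  Seminorm.ofSMulLE
    (fun u => ⨆ ξ : E d, Real.exp (lam * ω ‖ξ‖) * ‖iteratedFDeriv ℝ n (hat u.1) ξ‖)
    (by
      have h0 : hat (0 : E d → ℂ) = 0 := by funext ξ; simp [hat]
      have : iteratedFDeriv ℝ n (0 : E d → ℂ) = 0 := iteratedFDeriv_fun_zero
      show (⨆ x : E d, Real.exp (lam * ω ‖x‖) * ‖iteratedFDeriv ℝ n (hat (0 : E d → ℂ)) x‖) = 0
      simp [h0, this])
    (fun u v => by
      refine ciSup_le fun x => ?_
      have h0 : hat (u + v).1 = hat u.1 + hat v.1 := hat_add u.2.1 v.2.1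
      have h : iteratedFDeriv ℝ n (hat (u + v).1) x
          = iteratedFDeriv ℝ n (hat u.1) x + iteratedFDeriv ℝ n (hat v.1) x := by
        rw [h0]
        exact iteratedFDeriv_add_apply (u.2.2.2.1.contDiffAt.of_le (mod_cast le_top))
          (v.2.2.2.1.contDiffAt.of_le (mod_cast le_top))
      rw [h]
      refine le_trans (mul_le_mul_of_nonneg_left (norm_add_le _ _) (Real.exp_pos _).le) ?_
      rw [mul_add]
      exact add_le_add (le_ciSup (u.2.2.2.2 lam hl n) x) (le_ciSup (v.2.2.2.2 lam hl n) x))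
    (fun c u => by
      refine ciSup_le fun x => ?_
      have h0 : hat (c • u).1 = c • hat u.1 := hat_smul c u.1
      have h : iteratedFDeriv ℝ n (hat (c • u).1) x = c • iteratedFDeriv ℝ n (hat u.1) x := by
        rw [h0]
        exact iteratedFDeriv_const_smul_apply (u.2.2.2.1.contDiffAt.of_le (mod_cast le_top))
      rw [h, norm_smul, mul_left_comm]
      exact mul_le_mul_of_nonneg_left (le_ciSup (u.2.2.2.2 lam hl n) x) (norm_nonneg c))

/-- The family of all seminorms defining the topology of `𝒮_ω(ℝ^d)`. -/
noncomputable def testSeminorms (d : ℕ) (ω : WeightFunction) :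
    SeminormFamily ℂ (TestSpace d ω) (({lam : ℝ // 0 < lam} × ℕ) ⊕ ({lam : ℝ // 0 < lam} × ℕ)) :=
  Sum.elim (fun i => decaySeminorm d ω i.1.1 i.1.2 i.2) (fun i => hatSeminorm d ω i.1.1 i.1.2 i.2)

noncomputable instance : TopologicalSpace (TestSpace d ω) :=
  (testSeminorms d ω).moduleFilterBasis.topology

theorem withSeminorms_test : WithSeminorms (testSeminorms d ω) := ⟨rfl⟩

instance : IsTopologicalAddGroup (TestSpace d ω) :=
  (testSeminorms d ω).addGroupFilterBasis.isTopologicalAddGroup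

instance : ContinuousSMul ℂ (TestSpace d ω) :=
  (testSeminorms d ω).moduleFilterBasis.continuousSMul

variable (d ω) in
/-- The space `𝒮'_ω(ℝ^d)` of `ω`-tempered distributions. -/
abbrev TemperedDist : Type := TestSpace d ω →L[ℂ] ℂ

/-- Translation, `(T_a u)(y) = u(y - a)`. -/
def translate (a : E d) (u : TestSpace d ω) : TestSpace d ω :=
  ⟨fun y => u (y - a), u.2.1.comp_sub_right a, u.2.2.1.translate a, by
    rw [hat_translate]; exact u.2.2.2.modulate (-a)⟩

/-- Modulation, `(M_ξ u)(y) = e^{i y · ξ} u(y)`. -/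
noncomputable def modulate (ξ : E d) (u : TestSpace d ω) : TestSpace d ω :=
  ⟨fun y => character ξ y * u y, integrable_character_mul u.2.1 ξ, u.2.2.1.modulate ξ, by
    rw [hat_modulate]; exact u.2.2.2.translate ξ⟩

/-- Reflection, `y ↦ u(-y)`. -/
def reflect (u : TestSpace d ω) : TestSpace d ω :=
  ⟨fun y => u (-y), u.2.1.comp_neg, u.2.2.1.reflect, by
    rw [hat_reflect]; exact u.2.2.2.reflect⟩

/-- Complex conjugation. -/
def conjugate (u : TestSpace d ω) : TestSpace d ω :=
  ⟨fun y => (starRingEnd ℂ) (u y), Complex.conjLIE.integrable_comp_iff.2 u.2.1, u.2.2.1.conj, by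
    rw [hat_conj]; exact u.2.2.2.conj.reflect⟩

/-! ### Short-time Fourier transform and modulation spaces -/

/-- The short-time Fourier transform `V_φ f (x, ξ) = ⟨f, M_ξ T_x φ⟩` of an `ω`-tempered
distribution, where the pairing `⟨f, ψ⟩ = f (conj ψ)` is antilinear in `ψ`
(so that `⟨f, ψ⟩ = ∫ f conj ψ` for functions `f`). -/
noncomputable def stft (φ : TestSpace d ω) (f : TemperedDist d ω) (x ξ : E d) : ℂ :=
  f (conjugate (modulate ξ (translate x φ)))

/-- The weighted mixed norm `‖F‖_{L^{p,q}_m}`: the `L^p` norm in `x` (inside) and the `L^q` norm in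
`ξ` (outside) of `F(x, ξ) m(x, ξ)`. -/
noncomputable def mixedNorm (p q : ℝ≥0∞) (m : E d → E d → ℝ) (F : E d → E d → ℂ) : ℝ≥0∞ :=
  eLpNorm (fun ξ => eLpNorm (fun x => (m x ξ : ℂ) * F x ξ) p volume) q volume

/-- The modulation norm `‖f‖_{M^{p,q}_m} = ‖V_φ f‖_{L^{p,q}_m}` with respect to the window `φ`. -/
noncomputable def modNorm (φ : TestSpace d ω) (p q : ℝ≥0∞) (m : E d → E d → ℝ)
    (f : TemperedDist d ω) : ℝ≥0∞ :=
  mixedNorm p q m (stft φ f)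

/-- The modulation space `M^{p,q}_m(ℝ^d)`: all `f ∈ 𝒮'_ω` with `V_φ f ∈ L^{p,q}_m(ℝ^{2d})`,
with respect to the window `φ`. -/
def modulationSpace (φ : TestSpace d ω) (p q : ℝ≥0∞) (m : E d → E d → ℝ) :
    Set (TemperedDist d ω) :=
  {f | AEStronglyMeasurable (fun z : E d × E d => stft φ f z.1 z.2) volume ∧
    modNorm φ p q m f < ∞}

/-- The weight `m_λ(x, ξ) = e^{λ ω(|(x, ξ)|)}` on `ℝ^{2d}`. -/
noncomputable def mWeight (ω : WeightFunction) (lam : ℝ) (x ξ : E d) : ℝ :=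
  Real.exp (lam * ω (Real.sqrt (‖x‖ ^ 2 + ‖ξ‖ ^ 2)))

/-- The weight `v_λ(x, ξ) = e^{|λ| ω(|(x, ξ)|)}` on `ℝ^{2d}`. -/
noncomputable def vWeight (ω : WeightFunction) (lam : ℝ) (x ξ : E d) : ℝ :=
  Real.exp (|lam| * ω (Real.sqrt (‖x‖ ^ 2 + ‖ξ‖ ^ 2)))

/-- The weight `m_{λ,1} ⊗ m_{μ,2}`, that is `(x, ξ) ↦ m_λ(x, 0) m_μ(0, ξ)`. -/
noncomputable def leftWeight (ω : WeightFunction) (lam mu : ℝ) (x ξ : E d) : ℝ :=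
  mWeight ω lam x 0 * mWeight ω mu 0 ξ

/-- The weight `v_{λ,1} ⊗ v_{λ,2} m_{-μ,2}`, that is
`(x, ξ) ↦ v_λ(x, 0) v_λ(0, ξ) m_{-μ}(0, ξ)`. -/
noncomputable def rightWeight (ω : WeightFunction) (lam mu : ℝ) (x ξ : E d) : ℝ :=
  vWeight ω lam x 0 * (vWeight ω lam 0 ξ * mWeight ω (-mu) 0 ξ)

/-! ### Convolution -/

/-- The regularisation `(f * φ)(x) = f (φ(x - ·))` of a distribution by a test function. -/
noncomputable def regularize (f : TemperedDist d ω) (φ : TestSpace d ω) (x : E d) : ℂ :=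
  f (translate x (reflect φ))

/-- `u` is the convolution `f * h` of two `ω`-tempered distributions (in Chevalley's sense): for all
test functions `φ`, `ψ`, the functions `f * φ` and `h * ψ` can be convolved, and
`(f * φ) * (h * ψ) = (u * φ) * ψ`. -/
def IsConvolution (f h u : TemperedDist d ω) : Prop :=
  ∀ (φ ψ : TestSpace d ω) (x : E d),
    Integrable (fun y => regularize f φ y * regularize h ψ (x - y)) ∧
    ∫ y, regularize f φ y * regularize h ψ (x - y) = ∫ y, regularize u φ y * ψ (x - y)

end test

end OmegaTempered

/-! ### Weights, decay of Fourier transforms, and interpolation of derivatives. -/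

namespace OmegaTempered

open Real FourierTransform Filter Topology

/-! ### Elementary properties of the weight -/

section weight

variable {d : ℕ} (ω : WeightFunction)

/-! Write `a^*(y) = conj (a (-y))`. Up to a unimodular factor, `V_φ f(x, ξ)` is the regularisation
`(f * M_ξ φ^*)(x)` (`regularize_modulate_star`), so every modulation norm is a mixed norm of a
family of ordinary functions. Modulation is multiplicative for convolution, `M_ξ(a * b) = M_ξ a *
M_ξ b`, so the convolution `u` of `f` and `h` satisfies `u * M_ξ(a * b) = (f * M_ξ a) * (h * M_ξ b)`
for each fixed `ξ`. The weights satisfy `m_λ(x, ξ) ≤ left(y, ξ) right(x - y, ξ)` (`mWeight_le`).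
Young's inequality in `x` followed by Hölder's inequality in `ξ`, with `1/(st) + 1/(st') = 1/s`,
gives the estimate with constant one (`regNorm_conv_le`).

The other assertions rest on the reproducing formula `(2π)^d g(0) χ = ∫ M_ξ g * χ dξ`, applied under
a distribution (`regularize_reproducing`). With `g = a * a^*` one has `g(0) = ∫ |a|^2 ≠ 0`, and `f *
M_η a'` becomes an integral of `f * M_ξ a` against a kernel decaying in both `y` and `η - ξ`
(`exists_conv_modulate_le`). Minkowski's and Young's inequalities then bound one window by another
(`exists_regNorm_le`). Since `a * b` may vanish, `b` is first modulated so that the Fourier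
transforms of the two windows overlap.

For existence, `u` is defined by `u * χ = c ∫∫ (f * M_ξ a)(y) (h * (M_ξ a^* * χ))(· - y) dy dξ`.
Absolute convergence is reduced to finiteness of a convolution of two frequency averages with
`e^{-Kω}` (`lconvolution_freqAverage_lt_top`). Fubini's theorem and the reproducing formula turn `u
* (φ * ψ)` into `(f * φ) * (h * ψ)` (`integral_convIntegrand_conv`). Uniqueness holds because, again
by the reproducing formula, a distribution is determined by its regularisations with convolution
products.

Applying a distribution under an integral sign requires a norm description of the test space. The
derivative seminorms are dominated by the sup norms of `e^{λω} u` and `e^{λω} û`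
(`exists_testSeminorms_le`), so every distribution extends to a functional on a Banach space of
pairs of bounded continuous functions, where Bochner integration applies. -/

theorem weight_nonneg (x : E d) : 0 ≤ ω ‖x‖ := ω.nonneg _ (norm_nonneg x)

theorem continuous_weight : Continuous fun x : E d => ω ‖x‖ :=
  ω.cont.comp_continuous continuous_norm fun x => norm_nonneg x

theorem exists_rpow_le_exp_weight (r : ℝ) (hr : 0 ≤ r) : ∃ K C : ℝ, 0 < K ∧ 0 < C ∧
    ∀ x : E d, (1 + ‖x‖) ^ r ≤ C * exp (K * ω ‖x‖) := by
  obtain ⟨A, B, hB, h⟩ := ω.log_le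
  -- The exponent `r / B` would suffice; the summand `1` only makes it positive when `r = 0`.
  refine ⟨r / B + 1, exp (-(r / B * A)), by positivity, by positivity, fun x => ?_⟩
  have h1 := h ‖x‖ (norm_nonneg x)
  have hx : 0 < 1 + ‖x‖ := by positivity
  have h2 : Real.log (1 + ‖x‖) * r ≤ -(r / B * A) + (r / B + 1) * ω ‖x‖ := by
    have h3 : r / B * (A + B * Real.log (1 + ‖x‖)) ≤ r / B * ω ‖x‖ := by gcongr
    have h4 : r / B * (A + B * Real.log (1 + ‖x‖)) = r / B * A + Real.log (1 + ‖x‖) * r := by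
      field_simp
    have := weight_nonneg ω x
    linarith
  rw [Real.rpow_def_of_pos hx, ← exp_add]
  exact exp_le_exp.2 h2

/-- The logarithmic lower bound on `ω` lets `e^{-Kω}` be compared with `(1 + |x|)^{-(d+1)}`. -/
theorem exists_integrable_exp_weight : ∃ K₀ : ℝ, 0 < K₀ ∧ ∀ K, K₀ ≤ K →
    Integrable fun x : E d => exp (-(K * ω ‖x‖)) := by
  obtain ⟨K₀, C, hK, hC, h⟩ := exists_rpow_le_exp_weight (d := d) ω (d + 1) (by positivity)
  refine ⟨K₀, hK, fun K hKK => ?_⟩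
  have hi := (integrable_one_add_norm (E := E d) (μ := volume) (r := d + 1) (by simp)).const_mul C
  refine hi.mono' (by
    have := continuous_weight (d := d) ω
    exact (by fun_prop : Continuous _).aestronglyMeasurable) (Eventually.of_forall fun x => ?_)
  rw [Real.norm_of_nonneg (exp_pos _).le, exp_neg, Real.rpow_neg (by positivity), ← div_eq_mul_inv,
    inv_eq_one_div, div_le_div_iff₀ (exp_pos _) (by positivity), one_mul]
  refine (h x).trans ?_
  have := weight_nonneg ω x
  gcongr

theorem exists_integrable_pow_mul_exp_weight (n : ℕ) : ∃ K : ℝ, 0 < K ∧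
    Integrable fun x : E d => ‖x‖ ^ n * exp (-(K * ω ‖x‖)) := by
  obtain ⟨K₁, C, hK, hC, h⟩ := exists_rpow_le_exp_weight (d := d) ω n (by positivity)
  obtain ⟨K₀, hK₀, h₀⟩ := exists_integrable_exp_weight (d := d) ω
  refine ⟨K₁ + K₀, by positivity, ((h₀ K₀ le_rfl).const_mul C).mono' (by
    have := continuous_weight (d := d) ω
    exact (by fun_prop : Continuous _).aestronglyMeasurable) (Eventually.of_forall fun x => ?_)⟩
  rw [Real.norm_of_nonneg (by positivity)]
  have h1 : ‖x‖ ^ n ≤ C * exp (K₁ * ω ‖x‖) := by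
    refine le_trans ?_ (h x)
    rw [Real.rpow_natCast]
    gcongr
    linarith
  calc ‖x‖ ^ n * exp (-((K₁ + K₀) * ω ‖x‖))
      ≤ C * exp (K₁ * ω ‖x‖) * exp (-((K₁ + K₀) * ω ‖x‖)) := by gcongr
    _ = C * exp (-(K₀ * ω ‖x‖)) := by
        rw [mul_assoc, ← exp_add]; ring_nf

end weight

/-! ### The Fourier transform of decaying functions -/

section fourierDecay

variable {d : ℕ} (ω : WeightFunction)

/-- The pairing `(2π)⁻¹ ⟨x, y⟩`. -/
noncomputable def scaledInner (d : ℕ) : E d →L[ℝ] E d →L[ℝ] ℝ := (2 * π)⁻¹ • innerSL ℝ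

theorem hat_eq_fourierIntegral (u : E d → ℂ) :
    hat u = VectorFourier.fourierIntegral 𝐞 volume (scaledInner d).toLinearMap₁₂ u := by
  funext ξ
  simp only [hat, VectorFourier.fourierIntegral]
  refine integral_congr_ae (Eventually.of_forall fun y => ?_)
  simp only [Circle.smul_def, Real.fourierChar_apply, smul_eq_mul]
  congr 2
  have : (innerSL ℝ) y ξ = inner ℝ y ξ := rfl
  simp [scaledInner, this]
  field_simp

theorem hat_eq_fourier (u : E d → ℂ) (ξ : E d) : hat u ξ = 𝓕 u ((2 * π)⁻¹ • ξ) := by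
  rw [hat, Real.fourier_eq]
  refine integral_congr_ae (Eventually.of_forall fun y => ?_)
  simp only [Circle.smul_def, Real.fourierChar_apply, smul_eq_mul, inner_smul_right]
  congr 2
  push_cast
  field_simp

theorem continuous_hat {u : E d → ℂ} (hu : Integrable u) : Continuous (hat u) := by
  rw [hat_eq_fourierIntegral]
  refine VectorFourier.fourierIntegral_continuous Real.continuous_fourierChar ?_ hu
  exact (scaledInner d).continuous₂

theorem norm_hat_le (u : E d → ℂ) (ξ : E d) : ‖hat u ξ‖ ≤ ∫ y, ‖u y‖ := by
  rw [hat_eq]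
  refine (norm_integral_le_integral_norm _).trans (le_of_eq ?_)
  simp [norm_character]

/-- Fourier inversion; the factor is the Jacobian of the rescaling by `2π` between the two
normalisations of the transform. -/
theorem hat_hat {u : E d → ℂ} (hc : Continuous u) (hu : Integrable u) (hu' : Integrable (hat u))
    (x : E d) : hat (hat u) x = (2 * π) ^ d * u (-x) := by
  have hpi : (2 * π)⁻¹ ≠ 0 := by positivity
  have hF : Integrable (𝓕 u) := by
    have : hat u = fun ξ => 𝓕 u ((2 * π)⁻¹ • ξ) := funext (hat_eq_fourier u)
    rw [this, integrable_comp_smul_iff _ _ hpi] at hu'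
    exact hu'
  have hinv := congrFun (hc.fourierInv_fourier_eq hu hF) (-x)
  rw [Real.fourierInv_eq] at hinv
  rw [← hinv, hat]
  have h := Measure.integral_comp_smul (volume : Measure (E d))
    (fun v => 𝐞 (inner ℝ v (-x)) • 𝓕 u v) (2 * π)⁻¹
  have h1 : |((2 * π)⁻¹ ^ Module.finrank ℝ (E d))⁻¹| = (2 * π) ^ d := by
    rw [abs_of_pos (by positivity)]; simp [← inv_pow]
  rw [h1] at h
  have h2 : ((2 * π) ^ d : ℂ) = (((2 * π) ^ d : ℝ) : ℂ) := by push_cast; rfl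
  rw [h2, ← Complex.real_smul, ← h]
  refine integral_congr_ae (Eventually.of_forall fun y => ?_)
  simp only [Circle.smul_def, Real.fourierChar_apply, smul_eq_mul, hat_eq_fourier, inner_smul_left,
    inner_neg_right]
  congr 2
  push_cast
  simp
  field_simp

/-- A weighted sup bound. -/
def WeightedBound (lam M : ℝ) (u : E d → ℂ) : Prop := ∀ x, exp (lam * ω ‖x‖) * ‖u x‖ ≤ M

variable {ω}

theorem WeightedBound.norm_le {lam M : ℝ} {u : E d → ℂ} (h : WeightedBound ω lam M u) (x : E d) :
    ‖u x‖ ≤ M * exp (-(lam * ω ‖x‖)) := by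
  rw [exp_neg, ← div_eq_mul_inv, le_div_iff₀ (exp_pos _), mul_comm]
  exact h x

theorem WeightedBound.mono {lam lam' M : ℝ} (hl : lam ≤ lam') {u : E d → ℂ}
    (h : WeightedBound ω lam' M u) : WeightedBound ω lam M u := fun x =>
  le_trans (by have := weight_nonneg ω x; gcongr) (h x)

theorem WeightedBound.nonneg {lam M : ℝ} {u : E d → ℂ} (h : WeightedBound ω lam M u) : 0 ≤ M :=
  le_trans (by positivity) (h 0)

theorem WeightedBound.integrable_pow {n : ℕ} {K M : ℝ} {u : E d → ℂ} (hc : Continuous u)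
    (hK : Integrable fun x : E d => ‖x‖ ^ n * exp (-(K * ω ‖x‖)))
    (h : WeightedBound ω K M u) : Integrable fun x => ‖x‖ ^ n * ‖u x‖ := by
  refine (hK.const_mul M).mono' (by fun_prop) (Eventually.of_forall fun x => ?_)
  rw [Real.norm_of_nonneg (by positivity), mul_left_comm]
  gcongr
  exact h.norm_le x

theorem integrable_of_weightedBound {u : E d → ℂ} (hc : Continuous u)
    (h : ∀ lam : ℝ, 0 < lam → ∃ M, WeightedBound ω lam M u) : Integrable u := by
  obtain ⟨K, hK, hi⟩ := exists_integrable_exp_weight (d := d) ω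
  obtain ⟨M, hM⟩ := h K hK
  refine ((hi K le_rfl).const_mul M).mono' (by fun_prop) (Eventually.of_forall fun x => hM.norm_le x)

theorem contDiff_hat {u : E d → ℂ} (hc : Continuous u)
    (h : ∀ lam : ℝ, 0 < lam → ∃ M, WeightedBound ω lam M u) :
    ContDiff ℝ (⊤ : ℕ∞) (hat u) := by
  rw [hat_eq_fourierIntegral]
  refine VectorFourier.contDiff_fourierIntegral _ fun n _ => ?_
  obtain ⟨K, hK, hi⟩ := exists_integrable_pow_mul_exp_weight (d := d) ω n
  obtain ⟨M, hM⟩ := h K hK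
  exact hM.integrable_pow hc hi

variable (ω) in
-- Differentiation under the integral brings down `|x|^n`, which is integrable against `e^{-Kω}`.
-- What matters is that `K` and `C` do not depend on `u`.
theorem exists_norm_iteratedFDeriv_hat_le (d n : ℕ) : ∃ K C : ℝ, 0 < K ∧ 0 ≤ C ∧
    ∀ u : E d → ℂ, Continuous u → (∀ lam : ℝ, 0 < lam → ∃ M, WeightedBound ω lam M u) →
    ∀ M, WeightedBound ω K M u → ∀ ξ, ‖iteratedFDeriv ℝ n (hat u) ξ‖ ≤ C * M := by
  obtain ⟨K, hK, hi⟩ := exists_integrable_pow_mul_exp_weight (d := d) ω n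
  refine ⟨K, (2 * π * ‖scaledInner d‖) ^ n * ∫ x : E d, ‖x‖ ^ n * exp (-(K * ω ‖x‖)), hK,
    by positivity, fun u hc hu M hM ξ => ?_⟩
  rw [hat_eq_fourierIntegral, VectorFourier.iteratedFDeriv_fourierIntegral (N := ⊤) (scaledInner d)
    (fun n _ => ?_) hc.aestronglyMeasurable (by exact_mod_cast le_top)]
  · refine (VectorFourier.norm_fourierIntegral_le_integral_norm _ _ _ _ _).trans ?_
    rw [mul_assoc, ← integral_mul_const, ← integral_const_mul]
    refine integral_mono_of_nonneg (Eventually.of_forall fun x => norm_nonneg _)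
      ((hi.mul_const _).const_mul _) (Eventually.of_forall fun x => ?_)
    refine (VectorFourier.norm_fourierPowSMulRight_le _ _ _ _).trans ?_
    simp only [mul_assoc]
    gcongr
    rw [mul_comm]
    exact hM.norm_le x
  · obtain ⟨K, hK, hi⟩ := exists_integrable_pow_mul_exp_weight (d := d) ω n
    obtain ⟨M, hM⟩ := hu K hK
    exact hM.integrable_pow hc hi

end fourierDecay

/-! ### Weighted bounds for derivatives -/

section derivatives

variable {d : ℕ} {F : Type*} [NormedAddCommGroup F] [NormedSpace ℝ F]

/-- A Landau type inequality: the difference quotient with step `h` is at most `2N/h`, and it misses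
the derivative by at most `M h`. Smallness of `g` is needed only within distance `h` of `x`, so
decay at `x` can be exploited. -/
theorem norm_fderiv_le_of_second_deriv {g : E d → F} (hg : Differentiable ℝ g) {M N h : ℝ}
    (hh : 0 < h) (hM : 0 ≤ M) (x : E d) (hN : ∀ y, ‖y - x‖ ≤ h → ‖g y‖ ≤ N)
    
    (h2 : ∀ y, ‖fderiv ℝ g y - fderiv ℝ g x‖ ≤ M * ‖y - x‖) : ‖fderiv ℝ g x‖ ≤ 2 * N / h + M * h := by
  have hN0 : 0 ≤ N := (norm_nonneg _).trans (hN x (by simpa using hh.le))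
  have hlip : ∀ y, ‖y - x‖ ≤ h → ‖fderiv ℝ g y - fderiv ℝ g x‖ ≤ M * h := fun y hy =>
    (h2 y).trans (by gcongr)
  refine ContinuousLinearMap.opNorm_le_of_unit_norm (by positivity) fun v hv => ?_
  have hy : ‖x + h • v - x‖ ≤ h := by
    rw [add_sub_cancel_left, norm_smul, hv, mul_one, Real.norm_of_nonneg hh.le]
  have key : ‖g (x + h • v) - g x - fderiv ℝ g x (x + h • v - x)‖ ≤ M * h * ‖x + h • v - x‖ :=
    (convex_closedBall x h).norm_image_sub_le_of_norm_fderiv_le' (𝕜 := ℝ) (fun z _ => hg z)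
      (fun z hz => hlip z (by simpa [dist_eq_norm] using hz)) (by simpa using hh.le)
      (by rw [Metric.mem_closedBall, dist_eq_norm]; exact hy)
  have e1 : fderiv ℝ g x (x + h • v - x) = h • fderiv ℝ g x v := by simp
  rw [e1] at key
  have h3 : h * ‖fderiv ℝ g x v‖ ≤ 2 * N + M * h * h := by
    have : h * ‖fderiv ℝ g x v‖ = ‖h • fderiv ℝ g x v‖ := by
      rw [norm_smul, Real.norm_of_nonneg hh.le]
    rw [this]
    have h4 : h • fderiv ℝ g x v = g (x + h • v) - g x
        - (g (x + h • v) - g x - h • fderiv ℝ g x v) := by abel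
    rw [h4]
    refine (norm_sub_le _ _).trans ?_
    have h5 := norm_sub_le (g (x + h • v)) (g x)
    have h6 := hN _ hy
    have h7 := hN x (by simpa using hh.le)
    have h8 : M * h * ‖x + h • v - x‖ ≤ M * h * h := by gcongr
    linarith
  rw [div_add' _ _ _ hh.ne', le_div_iff₀ hh, mul_comm]
  exact h3

variable (ω : WeightFunction)

/-- Decay of `u` and mere boundedness of its derivatives give decay of the derivatives, by
interpolation. If order `n` decays like `e^{-2λω}`, the Landau inequality with step `e^{-λω(x)}`
makes order `n + 1` decay like `e^{-λω}`; each order halves the exponent and uses one further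
bounded derivative. -/
theorem exists_weighted_iteratedFDeriv_le (d n : ℕ) : ∀ lam : ℝ, 0 < lam → ∃ K C : ℝ, 0 < K ∧ 0 ≤ C ∧
    ∀ u : E d → ℂ, ContDiff ℝ (⊤ : ℕ∞) u → ∀ M, WeightedBound ω K M u →
    (∀ k ≤ n + 1, ∀ x, ‖iteratedFDeriv ℝ k u x‖ ≤ M) →
    ∀ x, exp (lam * ω ‖x‖) * ‖iteratedFDeriv ℝ n u x‖ ≤ C * M := by
  induction n with
  | zero =>
    intro lam hl
    refine ⟨lam, 1, hl, zero_le_one, fun u hu M hM _ x => ?_⟩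
    simpa using hM x
  | succ n ih =>
    intro lam hl
    obtain ⟨K, C, hK, hC, h⟩ := ih (2 * lam) (by positivity)
    -- The factor `e^{2λω(1)}` pays for moving the weight from `x` to a point at distance at most
    -- `1`; the `2` and the `1` come from the two terms `2N/h` and `M h`.
    refine ⟨K, 2 * (C * exp (2 * lam * ω 1)) + 1, hK, by positivity, fun u hu M hM hk x => ?_⟩
    have hM0 := hM.nonneg
    have h1 := h u hu M hM (fun k hk' => hk k (by omega))
    have hω := weight_nonneg ω x
    have hle : exp (-(lam * ω ‖x‖)) ≤ 1 := exp_le_one_iff.2 (by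
      have := mul_nonneg hl.le hω; linarith)
    have hd : ∀ m, Differentiable ℝ (iteratedFDeriv ℝ m u) := fun m =>
      hu.differentiable_iteratedFDeriv (by exact_mod_cast ENat.natCast_lt_top m)
    have key := norm_fderiv_le_of_second_deriv (g := iteratedFDeriv ℝ n u) (M := M)
      (N := C * M * exp (2 * lam * ω 1) * exp (-(2 * lam * ω ‖x‖))) (h := exp (-(lam * ω ‖x‖)))
      (hd n) (exp_pos _) hM0 x ?_ ?_
    · rw [norm_fderiv_iteratedFDeriv] at key
      refine (mul_le_mul_of_nonneg_left key (exp_pos _).le).trans (le_of_eq ?_)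
      have e1 : exp (-(2 * lam * ω ‖x‖)) = exp (-(lam * ω ‖x‖)) * exp (-(lam * ω ‖x‖)) := by
        rw [← exp_add]; ring_nf
      have e2 : exp (lam * ω ‖x‖) * exp (-(lam * ω ‖x‖)) = 1 := by rw [← exp_add]; simp
      have e3 := (exp_pos (-(lam * ω ‖x‖))).ne'
      have e4 : ∀ c, 2 * (c * exp (-(2 * lam * ω ‖x‖))) / exp (-(lam * ω ‖x‖))
          = 2 * c * exp (-(lam * ω ‖x‖)) := fun c => by
        rw [e1]; field_simp
      rw [e4]
      linear_combination (2 * C * M * exp (2 * lam * ω 1) + M) * e2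
    · intro y hy
      have hxy : ω ‖x‖ ≤ ω ‖y‖ + ω 1 := by
        have h3 := weight_le ω x (x - y)
        rw [sub_sub_cancel] at h3
        have h4 : ω ‖x - y‖ ≤ ω 1 :=
          ω.mono (norm_nonneg _) (by simp) (by rw [norm_sub_rev]; exact hy.trans hle)
        linarith
      have h2 := h1 y
      rw [mul_comm, ← le_div_iff₀ (exp_pos _), div_eq_mul_inv, ← exp_neg] at h2
      refine h2.trans ?_
      rw [mul_assoc (C * M), ← exp_add]
      gcongr
      nlinarith
    · intro y
      -- Up to a linear isometry this derivative is `D^{n+1} u`, whose Lipschitz constant is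
      -- controlled by the bound on order `n + 2`.
      have e : ∀ z, fderiv ℝ (iteratedFDeriv ℝ n u) z
          = continuousMultilinearCurryLeftEquiv ℝ (fun _ : Fin (n + 1) => E d) ℂ
            (iteratedFDeriv ℝ (n + 1) u z) := fun z => by
        rw [iteratedFDeriv_succ_eq_comp_left, Function.comp_apply,
          LinearIsometryEquiv.apply_symm_apply]
      rw [e, e, ← LinearIsometryEquiv.map_sub, LinearIsometryEquiv.norm_map]
      exact convex_univ.norm_image_sub_le_of_norm_fderiv_le (𝕜 := ℝ) (fun z _ => hd _ z)
        (fun z _ => by rw [norm_fderiv_iteratedFDeriv]; exact hk _ le_rfl z)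
        (Set.mem_univ x) (Set.mem_univ y)

end derivatives

end OmegaTempered

/-! ### Test functions through weighted sup norms; distributions as functionals on a Banach space.
-/

namespace OmegaTempered

open Real FourierTransform Filter Topology

/-! ### A zeroth order description of the test functions -/

section testLike

variable {d : ℕ} {ω : WeightFunction}

variable (ω) in
/-- Continuous functions that, together with their Fourier transform, decay rapidly. -/
structure TestLike (u : E d → ℂ) : Prop where
  continuous : Continuous u
  bound : ∀ lam : ℝ, 0 < lam → ∃ M, WeightedBound ω lam M u
  bound_hat : ∀ lam : ℝ, 0 < lam → ∃ M, WeightedBound ω lam M (hat u)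

namespace TestLike

variable {u : E d → ℂ}

theorem integrable (h : TestLike ω u) : Integrable u := integrable_of_weightedBound h.1 h.2

theorem integrable_hat (h : TestLike ω u) : Integrable (hat u) :=
  integrable_of_weightedBound (continuous_hat h.integrable) h.3

theorem hat_hat_eq (h : TestLike ω u) : hat (hat u) = fun x => (2 * π) ^ d * u (-x) :=
  funext (hat_hat h.1 h.integrable h.integrable_hat)

theorem norm_hat_hat (h : TestLike ω u) (x : E d) : ‖hat (hat u) x‖ = (2 * π) ^ d * ‖u (-x)‖ := by
  rw [h.hat_hat_eq]
  simp [abs_of_pos pi_pos]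

theorem eq_hat_hat (h : TestLike ω u) (x : E d) :
    u x = ((2 * π) ^ d : ℂ)⁻¹ * hat (hat u) (-x) := by
  have hpi : ((2 * π) ^ d : ℂ) ≠ 0 := by
    exact_mod_cast (by positivity : ((2 * π) ^ d : ℝ) ≠ 0)
  simp only [h.hat_hat_eq, neg_neg, inv_mul_cancel_left₀ hpi]

theorem weightedBound_hat_hat (h : TestLike ω u) {lam M : ℝ} (hM : WeightedBound ω lam M u) :
    WeightedBound ω lam ((2 * π) ^ d * M) (hat (hat u)) := fun x => by
  rw [h.norm_hat_hat, mul_left_comm]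
  have := hM (-x)
  rw [norm_neg] at this
  gcongr

protected theorem hat (h : TestLike ω u) : TestLike ω (hat u) :=
  ⟨continuous_hat h.integrable, h.3, fun lam hl => by
    obtain ⟨M, hM⟩ := h.2 lam hl
    exact ⟨_, h.weightedBound_hat_hat hM⟩⟩

theorem eq_hat_hat' (h : TestLike ω u) :
    u = ((2 * π) ^ d : ℂ)⁻¹ • (hat (hat u) ∘ (LinearIsometryEquiv.neg ℝ (E := E d))) :=
  funext h.eq_hat_hat

theorem contDiff (h : TestLike ω u) : ContDiff ℝ (⊤ : ℕ∞) u := by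
  rw [h.eq_hat_hat']
  exact contDiff_const.smul ((contDiff_hat h.hat.1 h.hat.2).comp (LinearIsometryEquiv.contDiff _))

variable (ω) in
-- By inversion `u` is itself a Fourier transform, so its derivatives are bounded through the decay
-- of `û`.
theorem exists_norm_iteratedFDeriv_le (d n : ℕ) : ∃ K C : ℝ, 0 < K ∧ 0 ≤ C ∧
    ∀ u : E d → ℂ, TestLike ω u → ∀ M, WeightedBound ω K M (hat u) →
      ∀ x, ‖iteratedFDeriv ℝ n u x‖ ≤ C * M := by
  obtain ⟨K, C, hK, hC, h⟩ := exists_norm_iteratedFDeriv_hat_le ω d n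
  refine ⟨K, C, hK, hC, fun u hu M hM x => ?_⟩
  have hM0 := hM.nonneg
  have hsm : ContDiff ℝ (⊤ : ℕ∞) (hat (hat u)) := contDiff_hat hu.hat.1 hu.hat.2
  rw [hu.eq_hat_hat', iteratedFDeriv_const_smul_apply
    ((hsm.comp (LinearIsometryEquiv.contDiff _)).contDiffAt.of_le (mod_cast le_top)), norm_smul,
    LinearIsometryEquiv.norm_iteratedFDeriv_comp_right]
  have h1 := h (hat u) hu.hat.1 hu.hat.2 M hM ((LinearIsometryEquiv.neg ℝ (E := E d)) x)
  have h2 : ‖((2 * π) ^ d : ℂ)⁻¹‖ ≤ 1 := by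
    rw [norm_inv, norm_pow]
    refine inv_le_one_of_one_le₀ (one_le_pow₀ ?_)
    have := two_le_pi
    simp [abs_of_pos pi_pos]
    linarith
  calc _ ≤ 1 * (C * M) := by gcongr
    _ = C * M := one_mul _

variable (ω) in
theorem exists_weighted_le (d n : ℕ) (lam : ℝ) (hl : 0 < lam) : ∃ K C : ℝ, 0 < K ∧ 0 ≤ C ∧
    ∀ u : E d → ℂ, TestLike ω u → ∀ M, WeightedBound ω K M u → WeightedBound ω K M (hat u) →
      ∀ x, exp (lam * ω ‖x‖) * ‖iteratedFDeriv ℝ n u x‖ ≤ C * M := by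
  obtain ⟨K, C, hK, hC, h⟩ := exists_weighted_iteratedFDeriv_le ω d n lam hl
  choose K' C' hK' hC' h' using exists_norm_iteratedFDeriv_le ω d
  have hle : ∀ k ∈ Finset.range (n + 2), K' k ≤ ∑ k ∈ Finset.range (n + 2), K' k := fun k hk =>
    Finset.single_le_sum (f := K') (fun k _ => (hK' k).le) hk
  have hle' : ∀ k ∈ Finset.range (n + 2), C' k ≤ ∑ k ∈ Finset.range (n + 2), C' k := fun k hk =>
    Finset.single_le_sum (f := C') (fun k _ => (hC' k)) hk
  have hSK : 0 ≤ ∑ k ∈ Finset.range (n + 2), K' k := Finset.sum_nonneg fun k _ => (hK' k).le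
  have hSC : 0 ≤ ∑ k ∈ Finset.range (n + 2), C' k := Finset.sum_nonneg fun k _ => hC' k
  set SK := ∑ k ∈ Finset.range (n + 2), K' k
  set SC := ∑ k ∈ Finset.range (n + 2), C' k
  -- Sums serve as common majorants of the finitely many exponents and constants belonging to the
  -- orders `k ≤ n + 1`.
  refine ⟨K + SK, C * (1 + SC), by positivity, by positivity, fun u hu M hM hM' x => ?_⟩
  have hM0 := hM.nonneg
  rw [mul_assoc]
  refine h u hu.contDiff _ (fun y => ?_) (fun k hk y => ?_) x
  · refine (hM.mono (by linarith) y).trans ?_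
    nlinarith
  · have hk' : k ∈ Finset.range (n + 2) := Finset.mem_range.2 (by omega)
    refine (h' k u hu M (hM'.mono ?_) y).trans ?_
    · linarith [hle k hk']
    · have := hle' k hk'
      gcongr
      linarith

theorem rapidDecay (h : TestLike ω u) : RapidDecay ω u := by
  refine rapidDecay_of_le h.contDiff fun lam hl n => ?_
  obtain ⟨K, C, hK, hC, hb⟩ := exists_weighted_le ω d n lam hl
  obtain ⟨M, hM⟩ := h.2 K hK
  obtain ⟨M', hM'⟩ := h.3 K hK
  exact ⟨_, hb u h (max M M') (fun x => (hM x).trans (le_max_left _ _))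
    (fun x => (hM' x).trans (le_max_right _ _))⟩

/-- Membership can thus be verified without touching derivatives; this is how convolutions are
recognised as test functions. -/
theorem mem_testSubmodule (h : TestLike ω u) : u ∈ testSubmodule d ω :=
  ⟨h.integrable, h.rapidDecay, h.hat.rapidDecay⟩

end TestLike

theorem TestSpace.testLike (u : TestSpace d ω) : TestLike ω (u : E d → ℂ) := by
  refine ⟨u.2.2.1.1.continuous, fun lam hl => ?_, fun lam hl => ?_⟩
  · obtain ⟨C, -, hC⟩ := u.2.2.1.bound hl 0
    exact ⟨C, fun x => by simpa using hC x⟩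
  · obtain ⟨C, -, hC⟩ := u.2.2.2.bound hl 0
    exact ⟨C, fun x => by simpa using hC x⟩

theorem TestSpace.continuous (u : TestSpace d ω) : Continuous (u : E d → ℂ) := u.testLike.1

theorem TestSpace.integrable (u : TestSpace d ω) : Integrable (u : E d → ℂ) := u.2.1

@[ext]
theorem TestSpace.ext {u v : TestSpace d ω} (h : ∀ x, u x = v x) : u = v := Subtype.ext (funext h)

/-! ### The weighted sup norms -/

open scoped BoundedContinuousFunction

theorem exists_bound_weighted (u : E d → ℂ) (h : ∀ lam : ℝ, 0 < lam → ∃ M, WeightedBound ω lam M u)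
    (lam : ℝ) : ∃ M, ∀ x, ‖(exp (lam * ω ‖x‖) : ℂ) * u x‖ ≤ M := by
  obtain ⟨M, hM⟩ := h (max lam 1) (by positivity)
  refine ⟨M, fun x => ?_⟩
  rw [norm_mul, Complex.norm_real, norm_of_nonneg (exp_pos _).le]
  exact hM.mono (le_max_left _ _) x

/-- Multiplication by `e^{λ ω}` as a bounded continuous function. -/
noncomputable def weightedBCF (lam : ℝ) (u : E d → ℂ) (hc : Continuous u)
    (h : ∀ lam : ℝ, 0 < lam → ∃ M, WeightedBound ω lam M u) : E d →ᵇ ℂ :=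
  BoundedContinuousFunction.ofNormedAddCommGroup (fun x => (exp (lam * ω ‖x‖) : ℂ) * u x)
    (by have := continuous_weight (d := d) ω; fun_prop) _ (exists_bound_weighted u h lam).choose_spec

/-- The pair `(e^{λω} u, e^{λω} û)` of bounded continuous functions. -/
noncomputable def weightedPair (d : ℕ) (ω : WeightFunction) (lam : ℝ) :
    TestSpace d ω →ₗ[ℂ] (E d →ᵇ ℂ) × (E d →ᵇ ℂ) where
  toFun u := (weightedBCF lam u u.testLike.1 u.testLike.2,
    weightedBCF lam (hat u) u.testLike.hat.1 u.testLike.hat.2)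
  map_add' u v := by
    refine Prod.ext (BoundedContinuousFunction.ext fun x => ?_)
      (BoundedContinuousFunction.ext fun x => ?_)
    · exact mul_add _ _ _
    · change _ * hat (u.1 + v.1) x = _
      rw [hat_add u.2.1 v.2.1]
      exact mul_add _ _ _
  map_smul' c u := by
    refine Prod.ext (BoundedContinuousFunction.ext fun x => ?_)
      (BoundedContinuousFunction.ext fun x => ?_)
    · exact mul_left_comm _ _ _
    · change _ * hat (c • u.1) x = _
      rw [hat_smul]
      exact mul_left_comm _ _ _

/-- The norm `max (sup e^{λω} |u|, sup e^{λω} |û|)`. -/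
noncomputable def testNorm (lam : ℝ) (u : TestSpace d ω) : ℝ := ‖weightedPair d ω lam u‖

theorem testNorm_nonneg (lam : ℝ) (u : TestSpace d ω) : 0 ≤ testNorm lam u := norm_nonneg _

theorem weightedPair_fst_apply (lam : ℝ) (u : TestSpace d ω) (x : E d) :
    (weightedPair d ω lam u).1 x = (exp (lam * ω ‖x‖) : ℂ) * u x := rfl

theorem weightedPair_snd_apply (lam : ℝ) (u : TestSpace d ω) (x : E d) :
    (weightedPair d ω lam u).2 x = (exp (lam * ω ‖x‖) : ℂ) * hat u x := rfl

theorem norm_exp_mul (r : ℝ) (z : ℂ) : ‖(exp r : ℂ) * z‖ = exp r * ‖z‖ := by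
  rw [norm_mul, Complex.norm_real, norm_of_nonneg (exp_pos _).le]

theorem weightedBound_testNorm (lam : ℝ) (u : TestSpace d ω) :
    WeightedBound ω lam (testNorm lam u) u := fun x => by
  have h := (BoundedContinuousFunction.norm_coe_le_norm (weightedPair d ω lam u).1 x).trans
    (norm_fst_le _)
  rw [weightedPair_fst_apply] at h
  simpa only [norm_exp_mul, testNorm] using h

theorem weightedBound_hat_testNorm (lam : ℝ) (u : TestSpace d ω) :
    WeightedBound ω lam (testNorm lam u) (hat u) := fun x => by
  have h := (BoundedContinuousFunction.norm_coe_le_norm (weightedPair d ω lam u).2 x).trans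
    (norm_snd_le _)
  rw [weightedPair_snd_apply] at h
  simpa only [norm_exp_mul, testNorm] using h

theorem testNorm_le {lam M : ℝ} {u : TestSpace d ω} (h : WeightedBound ω lam M u)
    (h' : WeightedBound ω lam M (hat u)) : testNorm lam u ≤ M := by
  have hM := h.nonneg
  refine norm_prod_le_iff.2 ⟨?_, ?_⟩
  · refine (BoundedContinuousFunction.norm_le hM).2 fun x => ?_
    rw [weightedPair_fst_apply]
    simpa only [norm_exp_mul, testNorm] using h x
  · refine (BoundedContinuousFunction.norm_le hM).2 fun x => ?_
    rw [weightedPair_snd_apply]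
    simpa only [norm_exp_mul, testNorm] using h' x

theorem testNorm_mono {lam lam' : ℝ} (hl : lam ≤ lam') (u : TestSpace d ω) :
    testNorm lam u ≤ testNorm lam' u :=
  testNorm_le ((weightedBound_testNorm lam' u).mono hl) ((weightedBound_hat_testNorm lam' u).mono hl)

theorem exists_testSeminorms_le (i) : ∃ K C : ℝ, 0 ≤ C ∧
    ∀ u : TestSpace d ω, testSeminorms d ω i u ≤ C * testNorm K u := by
  rcases i with ⟨⟨lam, hl⟩, n⟩ | ⟨⟨lam, hl⟩, n⟩ <;>
  obtain ⟨K, C, hK, hC, h⟩ := TestLike.exists_weighted_le ω d n lam hl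
  · exact ⟨K, C, hC, fun u => ciSup_le fun x => h u u.testLike _ (weightedBound_testNorm K u)
      (weightedBound_hat_testNorm K u) x⟩
  -- The bound is applied to `û`, whose own transform is `(2π)^d u(-·)`; this is the source of the
  -- extra factor.
  · refine ⟨K, C * (2 * π) ^ d, by positivity, fun u => ciSup_le fun x => ?_⟩
    have h1 : (1 : ℝ) ≤ (2 * π) ^ d := one_le_pow₀ (by linarith [two_le_pi])
    have := testNorm_nonneg K u
    rw [mul_assoc]
    exact h (hat u) u.testLike.hat _
      (fun y => (weightedBound_hat_testNorm K u y).trans (by nlinarith))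
      (u.testLike.weightedBound_hat_hat (weightedBound_testNorm K u)) x

theorem TemperedDist.exists_bound (f : TemperedDist d ω) : ∃ K C : ℝ, 0 ≤ C ∧
    ∀ u : TestSpace d ω, ‖f u‖ ≤ C * testNorm K u := by
  obtain ⟨s, C, -, h⟩ := Seminorm.bound_of_continuous withSeminorms_test
    ((normSeminorm ℂ ℂ).comp (f : TestSpace d ω →ₗ[ℂ] ℂ)) (continuous_norm.comp f.continuous)
  choose K C' hC' h' using exists_testSeminorms_le (d := d) (ω := ω)
  have hs : ∃ K' C'' : ℝ, 0 ≤ C'' ∧ ∀ u : TestSpace d ω,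
      s.sup (testSeminorms d ω) u ≤ C'' * testNorm K' u := by
    clear h
    classical
    induction s using Finset.induction with
    | empty => exact ⟨0, 0, le_rfl, fun u => by simp⟩
    | insert i s _ ih =>
      obtain ⟨K', C'', hC'', hs⟩ := ih
      refine ⟨max (K i) K', max (C' i) C'', by positivity, fun u => ?_⟩
      rw [Finset.sup_insert]
      have hn := testNorm_nonneg (max (K i) K') u
      refine max_le ((h' i u).trans ?_) ((hs u).trans ?_)
      · exact mul_le_mul (le_max_left _ _) (testNorm_mono (le_max_left _ _) u) (testNorm_nonneg _ _)
          (le_max_of_le_right hC'')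
      · exact mul_le_mul (le_max_right _ _) (testNorm_mono (le_max_right _ _) u)
          (testNorm_nonneg _ _) (le_max_of_le_right hC'')
  obtain ⟨K', C'', hC'', hs⟩ := hs
  refine ⟨K', C * C'', by positivity, fun u => (h u).trans ?_⟩
  rw [mul_assoc]
  exact mul_le_mul_of_nonneg_left (hs u) C.2

/-- Each weighted sup norm is dominated by two of the defining seminorms of order zero, so these
norms generate the topology. -/
theorem continuous_of_testNorm_bound (f : TestSpace d ω →ₗ[ℂ] ℂ) {K C : ℝ} (hC : 0 ≤ C)
    (h : ∀ u, ‖f u‖ ≤ C * testNorm K u) : Continuous f := by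
  -- The defining seminorms are indexed by positive exponents only, while `K` is arbitrary.
  have hK : 0 < max K 1 := by positivity
  have h0 : ∀ u : TestSpace d ω, testNorm (max K 1) u ≤
      testSeminorms d ω (Sum.inl (⟨_, hK⟩, 0)) u + testSeminorms d ω (Sum.inr (⟨_, hK⟩, 0)) u :=
    fun u => by
    have h1 : ∀ x, exp (max K 1 * ω ‖x‖) * ‖u x‖
        ≤ testSeminorms d ω (Sum.inl (⟨_, hK⟩, 0)) u := fun x => by
      have := le_ciSup (u.2.2.1.2 _ hK 0) x
      rw [norm_iteratedFDeriv_zero] at this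
      exact this
    have h2 : ∀ x, exp (max K 1 * ω ‖x‖) * ‖hat u x‖
        ≤ testSeminorms d ω (Sum.inr (⟨_, hK⟩, 0)) u := fun x => by
      have := le_ciSup (u.2.2.2.2 _ hK 0) x
      rw [norm_iteratedFDeriv_zero] at this
      exact this
    exact testNorm_le (fun x => (h1 x).trans (le_add_of_nonneg_right (apply_nonneg _ _)))
      (fun x => (h2 x).trans (le_add_of_nonneg_left (apply_nonneg _ _)))
  -- The constant is `2 * C` because a sum of two seminorms is at most twice their supremum.
  refine withSeminorms_test.continuous_normedSpace_rng (p := testSeminorms d ω) ℂ f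
    ⟨{Sum.inl (⟨_, hK⟩, 0), Sum.inr (⟨_, hK⟩, 0)}, ⟨2 * C, by positivity⟩, fun u => ?_⟩
  have hs : ∀ i ∈ ({Sum.inl (⟨_, hK⟩, 0), Sum.inr (⟨_, hK⟩, 0)} : Finset _),
    testSeminorms d ω i u ≤ ({Sum.inl (⟨_, hK⟩, 0), Sum.inr (⟨_, hK⟩, 0)} : Finset _).sup
      (testSeminorms d ω) u := fun i hi => Seminorm.le_finset_sup_apply hi
  have hs1 := hs (Sum.inl (⟨_, hK⟩, 0)) (by simp)
  have hs2 := hs (Sum.inr (⟨_, hK⟩, 0)) (by simp)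
  have h3 := h0 u
  have h4 := testNorm_mono (le_max_left K 1) u
  have h5 : C * testNorm K u ≤ C * (2 * ({Sum.inl (⟨_, hK⟩, 0), Sum.inr (⟨_, hK⟩, 0)} : Finset _).sup
      (testSeminorms d ω) u) := by gcongr; linarith
  refine (h u).trans (h5.trans (le_of_eq ?_))
  rw [← mul_assoc, mul_comm C]
  rfl

/-- Hahn–Banach: the functional is bounded on the range of the embedding `J`, hence extends to all
of `B`. -/
theorem exists_clm_comp_eq {V B : Type*} [AddCommGroup V] [Module ℂ V] [NormedAddCommGroup B]
    [NormedSpace ℂ B] (J : V →ₗ[ℂ] B) (hJ : Function.Injective J) (f : V →ₗ[ℂ] ℂ) (C : ℝ)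
    (h : ∀ u, ‖f u‖ ≤ C * ‖J u‖) : ∃ L : B →L[ℂ] ℂ, ∀ u, f u = L (J u) := by
  let e := LinearEquiv.ofInjective J hJ
  let g : LinearMap.range J →L[ℂ] ℂ :=
    LinearMap.mkContinuous (f ∘ₗ (e.symm : LinearMap.range J →ₗ[ℂ] V)) C fun w => by
      obtain ⟨u, rfl⟩ := e.surjective w
      simpa [e] using h u
  obtain ⟨L, hL, -⟩ := exists_extension_norm_eq _ g
  refine ⟨L, fun u => ?_⟩
  have := hL (e u)
  simp only [g, LinearMap.mkContinuous_apply, LinearMap.comp_apply, LinearEquiv.coe_coe,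
    LinearEquiv.symm_apply_apply] at this
  exact this.symm

theorem TemperedDist.exists_factorization (f : TemperedDist d ω) : ∃ (K : ℝ)
    (L : (E d →ᵇ ℂ) × (E d →ᵇ ℂ) →L[ℂ] ℂ), ∀ u : TestSpace d ω, f u = L (weightedPair d ω K u) := by
  obtain ⟨K, C, hC, h⟩ := f.exists_bound
  have hinj : Function.Injective (weightedPair d ω K) := fun u v huv => by
    ext x
    have := congrArg (fun w => w.1 x) huv
    simp only [weightedPair_fst_apply] at this
    exact mul_left_cancel₀ (by exact_mod_cast (exp_pos _).ne') this
  exact ⟨K, exists_clm_comp_eq _ hinj (f : TestSpace d ω →ₗ[ℂ] ℂ) C h⟩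

/-- Continuity with respect to all the weighted sup norms. -/
def ContinuousFamily {X : Type*} [TopologicalSpace X] (F : X → TestSpace d ω) : Prop :=
  ∀ K, Continuous fun x => weightedPair d ω K (F x)

theorem ContinuousFamily.continuous_apply {X : Type*} [TopologicalSpace X] {F : X → TestSpace d ω}
    (hF : ContinuousFamily F) (f : TemperedDist d ω) : Continuous fun x => f (F x) := by
  obtain ⟨K, L, hL⟩ := f.exists_factorization
  simp only [hL]
  exact L.continuous.comp (hF K)

/-! ### Applying a distribution under an integral sign. -/

section interchange

variable {X : Type*} [TopologicalSpace X] [MeasurableSpace X] [OpensMeasurableSpace X]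
  {μ : Measure X} {F : X → TestSpace d ω}

theorem TemperedDist.integrable_apply (f : TemperedDist d ω) (hF : ContinuousFamily F)
    (hi : ∀ K, Integrable (fun x => testNorm K (F x)) μ) : Integrable (fun x => f (F x)) μ := by
  obtain ⟨K, C, hC, h⟩ := f.exists_bound
  exact ((hi K).const_mul C).mono' (hF.continuous_apply f).aestronglyMeasurable
    (Eventually.of_forall fun x => h _)

/-- A distribution commutes with integrals of continuous families of test functions. -/
theorem TemperedDist.apply_eq_integral [SecondCountableTopology X] (f : TemperedDist d ω) (hF : ContinuousFamily F)
    (hi : ∀ K, Integrable (fun x => testNorm K (F x)) μ) {G : TestSpace d ω}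
    (hG : ∀ y, G y = ∫ x, F x y ∂μ) (hG' : ∀ y, hat G y = ∫ x, hat (F x) y ∂μ) :
    f G = ∫ x, f (F x) ∂μ := by
  obtain ⟨K, L, hL⟩ := f.exists_factorization
  -- The target Banach space need not be separable, so strong measurability is drawn from second
  -- countability of the parameter space.
  have : SecondCountableTopologyEither X ((E d →ᵇ ℂ) × (E d →ᵇ ℂ)) :=
    secondCountableTopologyEither_of_left _ _
  have hint : Integrable (fun x => weightedPair d ω K (F x)) μ :=
    (integrable_norm_iff (hF K).aestronglyMeasurable).1 (hi K)
  have hint1 := (ContinuousLinearMap.fst ℂ (E d →ᵇ ℂ) (E d →ᵇ ℂ)).integrable_comp hint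
  have hint2 := (ContinuousLinearMap.snd ℂ (E d →ᵇ ℂ) (E d →ᵇ ℂ)).integrable_comp hint
  -- Evaluation at a point is continuous on bounded continuous functions, so the Bochner integral
  -- can be computed pointwise in both components.
  have key : weightedPair d ω K G = ∫ x, weightedPair d ω K (F x) ∂μ := by
    refine Prod.ext ?_ ?_
    · refine Eq.trans ?_ ((ContinuousLinearMap.fst ℂ _ _).integral_comp_comm hint)
      ext y
      refine Eq.trans ?_ ((BoundedContinuousFunction.evalCLM ℂ y).integral_comp_comm hint1)
      change _ = ∫ x, (weightedPair d ω K (F x)).1 y ∂μ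
      simp only [weightedPair_fst_apply]
      rw [hG, integral_const_mul]
    · refine Eq.trans ?_ ((ContinuousLinearMap.snd ℂ _ _).integral_comp_comm hint)
      ext y
      refine Eq.trans ?_ ((BoundedContinuousFunction.evalCLM ℂ y).integral_comp_comm hint2)
      change _ = ∫ x, (weightedPair d ω K (F x)).2 y ∂μ
      simp only [weightedPair_snd_apply]
      rw [hG', integral_const_mul]
  simp only [hL]
  rw [key, L.integral_comp_comm hint]

end interchange

end testLike

end OmegaTempered

namespace OmegaTempered

open Real FourierTransform Filter Topology

/-! ### Operations on test functions -/

section operations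

variable {d : ℕ} {ω : WeightFunction}

/-- The algebra of convolution below is checked on the Fourier side, where convolution is a
pointwise product, translation a character and modulation a shift. -/
theorem hat_injective {u v : TestSpace d ω} (h : hat (u : E d → ℂ) = hat v) : u = v := by
  ext x
  rw [u.testLike.eq_hat_hat, v.testLike.eq_hat_hat, h]

theorem hat_translate_apply (a : E d) (u : TestSpace d ω) (ξ : E d) :
    hat (translate a u) ξ = character (-a) ξ * hat u ξ := congrFun (hat_translate u.1 a) ξ

theorem hat_modulate_apply (ξ : E d) (u : TestSpace d ω) (η : E d) :
    hat (modulate ξ u) η = hat u (η - ξ) := congrFun (hat_modulate u.1 ξ) η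

theorem hat_reflect_apply (u : TestSpace d ω) (ξ : E d) :
    hat (reflect u) ξ = hat u (-ξ) := congrFun (hat_reflect u.1) ξ

theorem hat_conjugate_apply (u : TestSpace d ω) (ξ : E d) :
    hat (conjugate u) ξ = (starRingEnd ℂ) (hat u (-ξ)) := congrFun (hat_conj u.1) ξ

theorem hat_sub_apply (u v : TestSpace d ω) (ξ : E d) : hat (u - v).1 ξ = hat u ξ - hat v ξ := by
  have h : (u - v).1 = u.1 + (-1 : ℂ) • v.1 := by
    rw [neg_one_smul, ← sub_eq_add_neg]; rfl
  rw [h, hat_add u.2.1 (v.2.1.smul _), hat_smul]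
  simp [sub_eq_add_neg]

theorem hat_smul_apply (c : ℂ) (u : TestSpace d ω) (ξ : E d) :
    hat (c • u).1 ξ = c * hat u ξ := congrFun (hat_smul c u.1) ξ

theorem testNorm_smul (K : ℝ) (c : ℂ) (u : TestSpace d ω) :
    testNorm K (c • u) = ‖c‖ * testNorm K u := by
  rw [testNorm, map_smul, norm_smul, testNorm]

theorem testNorm_add_le (K : ℝ) (u v : TestSpace d ω) :
    testNorm K (u + v) ≤ testNorm K u + testNorm K v := by
  rw [testNorm, map_add]
  exact norm_add_le _ _

theorem testNorm_reflect_le (K : ℝ) (u : TestSpace d ω) :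
    testNorm K (reflect u) ≤ testNorm K u := by
  refine testNorm_le (fun x => ?_) (fun x => ?_)
  · have := weightedBound_testNorm K u (-x)
    rwa [norm_neg] at this
  · have := weightedBound_hat_testNorm K u (-x)
    rwa [norm_neg, ← hat_reflect_apply] at this

theorem testNorm_conjugate_le (K : ℝ) (u : TestSpace d ω) :
    testNorm K (conjugate u) ≤ testNorm K u := by
  refine testNorm_le (fun x => ?_) (fun x => ?_)
  · have := weightedBound_testNorm K u x
    rw [← RCLike.norm_conj] at this
    exact this
  · have := weightedBound_hat_testNorm K u (-x)
    rwa [norm_neg, ← RCLike.norm_conj, ← hat_conjugate_apply] at this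

theorem weightedBound_translate {K M : ℝ} (hK : 0 ≤ K) {u : E d → ℂ} (h : WeightedBound ω K M u)
    (a : E d) : WeightedBound ω K (exp (K * ω ‖a‖) * M) (fun y => u (y - a)) := fun x =>
  calc _ ≤ exp (K * (ω ‖x - a‖ + ω ‖a‖)) * ‖u (x - a)‖ := by
        gcongr; exact weight_le ω x a
    _ = exp (K * ω ‖a‖) * (exp (K * ω ‖x - a‖) * ‖u (x - a)‖) := by
        rw [mul_add, exp_add]; ring
    _ ≤ _ := by gcongr; exact h _

theorem weightedBound_character_mul {K M : ℝ} {u : E d → ℂ} (h : WeightedBound ω K M u)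
    (a : E d) : WeightedBound ω K M (fun y => character a y * u y) := fun x => by
  rw [norm_mul, norm_character, one_mul]
  exact h x

theorem le_exp_weight_mul {K M : ℝ} (hK : 0 ≤ K) (hM : 0 ≤ M) (a : E d) :
    M ≤ exp (K * ω ‖a‖) * M :=
  le_mul_of_one_le_left hM (one_le_exp (mul_nonneg hK (weight_nonneg ω a)))

theorem testNorm_translate_le {K : ℝ} (hK : 0 ≤ K) (a : E d) (u : TestSpace d ω) :
    testNorm K (translate a u) ≤ exp (K * ω ‖a‖) * testNorm K u := by
  refine testNorm_le (weightedBound_translate hK (weightedBound_testNorm K u) a) fun x => ?_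
  rw [hat_translate_apply]
  exact (weightedBound_character_mul (weightedBound_hat_testNorm K u) _ x).trans
    (le_exp_weight_mul hK (testNorm_nonneg _ _) a)

theorem testNorm_modulate_le {K : ℝ} (hK : 0 ≤ K) (ξ : E d) (u : TestSpace d ω) :
    testNorm K (modulate ξ u) ≤ exp (K * ω ‖ξ‖) * testNorm K u := by
  refine testNorm_le (fun x => ?_) (fun x => ?_)
  · exact (weightedBound_character_mul (weightedBound_testNorm K u) _ x).trans
      (le_exp_weight_mul hK (testNorm_nonneg _ _) ξ)
  · rw [hat_modulate_apply]
    exact weightedBound_translate hK (weightedBound_hat_testNorm K u) ξ x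

theorem character_neg_arg (ξ y : E d) : character ξ (-y) = character (-ξ) y := by
  simp [character]

theorem character_zero (y : E d) : character 0 y = 1 := by simp [character]

theorem conj_character (ξ y : E d) : (starRingEnd ℂ) (character ξ y) = character (-ξ) y := by
  simp [character, ← Complex.exp_conj]

theorem continuous_character₂ : Continuous fun z : E d × E d => character z.1 z.2 := by
  unfold character
  fun_prop

/-! ### Convolution of test functions -/

variable (d ω) in
/-- An exponent making `e^{-K ω}` integrable. -/
noncomputable def critExp : ℝ := (exists_integrable_exp_weight (d := d) ω).choose

theorem critExp_pos : 0 < critExp d ω := (exists_integrable_exp_weight (d := d) ω).choose_spec.1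

theorem integrable_exp_weight {K : ℝ} (hK : critExp d ω ≤ K) :
    Integrable fun x : E d => exp (-(K * ω ‖x‖)) :=
  (exists_integrable_exp_weight (d := d) ω).choose_spec.2 K hK

variable (d ω) in
/-- The integral of `e^{-K ω}` at the critical exponent. -/
noncomputable def critInt : ℝ := ∫ x : E d, exp (-(critExp d ω * ω ‖x‖))

theorem critInt_nonneg : 0 ≤ critInt d ω := integral_nonneg fun _ => (exp_pos _).le

theorem exp_weight_mul_le {K : ℝ} (hK : 0 ≤ K) (x y : E d) :
    exp (-(K * ω ‖y‖)) * exp (-(K * ω ‖x - y‖)) ≤ exp (-(K * ω ‖x‖)) := by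
  rw [← exp_add]
  have h := weight_le ω x y
  gcongr
  nlinarith

theorem exp_weight_add (K L : ℝ) (x : E d) :
    exp (-((K + L) * ω ‖x‖)) = exp (-(K * ω ‖x‖)) * exp (-(L * ω ‖x‖)) := by
  rw [← exp_add]; ring_nf

theorem weightedBound_of_le {K M : ℝ} {u : E d → ℂ} (h : ∀ x, ‖u x‖ ≤ M * exp (-(K * ω ‖x‖))) :
    WeightedBound ω K M u := fun x => by
  have := h x
  rw [exp_neg, ← div_eq_mul_inv, le_div_iff₀ (exp_pos _)] at this
  rwa [mul_comm]

/-- Subadditivity of `ω` transfers the exponent `K` from `y` and `x - y` to `x`; the surplus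
`critExp` in the decay of `u` is spent on integrating in `y`. -/
theorem weightedBound_conv {K M M' : ℝ} (hK : 0 ≤ K) {u v : E d → ℂ}
    (hu : WeightedBound ω (K + critExp d ω) M u) (hv : WeightedBound ω K M' v) :
    WeightedBound ω K (M * M' * critInt d ω) (fun x => ∫ y, u y * v (x - y)) := by
  refine weightedBound_of_le fun x => ?_
  have hM := hu.nonneg
  have hM' := hv.nonneg
  have hi := (integrable_exp_weight (d := d) (ω := ω) le_rfl).const_mul
    (M * M' * exp (-(K * ω ‖x‖)))
  refine (norm_integral_le_of_norm_le hi (Eventually.of_forall fun y => ?_)).trans (le_of_eq ?_)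
  · rw [norm_mul]
    refine (mul_le_mul (hu.norm_le y) (hv.norm_le _) (norm_nonneg _) (by positivity)).trans ?_
    rw [exp_weight_add]
    calc _ = M * M' * (exp (-(K * ω ‖y‖)) * exp (-(K * ω ‖x - y‖)))
          * exp (-(critExp d ω * ω ‖y‖)) := by ring
      _ ≤ _ := by gcongr; exact exp_weight_mul_le hK x y
  · rw [integral_const_mul, critInt]; ring

theorem hat_conv {u v : E d → ℂ} (hu : Integrable u) (hv : Integrable v) :
    hat (fun x => ∫ y, u y * v (x - y)) = fun ξ => hat u ξ * hat v ξ := by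
  funext ξ
  simp only [hat_eq_fourier]
  exact Real.fourier_mul_convolution_eq hu hv _

theorem continuous_conv {u v : E d → ℂ} (hu : Integrable u) (hv : Continuous v)
    (hb : BddAbove (Set.range fun x => ‖v x‖)) : Continuous (fun x => ∫ y, u y * v (x - y)) :=
  hb.continuous_convolution_right_of_integrable (ContinuousLinearMap.mul ℝ ℂ) hu hv

theorem TestSpace.norm_le (u : TestSpace d ω) (x : E d) : ‖u x‖ ≤ testNorm 0 u := by
  simpa using weightedBound_testNorm 0 u x

theorem TestSpace.norm_hat_le (u : TestSpace d ω) (x : E d) : ‖hat u x‖ ≤ testNorm 0 u := by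
  simpa using weightedBound_hat_testNorm 0 u x

theorem testLike_conv (u v : TestSpace d ω) : TestLike ω (fun x => ∫ y, u y * v (x - y)) := by
  refine ⟨continuous_conv u.integrable v.continuous ⟨testNorm 0 v, ?_⟩, fun K hK =>
    ⟨_, weightedBound_conv hK.le (weightedBound_testNorm _ u) (weightedBound_testNorm _ v)⟩,
    fun K hK => ⟨testNorm K u * testNorm 0 v, fun ξ => ?_⟩⟩
  · rintro _ ⟨x, rfl⟩
    exact v.norm_le x
  · rw [hat_conv u.integrable v.integrable, norm_mul, ← mul_assoc]
    exact mul_le_mul (weightedBound_hat_testNorm K u ξ) (v.norm_hat_le ξ) (norm_nonneg _)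
      (testNorm_nonneg _ _)

/-- The convolution of test functions. -/
noncomputable def conv (u v : TestSpace d ω) : TestSpace d ω :=
  ⟨fun x => ∫ y, u y * v (x - y), (testLike_conv u v).mem_testSubmodule⟩

theorem conv_apply (u v : TestSpace d ω) (x : E d) : conv u v x = ∫ y, u y * v (x - y) := rfl

theorem hat_conv_apply (u v : TestSpace d ω) (ξ : E d) : hat (conv u v) ξ = hat u ξ * hat v ξ :=
  congrFun (hat_conv u.integrable v.integrable) ξ

theorem conv_comm (u v : TestSpace d ω) : conv u v = conv v u :=
  hat_injective (by funext ξ; simp only [hat_conv_apply, mul_comm])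

theorem conv_assoc (u v w : TestSpace d ω) : conv (conv u v) w = conv u (conv v w) :=
  hat_injective (by funext ξ; simp only [hat_conv_apply, mul_assoc])

theorem modulate_conv (ξ : E d) (u v : TestSpace d ω) :
    modulate ξ (conv u v) = conv (modulate ξ u) (modulate ξ v) :=
  hat_injective (by funext η; simp only [hat_conv_apply, hat_modulate_apply])

theorem translate_conv (a : E d) (u v : TestSpace d ω) :
    translate a (conv u v) = conv u (translate a v) :=
  hat_injective (by funext η; simp only [hat_conv_apply, hat_translate_apply]; ring)

theorem modulate_modulate (ξ η : E d) (u : TestSpace d ω) :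
    modulate ξ (modulate η u) = modulate (ξ + η) u := by
  ext y
  change character ξ y * (character η y * u y) = character (ξ + η) y * u y
  rw [character_add, mul_assoc]

theorem translate_translate (a b : E d) (u : TestSpace d ω) :
    translate a (translate b u) = translate (a + b) u := by
  ext y
  change u (y - a - b) = u (y - (a + b))
  rw [sub_sub]

theorem modulate_zero (u : TestSpace d ω) : modulate 0 u = u := by
  ext y
  change character 0 y * u y = u y
  rw [character_zero, one_mul]

theorem translate_zero (u : TestSpace d ω) : translate 0 u = u := by
  ext y
  change u (y - 0) = u y
  rw [sub_zero]

/-- A common modulation factors out of a convolution, so only the frequency difference counts. This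
makes the kernel of the change of windows a convolution kernel in frequency. -/
theorem norm_conv_modulate (ζ η : E d) (b χ : TestSpace d ω) (z : E d) :
    ‖conv (modulate ζ b) (modulate η χ) z‖ = ‖conv (modulate (ζ - η) b) χ z‖ := by
  have h : conv (modulate ζ b) (modulate η χ) = modulate η (conv (modulate (ζ - η) b) χ) := by
    rw [modulate_conv, modulate_modulate, add_sub_cancel]
  rw [h]
  change ‖character η z * _‖ = _
  rw [norm_mul, norm_character, one_mul]

theorem conv_sub_left (u v w : TestSpace d ω) : conv (u - v) w = conv u w - conv v w :=
  hat_injective (by funext ξ; simp only [hat_conv_apply, hat_sub_apply, sub_mul])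

theorem conv_add_right (u v w : TestSpace d ω) : conv u (v + w) = conv u v + conv u w := by
  refine hat_injective ?_
  funext ξ
  rw [hat_conv_apply]
  refine (congrArg _ (congrFun (hat_add v.2.1 w.2.1) ξ)).trans ?_
  refine Eq.trans ?_ (congrFun (hat_add (conv u v).2.1 (conv u w).2.1) ξ).symm
  simp only [Pi.add_apply, hat_conv_apply, mul_add]

theorem conv_smul_right (c : ℂ) (u v : TestSpace d ω) : conv u (c • v) = c • conv u v := by
  refine hat_injective ?_
  funext ξ
  simp only [hat_conv_apply, hat_smul_apply, mul_left_comm]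

/-- The factor `critInt d ω + 1` serves both halves of the norm: the convolution costs `critInt`,
the product of transforms costs `1`. -/
theorem testNorm_conv_le {K : ℝ} (hK : 0 ≤ K) (u v : TestSpace d ω) :
    testNorm K (conv u v) ≤
      testNorm (K + critExp d ω) u * testNorm K v * (critInt d ω + 1) := by
  have h1 := testNorm_nonneg (K + critExp d ω) u
  have h2 := testNorm_nonneg K v
  have h3 := critInt_nonneg (d := d) (ω := ω)
  have h4 : 0 ≤ testNorm (K + critExp d ω) u * testNorm K v := by positivity
  refine testNorm_le (fun x => (weightedBound_conv hK (weightedBound_testNorm _ u)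
    (weightedBound_testNorm _ v) x).trans (by nlinarith)) fun ξ => ?_
  rw [hat_conv_apply, norm_mul, ← mul_assoc]
  have h5 := mul_le_mul ((weightedBound_hat_testNorm (K + critExp d ω) u).mono
    (le_add_of_nonneg_right critExp_pos.le) ξ) (v.norm_hat_le ξ) (norm_nonneg _) h1
  have h6 := testNorm_mono hK v
  have h7 : testNorm (K + critExp d ω) u * testNorm 0 v ≤ testNorm (K + critExp d ω) u
    * testNorm K v := by gcongr
  nlinarith

/-- The involution `φ^*(y) = conj (φ (-y))`. -/
def star (φ : TestSpace d ω) : TestSpace d ω := reflect (conjugate φ)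

theorem star_apply (φ : TestSpace d ω) (y : E d) : star φ y = (starRingEnd ℂ) (φ (-y)) := rfl

theorem hat_star_apply (φ : TestSpace d ω) (ξ : E d) :
    hat (star φ) ξ = (starRingEnd ℂ) (hat φ ξ) := by
  rw [star, hat_reflect_apply, hat_conjugate_apply, neg_neg]

theorem star_star (φ : TestSpace d ω) : star (star φ) = φ := by
  ext y; simp [star_apply]

theorem star_conv (u v : TestSpace d ω) : star (conv u v) = conv (star u) (star v) :=
  hat_injective (by funext ξ; simp only [hat_conv_apply, hat_star_apply, map_mul])

theorem ne_zero_iff {φ : TestSpace d ω} : φ ≠ 0 ↔ ∃ x, φ x ≠ 0 := by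
  constructor
  · intro h
    by_contra! h'
    exact h (TestSpace.ext h')
  · rintro ⟨x, hx⟩ rfl
    exact hx rfl

theorem exists_hat_ne_zero {φ : TestSpace d ω} (h : φ ≠ 0) : ∃ ξ, hat φ ξ ≠ 0 := by
  by_contra! h'
  refine h (hat_injective ?_)
  funext ξ
  rw [h' ξ]
  simp [hat, show ((0 : TestSpace d ω) : E d → ℂ) = 0 from rfl]

theorem star_ne_zero {φ : TestSpace d ω} (h : φ ≠ 0) : star φ ≠ 0 := by
  obtain ⟨x, hx⟩ := ne_zero_iff.1 h
  exact ne_zero_iff.2 ⟨-x, by simpa [star_apply] using hx⟩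

/-- The value is `∫ |φ|^2`. It is the normalising constant of the reproducing formula, so every
nonzero window reproduces. -/
theorem conv_star_apply_zero_ne {φ : TestSpace d ω} (h : φ ≠ 0) : conv φ (star φ) 0 ≠ 0 := by
  have h1 : conv φ (star φ) 0 = ((∫ y, ‖φ y‖ ^ 2 : ℝ) : ℂ) := by
    refine Eq.trans ?_ integral_ofReal
    refine integral_congr_ae (Eventually.of_forall fun y => ?_)
    simp only [star_apply, zero_sub, neg_neg, Complex.mul_conj, Complex.normSq_eq_norm_sq]
    norm_cast
  obtain ⟨x, hx⟩ := ne_zero_iff.1 h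
  have hc : Continuous fun y => ‖φ y‖ ^ 2 := by have := φ.continuous; fun_prop
  have hi : Integrable fun y => ‖φ y‖ ^ 2 := by
    simp only [sq]
    exact φ.integrable.norm.bdd_mul φ.continuous.norm.aestronglyMeasurable
      (Eventually.of_forall fun y => by rw [norm_norm]; exact φ.norm_le y)
  rw [h1]
  refine Complex.ofReal_ne_zero.2 (ne_of_gt ?_)
  refine (integral_pos_iff_support_of_nonneg (fun y => by positivity) hi).2 ?_
  exact hc.isOpen_support.measure_pos volume ⟨x, by simpa using hx⟩

/-! ### Continuity of translation and modulation -/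

theorem continuousFamily_of_tendsto {X : Type*} [TopologicalSpace X] {F : X → TestSpace d ω}
    (h : ∀ x₀, ∀ K : ℝ, 0 < K → Tendsto (fun x => testNorm K (F x - F x₀)) (𝓝 x₀) (𝓝 0)) :
    ContinuousFamily F := fun K => by
  refine continuous_iff_continuousAt.2 fun x₀ => tendsto_iff_norm_sub_tendsto_zero.2 ?_
  refine squeeze_zero (fun _ => norm_nonneg _) (fun x => ?_) (h x₀ (max K 1) (by positivity))
  rw [← map_sub]
  exact testNorm_mono (le_max_left _ _) _

theorem ContinuousFamily.tendsto {X : Type*} [TopologicalSpace X] {F : X → TestSpace d ω}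
    (h : ContinuousFamily F) (x₀ : X) (K : ℝ) :
    Tendsto (fun x => testNorm K (F x - F x₀)) (𝓝 x₀) (𝓝 0) := by
  have := tendsto_iff_norm_sub_tendsto_zero.1 ((h K).tendsto x₀)
  simpa only [← map_sub] using! this

/-- Mean value inequality on the segment from `y` to `y - a`; for `|a| ≤ 1` the weight changes along
it by at most `ω(1)`. -/
theorem exists_weightedBound_translate_sub {v : E d → ℂ} (hv : RapidDecay ω v) {K : ℝ}
    (hK : 0 < K) : ∃ C, ∀ a : E d, ‖a‖ ≤ 1 →
      WeightedBound ω K (C * ‖a‖) (fun y => v (y - a) - v y) := by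
  obtain ⟨C, hC0, hC⟩ := hv.bound hK 1
  refine ⟨C * exp (K * ω 1), fun a ha => weightedBound_of_le fun y => ?_⟩
  have hd : Differentiable ℝ v := hv.1.differentiable (by simp)
  have key := (convex_segment y (y - a)).norm_image_sub_le_of_norm_fderiv_le (𝕜 := ℝ)
    (f := v) (C := C * exp (K * ω 1) * exp (-(K * ω ‖y‖))) (fun z _ => hd z) (fun z hz => ?_)
    (left_mem_segment _ _ _) (right_mem_segment _ _ _)
  · rw [sub_sub_cancel_left, norm_neg] at key
    calc _ ≤ _ := key
      _ = _ := by ring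
  · have hzy : ‖y - z‖ ≤ ‖a‖ := by
      have := norm_sub_le_of_mem_segment hz
      rw [norm_sub_rev]
      simpa using this
    have hw : ω ‖y‖ ≤ ω ‖z‖ + ω 1 := by
      have h3 := weight_le ω y (y - z)
      rw [sub_sub_cancel] at h3
      have h4 : ω ‖y - z‖ ≤ ω 1 := ω.mono (norm_nonneg _) (by simp) (hzy.trans ha)
      linarith
    have h2 := hC z
    rw [norm_iteratedFDeriv_one, mul_comm, ← le_div_iff₀ (exp_pos _), div_eq_mul_inv,
      ← exp_neg] at h2
    refine h2.trans ?_
    rw [mul_assoc, ← exp_add]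
    gcongr
    nlinarith

theorem norm_character_sub_one_le (a y : E d) : ‖character a y - 1‖ ≤ ‖a‖ * ‖y‖ := by
  rw [character]
  have := Real.norm_exp_I_mul_ofReal_sub_one_le (x := inner ℝ y a)
  refine this.trans ?_
  rw [mul_comm]
  exact norm_inner_le_norm y a

/-- The factor `|y|` in `|e^{i a·y} - 1| ≤ |a| |y|` is absorbed by a larger exponent of decay. -/
theorem exists_weightedBound_character_sub {v : E d → ℂ} (hv : RapidDecay ω v) {K : ℝ}
    (hK : 0 < K) : ∃ C, ∀ a : E d,
      WeightedBound ω K (C * ‖a‖) (fun y => character a y * v y - v y) := by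
  obtain ⟨K₁, C₁, hK₁, hC₁, h₁⟩ := exists_rpow_le_exp_weight (d := d) ω 1 zero_le_one
  obtain ⟨C, hC0, hC⟩ := hv.bound (lam := K + K₁) (by positivity) 0
  refine ⟨C * C₁, fun a y => ?_⟩
  have h2 := hC y
  rw [norm_iteratedFDeriv_zero] at h2
  have h3 : ‖y‖ ≤ C₁ * exp (K₁ * ω ‖y‖) := by
    have := h₁ y
    rw [rpow_one] at this
    linarith
  have h4 : character a y * v y - v y = (character a y - 1) * v y := by ring
  simp only [h4, norm_mul]
  calc _ ≤ exp (K * ω ‖y‖) * (‖a‖ * (C₁ * exp (K₁ * ω ‖y‖)) * ‖v y‖) := by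
        gcongr
        exact (norm_character_sub_one_le a y).trans (by gcongr)
    _ = C₁ * ‖a‖ * (exp ((K + K₁) * ω ‖y‖) * ‖v y‖) := by rw [add_mul, exp_add]; ring
    _ ≤ C₁ * ‖a‖ * C := by gcongr
    _ = _ := by ring

theorem exists_testNorm_translate_sub_le (φ : TestSpace d ω) {K : ℝ} (hK : 0 < K) :
    ∃ C, ∀ a : E d, ‖a‖ ≤ 1 → testNorm K (translate a φ - φ) ≤ C * ‖a‖ := by
  obtain ⟨C, hC⟩ := exists_weightedBound_translate_sub φ.2.2.1 hK
  obtain ⟨C', hC'⟩ := exists_weightedBound_character_sub φ.2.2.2 hK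
  refine ⟨max C C', fun a ha => testNorm_le (fun x => (hC a ha x).trans ?_) (fun x => ?_)⟩
  · gcongr; exact le_max_left _ _
  · rw [hat_sub_apply, hat_translate_apply]
    refine (hC' (-a) x).trans ?_
    rw [norm_neg]
    gcongr; exact le_max_right _ _

theorem exists_testNorm_modulate_sub_le (φ : TestSpace d ω) {K : ℝ} (hK : 0 < K) :
    ∃ C, ∀ a : E d, ‖a‖ ≤ 1 → testNorm K (modulate a φ - φ) ≤ C * ‖a‖ := by
  obtain ⟨C, hC⟩ := exists_weightedBound_translate_sub φ.2.2.2 hK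
  obtain ⟨C', hC'⟩ := exists_weightedBound_character_sub φ.2.2.1 hK
  refine ⟨max C C', fun a ha => testNorm_le (fun x => (hC' a x).trans ?_) (fun x => ?_)⟩
  · gcongr; exact le_max_right _ _
  · rw [hat_sub_apply, hat_modulate_apply]
    refine (hC a ha x).trans ?_
    gcongr; exact le_max_left _ _

theorem modulate_sub (ξ : E d) (u v : TestSpace d ω) :
    modulate ξ (u - v) = modulate ξ u - modulate ξ v := by
  ext y; exact mul_sub _ _ _

theorem continuousFamily_modulate_translate (φ : TestSpace d ω) :
    ContinuousFamily fun z : E d × E d => modulate z.2 (translate z.1 φ) := by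
  refine continuousFamily_of_tendsto fun z₀ K hK => ?_
  obtain ⟨C, hC⟩ := exists_testNorm_translate_sub_le (translate z₀.1 φ) hK
  obtain ⟨C', hC'⟩ := exists_testNorm_modulate_sub_le (translate z₀.1 φ) hK
  have hlim : Tendsto (fun z : E d × E d => exp (K * ω ‖z₀.2‖) *
      (exp (K * ω ‖z.2 - z₀.2‖) * (C * ‖z.1 - z₀.1‖) + C' * ‖z.2 - z₀.2‖)) (𝓝 z₀) (𝓝 0) := by
    have hw := continuous_weight (d := d) ω
    have hc : Continuous fun z : E d × E d => exp (K * ω ‖z₀.2‖) *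
      (exp (K * ω ‖z.2 - z₀.2‖) * (C * ‖z.1 - z₀.1‖) + C' * ‖z.2 - z₀.2‖) := by
      have : Continuous fun z : E d × E d => ω ‖z.2 - z₀.2‖ := hw.comp (by fun_prop)
      fun_prop
    have := hc.tendsto z₀
    simpa using this
  refine squeeze_zero' (Eventually.of_forall fun _ => testNorm_nonneg _ _) ?_ hlim
  have hev : ∀ᶠ z : E d × E d in 𝓝 z₀, ‖z.1 - z₀.1‖ < 1 ∧ ‖z.2 - z₀.2‖ < 1 := by
    have h1 : Continuous fun z : E d × E d => ‖z.1 - z₀.1‖ := by fun_prop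
    have h2 : Continuous fun z : E d × E d => ‖z.2 - z₀.2‖ := by fun_prop
    exact ((h1.tendsto z₀).eventually_lt_const (by simp)).and
      ((h2.tendsto z₀).eventually_lt_const (by simp))
  filter_upwards [hev] with z hz
  set ψ := translate z₀.1 φ with hψ
  -- Separates the increment into a small translation and a small modulation of the fixed function
  -- `ψ`, up to operators bounded near `z₀`.
  have e : modulate z.2 (translate z.1 φ) - modulate z₀.2 ψ
      = modulate z₀.2 (modulate (z.2 - z₀.2) (translate (z.1 - z₀.1) ψ - ψ)
        + (modulate (z.2 - z₀.2) ψ - ψ)) := by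
    rw [modulate_sub, sub_add_sub_cancel, modulate_sub, modulate_modulate, hψ, translate_translate,
      sub_add_cancel, add_sub_cancel]
  rw [e]
  refine (testNorm_modulate_le hK.le _ _).trans ?_
  gcongr
  refine (testNorm_add_le _ _ _).trans (add_le_add ?_ (hC' _ hz.2.le))
  refine (testNorm_modulate_le hK.le _ _).trans ?_
  gcongr
  exact hC _ hz.1.le

theorem continuousFamily_modulate (φ : TestSpace d ω) :
    ContinuousFamily fun ξ : E d => modulate ξ φ := fun K => by
  have := (continuousFamily_modulate_translate φ K).comp (Continuous.prodMk_right (0 : E d))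
  simpa only [Function.comp_def, translate_zero] using this

theorem continuousFamily_translate (φ : TestSpace d ω) :
    ContinuousFamily fun x : E d => translate x φ := fun K => by
  have := (continuousFamily_modulate_translate φ K).comp (Continuous.prodMk_left (0 : E d))
  simpa only [Function.comp_def, modulate_zero] using this

variable {X : Type*} [TopologicalSpace X] {F : X → TestSpace d ω}

theorem ContinuousFamily.smul (hF : ContinuousFamily F) {c : X → ℂ} (hc : Continuous c) :
    ContinuousFamily fun x => c x • F x := fun K => by
  simp only [map_smul]
  exact hc.smul (hF K)

theorem ContinuousFamily.conv_right (hF : ContinuousFamily F) (v : TestSpace d ω) :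
    ContinuousFamily fun x => conv (F x) v := by
  refine continuousFamily_of_tendsto fun x₀ K hK => ?_
  have h := ((hF.tendsto x₀ (K + critExp d ω)).mul_const (testNorm K v)).mul_const (critInt d ω + 1)
  rw [zero_mul, zero_mul] at h
  refine squeeze_zero (fun _ => testNorm_nonneg _ _) (fun x => ?_) h
  rw [← conv_sub_left]
  exact testNorm_conv_le hK.le _ _

theorem ContinuousFamily.conjugate (hF : ContinuousFamily F) :
    ContinuousFamily fun x => conjugate (F x) := by
  refine continuousFamily_of_tendsto fun x₀ K hK => ?_
  refine squeeze_zero (fun _ => testNorm_nonneg _ _) (fun x => ?_) (hF.tendsto x₀ K)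
  have e : OmegaTempered.conjugate (F x) - OmegaTempered.conjugate (F x₀)
      = OmegaTempered.conjugate (F x - F x₀) := by
    ext y; exact (map_sub (starRingEnd ℂ) _ _).symm
  rw [e]
  exact testNorm_conjugate_le _ _

end operations

end OmegaTempered

/-! ### Joint time-frequency decay, regularisations, and the reproducing formula. -/

namespace OmegaTempered

open Real FourierTransform Filter Topology

section reproducing

variable {d : ℕ} {ω : WeightFunction}

/-! ### Joint decay in position and frequency -/

theorem norm_le_integral_norm_hat (u : TestSpace d ω) (x : E d) : ‖u x‖ ≤ ∫ ξ, ‖hat u ξ‖ := by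
  have h := norm_hat_le (hat u) (-x)
  rw [u.testLike.norm_hat_hat, neg_neg] at h
  refine le_trans ?_ h
  exact le_mul_of_one_le_left (norm_nonneg _) (one_le_pow₀ (by linarith [two_le_pi]))

/-- Two one-variable bounds with exponent `2K` are combined. Decay in `y` is that of a convolution,
insensitive to modulation; decay in `ζ` comes from `|u(y)| ≤ ∫ |û|` with `û(η) = b̂(η - ζ) χ̂(η)`.
The better of the two wins, since `2 max(ω(ζ), ω(y)) ≥ ω(ζ) + ω(y)`. -/
theorem exists_conv_modulate_le (b : TestSpace d ω) {K : ℝ} (hK : 0 ≤ K) : ∃ C K' : ℝ, 0 ≤ C ∧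
    ∀ (χ : TestSpace d ω) (ζ y : E d), ‖conv (modulate ζ b) χ y‖ ≤
      C * testNorm K' χ * exp (-(K * ω ‖ζ‖)) * exp (-(K * ω ‖y‖)) := by
  have hcr := critExp_pos (d := d) (ω := ω)
  have hI := critInt_nonneg (d := d) (ω := ω)
  set K₁ := 2 * K + critExp d ω with hK₁
  refine ⟨testNorm K₁ b * critInt d ω, K₁, mul_nonneg (testNorm_nonneg _ _) hI, fun χ ζ y => ?_⟩
  set A := testNorm K₁ b * critInt d ω * testNorm K₁ χ with hA
  have hA0 : 0 ≤ A := mul_nonneg (mul_nonneg (testNorm_nonneg _ _) hI) (testNorm_nonneg _ _)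
  have h1 : ‖conv (modulate ζ b) χ y‖ ≤ A * exp (-(2 * K * ω ‖y‖)) := by
    have hb : WeightedBound ω K₁ (testNorm K₁ b) (modulate ζ b) :=
      weightedBound_character_mul (weightedBound_testNorm K₁ b) ζ
    have hχ : WeightedBound ω (2 * K) (testNorm K₁ χ) χ :=
      (weightedBound_testNorm K₁ χ).mono (by linarith)
    have := (weightedBound_conv (by positivity) hb hχ).norm_le y
    rw [conv_apply, hA]
    calc _ ≤ _ := this
      _ = _ := by ring
  have h2 : ‖conv (modulate ζ b) χ y‖ ≤ A * exp (-(2 * K * ω ‖ζ‖)) := by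
    refine (norm_le_integral_norm_hat _ y).trans ?_
    have hi := (integrable_exp_weight (d := d) (ω := ω) le_rfl).const_mul
      (testNorm K₁ b * testNorm K₁ χ * exp (-(2 * K * ω ‖ζ‖)))
    refine (integral_mono_of_nonneg (Eventually.of_forall fun _ => norm_nonneg _) hi
      (Eventually.of_forall fun η => ?_)).trans (le_of_eq ?_)
    · have e1 := ((weightedBound_hat_testNorm K₁ b).mono (lam := 2 * K) (by linarith)).norm_le (η - ζ)
      have e2 := (weightedBound_hat_testNorm K₁ χ).norm_le η
      simp only [hat_conv_apply, hat_modulate_apply, norm_mul]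
      refine (mul_le_mul e1 e2 (norm_nonneg _)
        (mul_nonneg (testNorm_nonneg _ _) (exp_pos _).le)).trans ?_
      have e3 := exp_weight_mul_le (ω := ω) (K := 2 * K) (by positivity) ζ η
      rw [hK₁, exp_weight_add, ← hK₁, norm_sub_rev η ζ]
      have := testNorm_nonneg K₁ b
      have := testNorm_nonneg K₁ χ
      calc _ = testNorm K₁ b * testNorm K₁ χ * (exp (-(2 * K * ω ‖η‖)) *
            exp (-(2 * K * ω ‖ζ - η‖))) * exp (-(critExp d ω * ω ‖η‖)) := by ring
        _ ≤ _ := by gcongr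
    · rw [integral_const_mul, hA, critInt]; ring
  have e : testNorm K₁ b * critInt d ω * testNorm K₁ χ * exp (-(K * ω ‖ζ‖)) * exp (-(K * ω ‖y‖))
      = A * exp (-(K * ω ‖ζ‖) + -(K * ω ‖y‖)) := by rw [exp_add, ← hA]; ring
  rw [e]
  rcases le_total (ω ‖ζ‖) (ω ‖y‖) with h | h
  · refine h1.trans ?_
    gcongr
    nlinarith
  · refine h2.trans ?_
    gcongr
    nlinarith

/-- Upgrades the joint decay to the norms of the test space, so that distributions can be integrated
over `ζ`. -/
theorem exists_testNorm_conv_modulate_le (b : TestSpace d ω) {L K : ℝ} (hL : 0 ≤ L) (hK : 0 ≤ K) :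
    ∃ C K' : ℝ, 0 ≤ C ∧ ∀ (χ : TestSpace d ω) (ζ : E d),
      testNorm L (conv (modulate ζ b) χ) ≤ C * testNorm K' χ * exp (-(K * ω ‖ζ‖)) := by
  obtain ⟨C, K', hC, h⟩ := exists_conv_modulate_le b (add_nonneg hL hK)
  set K₁ := max K' (L + K)
  have hmax : 0 ≤ max C (testNorm K b) := le_max_of_le_left hC
  refine ⟨max C (testNorm K b), K₁, hmax, fun χ ζ => ?_⟩
  have hχ := testNorm_nonneg K₁ χ
  have hχ' := testNorm_nonneg K' χ
  refine testNorm_le (weightedBound_of_le fun x => (h χ ζ x).trans ?_)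
    (weightedBound_of_le fun η => ?_)
  · have h1 : testNorm K' χ ≤ testNorm K₁ χ := testNorm_mono (le_max_left _ _) χ
    have := weight_nonneg ω ζ
    have := weight_nonneg ω x
    gcongr
    · exact le_max_left _ _
    · linarith
    · linarith
  · have e1 := (weightedBound_hat_testNorm K b).norm_le (η - ζ)
    have e2 := ((weightedBound_hat_testNorm K₁ χ).mono (le_max_right _ _)).norm_le η
    rw [hat_conv_apply, hat_modulate_apply, norm_mul]
    refine (mul_le_mul e1 e2 (norm_nonneg _)
        (mul_nonneg (testNorm_nonneg _ _) (exp_pos _).le)).trans ?_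
    have e3 := exp_weight_mul_le (ω := ω) hK ζ η
    rw [exp_weight_add, norm_sub_rev η ζ]
    have hb := testNorm_nonneg K b
    calc _ = testNorm K b * testNorm K₁ χ * (exp (-(K * ω ‖η‖)) *
            exp (-(K * ω ‖ζ - η‖))) * exp (-(L * ω ‖η‖)) := by ring
        _ ≤ testNorm K b * testNorm K₁ χ * exp (-(K * ω ‖ζ‖)) * exp (-(L * ω ‖η‖)) := by gcongr
        _ ≤ _ := by gcongr; exact le_max_right _ _

/-! ### Regularisations -/

/-- The functional `φ ↦ (f * φ)(x)`. -/
noncomputable def regularizeAt (f : TemperedDist d ω) (x : E d) : TemperedDist d ω where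
  toFun φ := regularize f φ x
  map_add' u v := by
    change f _ = f _ + f _
    rw [← map_add]; rfl
  map_smul' c u := by
    change f _ = c * f _
    rw [← smul_eq_mul, ← map_smul]; rfl
  cont := by
    obtain ⟨K, C, hC, h⟩ := f.exists_bound
    let g : TestSpace d ω →ₗ[ℂ] ℂ :=
      { toFun := fun φ => regularize f φ x
        map_add' := fun u v => by
          change f _ = f _ + f _
          rw [← map_add]; rfl
        map_smul' := fun c u => by
          change f _ = c * f _
          rw [← smul_eq_mul, ← map_smul]; rfl }
    have hK : 0 ≤ max K 0 := le_max_right _ _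
    refine continuous_of_testNorm_bound g (K := max K 0) (C := C * exp (max K 0 * ω ‖x‖))
      (by positivity) fun u => (h _).trans ?_
    rw [mul_assoc]
    gcongr
    refine (testNorm_mono (le_max_left _ _) _).trans ((testNorm_translate_le hK _ _).trans ?_)
    gcongr
    exact testNorm_reflect_le _ _

theorem regularizeAt_apply (f : TemperedDist d ω) (x : E d) (φ : TestSpace d ω) :
    regularizeAt f x φ = regularize f φ x := rfl

theorem regularize_translate (f : TemperedDist d ω) (φ : TestSpace d ω) (a x : E d) :
    regularize f (translate a φ) x = regularize f φ (x - a) := by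
  have : translate x (reflect (translate a φ)) = translate (x - a) (reflect φ) := by
    ext y
    change φ (-(y - x) - a) = φ (-(y - (x - a)))
    exact congrArg φ.1 (by abel)
  rw [regularize, this, regularize]

theorem apply_eq_regularize (f : TemperedDist d ω) (χ : TestSpace d ω) :
    f χ = regularize f (reflect χ) 0 := by
  have : translate 0 (reflect (reflect χ)) = χ := by
    ext y
    change χ (- -(y - 0)) = χ y
    simp
  rw [regularize, this]

theorem translate_reflect_modulate (x ξ : E d) (φ : TestSpace d ω) :
    translate x (reflect (modulate ξ φ))
      = character ξ x • modulate (-ξ) (translate x (reflect φ)) := by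
  ext y
  change character ξ (-(y - x)) * φ (-(y - x)) = character ξ x * (character (-ξ) y * φ (-(y - x)))
  rw [← mul_assoc, ← character_neg_arg ξ y, ← character_add_right]
  congr 2
  abel

/-- The bridge from the short-time Fourier transform to convolution: the phase has modulus one and
disappears in every norm. -/
theorem regularize_modulate_star (f : TemperedDist d ω) (φ : TestSpace d ω) (x ξ : E d) :
    regularize f (modulate ξ (star φ)) x = character ξ x * stft φ f x ξ := by
  have : conjugate (modulate ξ (translate x φ))
      = modulate (-ξ) (translate x (reflect (star φ))) := by
    ext y
    change (starRingEnd ℂ) (character ξ y * φ (y - x))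
      = character (-ξ) y * (starRingEnd ℂ) (φ (- -(y - x)))
    rw [map_mul, conj_character, neg_neg]
  rw [regularize, translate_reflect_modulate, map_smul, smul_eq_mul, stft, this]

theorem continuous_stft (f : TemperedDist d ω) (φ : TestSpace d ω) :
    Continuous fun z : E d × E d => stft φ f z.1 z.2 :=
  (continuousFamily_modulate_translate φ).conjugate.continuous_apply f

theorem continuous_regularize_modulate (f : TemperedDist d ω) (φ : TestSpace d ω) :
    Continuous fun z : E d × E d => regularize f (modulate z.2 φ) z.1 := by
  have h : ∀ z : E d × E d, regularize f (modulate z.2 φ) z.1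
      = character z.2 z.1 * stft (star φ) f z.1 z.2 := fun z => by
    rw [← regularize_modulate_star, star_star]
  simp only [h]
  exact (continuous_character₂.comp continuous_swap).mul (continuous_stft f _)

theorem continuous_regularize (f : TemperedDist d ω) (φ : TestSpace d ω) :
    Continuous (regularize f φ) := by
  have := (continuous_regularize_modulate f φ).comp (Continuous.prodMk_left (0 : E d))
  simpa only [Function.comp_def, modulate_zero] using this

/-- The family `y ↦ ψ(y) T_y φ` represents `φ * ψ`. -/
theorem regularize_conv (f : TemperedDist d ω) (φ ψ : TestSpace d ω) (x : E d) :
    Integrable (fun y => regularize f φ (x - y) * ψ y) ∧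
    regularize f (conv φ ψ) x = ∫ y, regularize f φ (x - y) * ψ y := by
  have hF : ContinuousFamily fun y : E d => ψ y • translate y φ :=
    (continuousFamily_translate φ).smul ψ.continuous
  have e : ∀ y, regularizeAt f x (ψ y • translate y φ) = regularize f φ (x - y) * ψ y := fun y => by
    rw [map_smul, regularizeAt_apply, regularize_translate, smul_eq_mul, mul_comm]
  -- Translation by `y` costs `e^{Kω(y)}`, which the decay of `ψ` with exponent `K + critExp` repays
  -- while leaving an integrable factor. The translation bound needs a nonnegative exponent, hence
  -- `max K 0`.
  have hi : ∀ K, Integrable fun y => testNorm K (ψ y • translate y φ) := fun K => by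
    have hK : 0 ≤ max K 0 := le_max_right _ _
    have hb := (weightedBound_testNorm (max K 0 + critExp d ω) ψ)
    refine ((integrable_exp_weight (d := d) (ω := ω) le_rfl).const_mul
      (testNorm (max K 0 + critExp d ω) ψ * testNorm (max K 0) φ)).mono'
      (hF K).norm.aestronglyMeasurable (Eventually.of_forall fun y => ?_)
    rw [norm_of_nonneg (testNorm_nonneg _ _), testNorm_smul]
    have h1 := (testNorm_mono (le_max_left K 0) _).trans (testNorm_translate_le hK y φ)
    refine (mul_le_mul (hb.norm_le y) h1 (testNorm_nonneg _ _)
      (mul_nonneg (testNorm_nonneg _ _) (exp_pos _).le)).trans (le_of_eq ?_)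
    rw [exp_weight_add]
    have : exp (-(max K 0 * ω ‖y‖)) * exp (max K 0 * ω ‖y‖) = 1 := by rw [← exp_add]; simp
    generalize testNorm (max K 0 + critExp d ω) ψ = s, testNorm (max K 0) φ = t,
      exp (-(max K 0 * ω ‖y‖)) = p, exp (max K 0 * ω ‖y‖) = q,
      exp (-(critExp d ω * ω ‖y‖)) = r at this ⊢
    linear_combination s * t * r * this
  refine ⟨by simpa only [e] using (regularizeAt f x).integrable_apply hF hi, ?_⟩
  rw [← regularizeAt_apply, (regularizeAt f x).apply_eq_integral hF hi (fun y => ?_) (fun η => ?_)]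
  · simp only [e]
  · rw [conv_comm]; rfl
  · simp only [hat_smul_apply, hat_translate_apply, hat_conv_apply]
    simp only [← mul_assoc]
    rw [integral_mul_const, mul_comm, hat_eq]
    congr 1
    refine integral_congr_ae (Eventually.of_forall fun y => ?_)
    have e2 : character (-η) y = character (-y) η := by simp [character, real_inner_comm]
    change character (-η) y * ψ y = ψ y * character (-y) η
    rw [e2, mul_comm]

theorem regularize_conv' (f : TemperedDist d ω) (φ ψ : TestSpace d ω) (x : E d) :
    Integrable (fun y => regularize f φ y * ψ (x - y)) ∧
    regularize f (conv φ ψ) x = ∫ y, regularize f φ y * ψ (x - y) := by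
  obtain ⟨h1, h2⟩ := regularize_conv f φ ψ x
  refine ⟨by simpa using h1.comp_sub_left x, h2.trans ?_⟩
  rw [← integral_sub_left_eq_self _ volume x]
  simp

/-! ### The reproducing formula -/

theorem integral_hat (g : TestSpace d ω) : ∫ ξ, hat g ξ = (2 * π) ^ d * g 0 := by
  have h := congrFun g.testLike.hat_hat_eq 0
  simpa [hat] using h

theorem integrable_testNorm_conv_modulate (g χ : TestSpace d ω) (K : ℝ) :
    Integrable fun ξ => testNorm K (conv (modulate ξ g) χ) := by
  obtain ⟨C, K', hC, h⟩ := exists_testNorm_conv_modulate_le g (le_max_right K 0) critExp_pos.le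
  refine ((integrable_exp_weight (d := d) (ω := ω) le_rfl).const_mul (C * testNorm K' χ)).mono'
      ((continuousFamily_modulate g).conv_right χ K).norm.aestronglyMeasurable
      (Eventually.of_forall fun ξ => ?_)
  rw [norm_of_nonneg (testNorm_nonneg _ _)]
  exact (testNorm_mono (le_max_left K 0) _).trans (h χ ξ)

/-- The integrand is the Fourier transform of `z ↦ g(z) χ(y - z)` at `-ξ`; integrating over all
frequencies is Fourier inversion at `0`. -/
theorem integral_conv_modulate (g χ : TestSpace d ω) (y : E d) :
    ∫ ξ, conv (modulate ξ g) χ y = (2 * π) ^ d * g 0 * χ y := by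
  have hk : ∀ ξ, conv (modulate ξ g) χ y = hat (fun z => g z * χ (y - z)) (-ξ) := fun ξ => by
    rw [hat_eq, neg_neg, conv_apply]
    refine integral_congr_ae (Eventually.of_forall fun z => ?_)
    exact mul_assoc _ _ _
  have hc : Continuous fun z => g z * χ (y - z) :=
    g.continuous.mul (χ.continuous.comp (by fun_prop))
  have hi : Integrable fun z => g z * χ (y - z) :=
    g.integrable.mul_bdd (c := testNorm 0 χ)
      (χ.continuous.comp (by fun_prop)).aestronglyMeasurable
      (Eventually.of_forall fun z => χ.norm_le _)
  -- Obtained from the decay in `ξ` of the convolutions, without knowing that the product is a test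
  -- function.
  have hi' : Integrable (hat fun z => g z * χ (y - z)) := by
    have h1 : Integrable fun ξ => hat (fun z => g z * χ (y - z)) (-ξ) := by
      refine (integrable_testNorm_conv_modulate g χ 0).mono'
        ((continuous_hat hi).comp continuous_neg).aestronglyMeasurable
        (Eventually.of_forall fun ξ => ?_)
      rw [← hk]
      exact TestSpace.norm_le _ _
    simpa using h1.comp_neg
  simp only [hk]
  rw [integral_neg_eq_self (fun ξ => hat (fun z => g z * χ (y - z)) ξ)]
  have h := hat_hat hc hi hi' 0
  simp only [neg_zero, sub_zero, ← mul_assoc] at h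
  rw [← h]
  simp [hat]

/-- The superposition of `M_ξ g * χ` is checked pointwise and on the Fourier side, where it reads `∫
ĝ(η - ξ) dξ · χ̂(η)`; then `f` is applied under the integral. -/
theorem regularize_reproducing (f : TemperedDist d ω) (g χ : TestSpace d ω) (x : E d) :
    Integrable (fun ξ => regularize f (conv (modulate ξ g) χ) x) ∧
    (2 * π) ^ d * g 0 * regularize f χ x = ∫ ξ, regularize f (conv (modulate ξ g) χ) x := by
  have hF : ContinuousFamily fun ξ : E d => conv (modulate ξ g) χ :=
    (continuousFamily_modulate g).conv_right χ
  have hi := integrable_testNorm_conv_modulate g χ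
  refine ⟨(regularizeAt f x).integrable_apply hF hi, ?_⟩
  have := (regularizeAt f x).apply_eq_integral hF hi (G := ((2 * π) ^ d * g 0 : ℂ) • χ)
    (fun y => ?_) (fun η => ?_)
  · rw [map_smul, smul_eq_mul] at this
    exact this
  · rw [integral_conv_modulate]; rfl
  · simp only [hat_conv_apply, hat_modulate_apply, hat_smul_apply]
    rw [integral_mul_const, integral_sub_left_eq_self (fun ξ => hat g ξ), integral_hat]

theorem two_pi_pow_ne_zero (d : ℕ) : ((2 * π) ^ d : ℂ) ≠ 0 := by
  exact_mod_cast (by positivity : ((2 * π) ^ d : ℝ) ≠ 0)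

/-- A distribution is determined by its regularisations with convolution products. -/
theorem TemperedDist.eq_of_regularize_conv {φ₀ : TestSpace d ω} (hφ₀ : φ₀ ≠ 0)
    {u v : TemperedDist d ω}
    (h : ∀ (φ ψ : TestSpace d ω) (x : E d), regularize u (conv φ ψ) x = regularize v (conv φ ψ) x) :
    u = v := by
  ext χ
  rw [apply_eq_regularize, apply_eq_regularize v]
  -- The reproducing integrand involves only convolution products, on which `u` and `v` agree.
  have hu := (regularize_reproducing u (conv φ₀ (star φ₀)) (reflect χ) 0).2
  have hv := (regularize_reproducing v (conv φ₀ (star φ₀)) (reflect χ) 0).2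
  refine mul_left_cancel₀ (mul_ne_zero (two_pi_pow_ne_zero d) (conv_star_apply_zero_ne hφ₀)) ?_
  rw [hu, hv]
  simp only [h]

/-- Pointwise estimate of a regularisation in terms of the regularisations by a fixed window. -/
theorem exists_enorm_regularize_le {a b : TestSpace d ω} (hab : conv a b 0 ≠ 0) : ∃ c : ℝ≥0,
    ∀ (f : TemperedDist d ω) (θ : TestSpace d ω) (x : E d), ‖regularize f θ x‖ₑ ≤
      c * ∫⁻ ξ, ∫⁻ y, ‖regularize f (modulate ξ a) (x - y)‖ₑ * ‖conv (modulate ξ b) θ y‖ₑ := by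
  refine ⟨‖((2 * π) ^ d * conv a b 0 : ℂ)⁻¹‖₊, fun f θ x => ?_⟩
  have h := (regularize_reproducing f (conv a b) θ x).2
  have h' : regularize f θ x = ((2 * π) ^ d * conv a b 0 : ℂ)⁻¹ *
      ∫ ξ, regularize f (conv (modulate ξ (conv a b)) θ) x := by
    rw [← h, inv_mul_cancel_left₀ (mul_ne_zero (two_pi_pow_ne_zero d) hab)]
  rw [h', enorm_mul]
  refine mul_le_mul' le_rfl ((enorm_integral_le_lintegral_enorm _).trans ?_)
  refine lintegral_mono fun ξ => ?_
  -- `M_ξ(a * b) * θ = M_ξ a * (M_ξ b * θ)`: the factor with `a` regularises `f`, the rest becomes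
  -- the kernel.
  rw [modulate_conv, conv_assoc, (regularize_conv f _ _ x).2]
  refine (enorm_integral_le_lintegral_enorm _).trans (le_of_eq ?_)
  simp only [enorm_mul]

end reproducing

end OmegaTempered

namespace OmegaTempered

open Real Filter Topology

/-! ### Integral inequalities for functions with values in `[0, ∞]` -/

section inequalities

variable {X Y : Type*} [MeasurableSpace X] [MeasurableSpace Y] {μ : Measure X} {ν : Measure Y}

theorem eLpNorm_ennreal_top (f : X → ℝ≥0∞) : eLpNorm f ∞ μ = essSup f μ := by
  simp [eLpNorm_exponent_top, eLpNormEssSup_eq_essSup_enorm]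

theorem eLpNorm_ennreal {p : ℝ≥0∞} (hp : 1 ≤ p) (hp' : p ≠ ∞) (f : X → ℝ≥0∞) :
    eLpNorm f p μ = (∫⁻ x, f x ^ p.toReal ∂μ) ^ (1 / p.toReal) := by
  simp [eLpNorm_eq_lintegral_rpow_enorm_toReal (zero_lt_one.trans_le hp).ne' hp']

theorem eLpNorm_ennreal_rpow {p : ℝ≥0∞} (hp : 1 ≤ p) (hp' : p ≠ ∞) (f : X → ℝ≥0∞) :
    eLpNorm f p μ ^ p.toReal = ∫⁻ x, f x ^ p.toReal ∂μ := by
  have : p.toReal ≠ 0 := (ENNReal.toReal_pos (zero_lt_one.trans_le hp).ne' hp').ne'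
  rw [eLpNorm_ennreal hp hp', ← ENNReal.rpow_mul, one_div_mul_cancel this, ENNReal.rpow_one]

theorem eLpNorm_ennreal_mono {p : ℝ≥0∞} {f g : X → ℝ≥0∞} (h : ∀ x, f x ≤ g x) :
    eLpNorm f p μ ≤ eLpNorm g p μ := eLpNorm_mono_enorm (by simpa using h)

theorem one_le_toReal {p : ℝ≥0∞} (hp : 1 ≤ p) (hp' : p ≠ ∞) : 1 ≤ p.toReal := by
  rw [← ENNReal.toReal_one]
  exact (ENNReal.toReal_le_toReal ENNReal.one_ne_top hp').2 hp

theorem eLpNorm_ennreal_const_mul {p : ℝ≥0∞} (hp : 1 ≤ p) (c : ℝ≥0∞) {f : X → ℝ≥0∞}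
    (hf : Measurable f) : eLpNorm (fun x => c * f x) p μ = c * eLpNorm f p μ := by
  rcases eq_or_ne p ∞ with rfl | hp'
  · simp only [eLpNorm_ennreal_top, ENNReal.essSup_const_mul]
  · have h1 := one_le_toReal hp hp'
    have h0 : 0 ≤ p.toReal := by linarith
    simp only [eLpNorm_ennreal hp hp', ENNReal.mul_rpow_of_nonneg _ _ h0]
    rw [lintegral_const_mul _ (hf.pow_const _), ENNReal.mul_rpow_of_nonneg _ _ (by positivity),
      ← ENNReal.rpow_mul, mul_one_div_cancel (by positivity), ENNReal.rpow_one]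

/-- Finiteness of the constant replaces measurability of `f`; useful for iterated integrals whose
measurability is not at hand. -/
theorem eLpNorm_ennreal_coe_mul {p : ℝ≥0∞} (hp : 1 ≤ p) (c : ℝ≥0) (f : X → ℝ≥0∞) :
    eLpNorm (fun x => c * f x) p μ = c * eLpNorm f p μ := by
  rcases eq_or_ne p ∞ with rfl | hp'
  · simp only [eLpNorm_ennreal_top, ENNReal.essSup_const_mul]
  · have h1 := one_le_toReal hp hp'
    have h0 : 0 ≤ p.toReal := by linarith
    simp only [eLpNorm_ennreal hp hp', ENNReal.mul_rpow_of_nonneg _ _ h0]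
    rw [lintegral_const_mul' _ _ (ENNReal.rpow_ne_top_of_nonneg h0 ENNReal.coe_ne_top),
      ENNReal.mul_rpow_of_nonneg _ _ (by positivity),
      ← ENNReal.rpow_mul, mul_one_div_cancel (by positivity), ENNReal.rpow_one]

/-- **Hölder's inequality**. -/
theorem eLpNorm_ennreal_mul_le {p q r : ℝ≥0∞} (hp : 1 ≤ p) (hq : 1 ≤ q) (hr : 1 ≤ r)
    (hpqr : p⁻¹ + q⁻¹ = r⁻¹) {f g : X → ℝ≥0∞} (hf : Measurable f) (hg : Measurable g) :
    eLpNorm (fun x => f x * g x) r μ ≤ eLpNorm f p μ * eLpNorm g q μ := by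
  rcases eq_or_ne p ∞ with rfl | hp'
  · have hqr : q = r := by simpa using hpqr
    subst hqr
    rw [← eLpNorm_ennreal_const_mul hr _ hg, eLpNorm_ennreal_top]
    refine eLpNorm_mono_enorm_ae ?_
    filter_upwards [ENNReal.ae_le_essSup (μ := μ) f] with x hx
    simpa using mul_le_mul' hx le_rfl
  rcases eq_or_ne q ∞ with rfl | hq'
  · have hqr : p = r := by simpa using hpqr
    subst hqr
    rw [mul_comm, ← eLpNorm_ennreal_const_mul hr _ hf, eLpNorm_ennreal_top]
    refine eLpNorm_mono_enorm_ae ?_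
    filter_upwards [ENNReal.ae_le_essSup (μ := μ) g] with x hx
    rw [mul_comm]
    simpa using mul_le_mul' hx le_rfl
  have hr' : r ≠ ∞ := by
    rintro rfl
    simp [hp'] at hpqr
  have h1 := one_le_toReal hp hp'
  have h2 := one_le_toReal hq hq'
  have h3 := one_le_toReal hr hr'
  have e : 1 / r.toReal = 1 / p.toReal + 1 / q.toReal := by
    have := congrArg ENNReal.toReal hpqr
    rw [ENNReal.toReal_add (by simpa using (zero_lt_one.trans_le hp).ne')
      (by simpa using (zero_lt_one.trans_le hq).ne')] at this
    simpa using this.symm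
  have hlt : r.toReal < p.toReal := by
    have hq0 : 0 < 1 / q.toReal := by positivity
    exact lt_of_one_div_lt_one_div (by positivity) (by linarith)
  rw [eLpNorm_ennreal hp hp', eLpNorm_ennreal hq hq', eLpNorm_ennreal hr hr']
  exact ENNReal.lintegral_Lp_mul_le_Lq_mul_Lr (by linarith) hlt e μ hf.aemeasurable hg.aemeasurable

theorem lintegral_mul_le_eLpNorm {p q : ℝ≥0∞} (hp : 1 ≤ p) (hq : 1 ≤ q) (hpq : p⁻¹ + q⁻¹ = 1)
    {f g : X → ℝ≥0∞} (hf : Measurable f) (hg : Measurable g) :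
    ∫⁻ x, f x * g x ∂μ ≤ eLpNorm f p μ * eLpNorm g q μ := by
  have := eLpNorm_ennreal_mul_le (μ := μ) hp hq le_rfl (by simpa using hpq) hf hg
  simpa [eLpNorm_one_eq_lintegral_enorm] using this

/-- **Minkowski's integral inequality**. -/
theorem eLpNorm_lintegral_le [SFinite μ] [SFinite ν] {p : ℝ≥0∞} (hp : 1 ≤ p) {F : X → Y → ℝ≥0∞}
    (hF : Measurable (Function.uncurry F)) {N : Y → ℝ≥0∞} (hN : Measurable N)
    (hFN : ∀ y, eLpNorm (fun x => F x y) p μ ≤ N y) (htop : p = ∞ → ∀ x y, F x y ≤ N y) :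
    eLpNorm (fun x => ∫⁻ y, F x y ∂ν) p μ ≤ ∫⁻ y, N y ∂ν := by
  -- For `p = ∞` the bound `htop` holds everywhere, which avoids exceptional null sets depending on
  -- `y`.
  rcases eq_or_ne p ∞ with rfl | hp'
  · rw [eLpNorm_ennreal_top]
    exact essSup_le_of_ae_le _ (Eventually.of_forall fun x => lintegral_mono fun y => htop rfl x y)
  rcases eq_or_ne (∫⁻ y, N y ∂ν) ∞ with htop' | hfin
  · rw [htop']; exact le_top
  have h1 := one_le_toReal hp hp'
  set s := p.toReal with hs
  have hs0 : 0 < s := by linarith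
  have hFs : ∀ y, ∫⁻ x, F x y ^ s ∂μ ≤ N y ^ s := fun y => by
    rw [hs, ← eLpNorm_ennreal_rpow hp hp']
    exact ENNReal.rpow_le_rpow (hFN y) hs0.le
  have hNfin : ∀ᵐ y ∂ν, N y < ∞ := ae_lt_top hN hfin
  -- Needed so that multiplying and dividing by powers of `N` loses nothing where `N` vanishes.
  have hzero : ∀ᵐ x ∂μ, ∀ᵐ y ∂ν, N y = 0 → F x y = 0 := by
    have hm : MeasurableSet {z : X × Y | N z.2 = 0 → F z.1 z.2 = 0} := by
      have e : {z : X × Y | N z.2 = 0 → F z.1 z.2 = 0}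
          = {z : X × Y | N z.2 = 0}ᶜ ∪ {z | Function.uncurry F z = 0} := by
        ext z; simp [imp_iff_not_or, Function.uncurry]
      rw [e]
      exact ((hN.comp measurable_snd) (measurableSet_singleton 0)).compl.union
        (hF (measurableSet_singleton 0))
    rw [Measure.ae_ae_comm hm]
    refine Eventually.of_forall fun y => ?_
    by_cases hy : N y = 0
    · have h0 : ∫⁻ x, F x y ^ s ∂μ = 0 := le_antisymm ((hFs y).trans (by simp [hy, hs0])) zero_le
      have hmy : Measurable fun x => F x y := hF.comp measurable_prodMk_right
      rw [lintegral_eq_zero_iff (hmy.pow_const s)] at h0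
      filter_upwards [h0] with x hx _
      simpa [hs0, hs0.not_gt] using hx
    · exact Eventually.of_forall fun x h => absurd h hy
  have hpow : Measurable fun z : X × Y => F z.1 z.2 ^ s * N z.2 ^ (1 - s) :=
    (hF.pow_const s).mul ((hN.comp measurable_snd).pow_const _)
  -- Hölder with exponents `1/s` and `1 - 1/s` for `F = (F^s N^{1-s})^{1/s} N^{1-1/s}`. Integrating
  -- in `x` then costs only `∫ F^s dx ≤ N^s`.
  have key : ∀ᵐ x ∂μ, (∫⁻ y, F x y ∂ν) ^ s ≤
      (∫⁻ y, F x y ^ s * N y ^ (1 - s) ∂ν) * (∫⁻ y, N y ∂ν) ^ (s - 1) := by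
    filter_upwards [hzero] with x hx
    have hle : ∫⁻ y, F x y ∂ν ≤
        ∫⁻ y, (F x y ^ s * N y ^ (1 - s)) ^ (1 / s) * N y ^ (1 - 1 / s) ∂ν := by
      refine lintegral_mono_ae ?_
      filter_upwards [hx, hNfin] with y hy hy'
      rcases eq_or_ne (N y) 0 with h0 | h0
      · simp [hy h0]
      · rw [ENNReal.mul_rpow_of_nonneg _ _ (by positivity), ← ENNReal.rpow_mul,
          mul_one_div_cancel hs0.ne', ENNReal.rpow_one, ← ENNReal.rpow_mul, mul_assoc,
          ← ENNReal.rpow_add _ _ h0 hy'.ne]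
        have : (1 - s) * (1 / s) + (1 - 1 / s) = 0 := by field_simp; ring
        rw [this, ENNReal.rpow_zero, mul_one]
    have hs1 : 1 / s ≤ 1 := by rw [div_le_one hs0]; exact h1
    have hH := ENNReal.lintegral_mul_norm_pow_le (μ := ν)
      (f := fun y => F x y ^ s * N y ^ (1 - s)) (g := N)
      (hpow.comp measurable_prodMk_left).aemeasurable hN.aemeasurable
      (p := 1 / s) (q := 1 - 1 / s) (by positivity) (by linarith) (by ring)
    refine (ENNReal.rpow_le_rpow (hle.trans hH) hs0.le).trans (le_of_eq ?_)
    rw [ENNReal.mul_rpow_of_nonneg _ _ hs0.le, ← ENNReal.rpow_mul, ← ENNReal.rpow_mul,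
      one_div_mul_cancel hs0.ne', ENNReal.rpow_one]
    congr 2
    field_simp
  have hI : ∫⁻ x, (∫⁻ y, F x y ∂ν) ^ s ∂μ ≤ (∫⁻ y, N y ∂ν) ^ s := by
    calc _ ≤ ∫⁻ x, (∫⁻ y, F x y ^ s * N y ^ (1 - s) ∂ν) * (∫⁻ y, N y ∂ν) ^ (s - 1) ∂μ :=
          lintegral_mono_ae key
      _ = (∫⁻ x, ∫⁻ y, F x y ^ s * N y ^ (1 - s) ∂ν ∂μ) * (∫⁻ y, N y ∂ν) ^ (s - 1) :=
          lintegral_mul_const _ hpow.lintegral_prod_right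
      _ = (∫⁻ y, ∫⁻ x, F x y ^ s * N y ^ (1 - s) ∂μ ∂ν) * (∫⁻ y, N y ∂ν) ^ (s - 1) := by
          rw [lintegral_lintegral_swap hpow.aemeasurable]
      _ ≤ (∫⁻ y, N y ∂ν) * (∫⁻ y, N y ∂ν) ^ (s - 1) := by
          gcongr with y
          have hmy : Measurable fun x => F x y := hF.comp measurable_prodMk_right
          rw [lintegral_mul_const _ (hmy.pow_const s)]
          refine (mul_le_mul' (hFs y) le_rfl).trans ?_
          rcases eq_or_ne (N y) 0 with h0 | h0
          · simp [h0, hs0]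
          rcases eq_or_ne (N y) ∞ with h2 | h2
          · simp [h2]
          · rw [← ENNReal.rpow_add _ _ h0 h2]; simp
      _ = _ := by
          have : s = 1 + (s - 1) := by ring
          conv_rhs => rw [this]
          rw [ENNReal.rpow_add_of_nonneg _ _ zero_le_one (by linarith), ENNReal.rpow_one]
  rw [eLpNorm_ennreal hp hp', ← hs]
  calc _ ≤ ((∫⁻ y, N y ∂ν) ^ s) ^ (1 / s) := ENNReal.rpow_le_rpow hI (by positivity)
    _ = _ := by rw [← ENNReal.rpow_mul, mul_one_div_cancel hs0.ne', ENNReal.rpow_one]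

/-- **Young's convolution inequality**. -/
theorem eLpNorm_lconvolution_le {d : ℕ} {p q r : ℝ≥0∞} (hp : 1 ≤ p) (hq : 1 ≤ q) (hr : 1 ≤ r)
    (hpqr : p⁻¹ + q⁻¹ = 1 + r⁻¹) {f g : E d → ℝ≥0∞} (hf : Measurable f) (hg : Measurable g) :
    eLpNorm (f ⋆ₗ g) r volume ≤ eLpNorm f p volume * eLpNorm g q volume := by
  have hmp : ∀ x : E d, MeasurePreserving (fun y : E d => -y + x) volume volume := fun x =>
    (measurePreserving_add_right volume x).comp (Measure.measurePreserving_neg volume)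
  rcases eq_or_ne r ∞ with rfl | hr'
  · rw [eLpNorm_ennreal_top]
    refine essSup_le_of_ae_le _ (Eventually.of_forall fun x => ?_)
    have h := lintegral_mul_le_eLpNorm (μ := (volume : Measure (E d))) hp hq (by simpa using hpqr) hf
      (hg.comp (hmp x).measurable)
    refine h.trans (le_of_eq ?_)
    rw [eLpNorm_comp_measurePreserving hg.aestronglyMeasurable (hmp x)]
  have hp1 : p⁻¹ ≤ 1 := by simpa using hp
  have hq1 : q⁻¹ ≤ 1 := by simpa using hq
  have hrinv : r⁻¹ ≠ 0 := by simpa using hr'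
  have hlt : (1 : ℝ≥0∞) < 1 + r⁻¹ :=
    ENNReal.lt_add_right ENNReal.one_ne_top hrinv
  -- If `p` were infinite, `1/q = 1 + 1/r > 1` would contradict `q ≥ 1`; likewise for `q`.
  have hp' : p ≠ ∞ := by
    rintro rfl
    rw [← hpqr] at hlt
    simp only [ENNReal.inv_top, zero_add] at hlt
    exact absurd hlt (not_lt.2 hq1)
  have hq' : q ≠ ∞ := by
    rintro rfl
    rw [← hpqr] at hlt
    simp only [ENNReal.inv_top, add_zero] at hlt
    exact absurd hlt (not_lt.2 hp1)
  have h1 := one_le_toReal hp hp'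
  have h2 := one_le_toReal hq hq'
  have h3 := one_le_toReal hr hr'
  have e : 1 / p.toReal + 1 / q.toReal = 1 + 1 / r.toReal := by
    have := congrArg ENNReal.toReal hpqr
    rw [ENNReal.toReal_add (by simpa using (zero_lt_one.trans_le hp).ne')
      (by simpa using (zero_lt_one.trans_le hq).ne'), ENNReal.toReal_add ENNReal.one_ne_top
      (by simpa using (zero_lt_one.trans_le hr).ne')] at this
    simpa using this
  rw [eLpNorm_ennreal hp hp', eLpNorm_ennreal hq hq', eLpNorm_ennreal hr hr']
  generalize p.toReal = a at *
  generalize q.toReal = b at *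
  generalize r.toReal = c at *
  have ha0 : 0 < a := by linarith
  have hb0 : 0 < b := by linarith
  have hc0 : 0 < c := by linarith
  have hA : 0 ≤ 1 / a - 1 / c := by
    have : 1 / b ≤ 1 := by rw [div_le_one hb0]; exact h2
    linarith
  have hB : 0 ≤ 1 / b - 1 / c := by
    have : 1 / a ≤ 1 := by rw [div_le_one ha0]; exact h1
    linarith
  set I := ∫⁻ x, f x ^ a with hI
  set J := ∫⁻ x, g x ^ b with hJ
  have hJx : ∀ x : E d, ∫⁻ y, g (-y + x) ^ b = J := fun x =>
    (hmp x).lintegral_comp (hg.pow_const b)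
  have key : ∀ x, (f ⋆ₗ g) x ^ c ≤
      ((fun y => f y ^ a) ⋆ₗ (fun y => g y ^ b)) x *
        (I ^ ((1 / a - 1 / c) * c) * J ^ ((1 / b - 1 / c) * c)) := fun x => by
    -- Three-factor Hölder for `f g = (f^a g^b)^{1/c} (f^a)^{1/a-1/c} (g^b)^{1/b-1/c}`; the
    -- exponents add up to `1` by the relation between `a`, `b` and `c`.
    have hH := ENNReal.lintegral_prod_norm_pow_le (μ := (volume : Measure (E d)))
      (Finset.univ : Finset (Fin 3))
      (f := ![fun y => f y ^ a * g (-y + x) ^ b, fun y => f y ^ a, fun y => g (-y + x) ^ b])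
      (p := ![1 / c, 1 / a - 1 / c, 1 / b - 1 / c]) (fun i _ => ?_) ?_ (fun i _ => ?_)
    · simp only [Fin.prod_univ_three, Matrix.cons_val_zero, Matrix.cons_val_one,
        Matrix.cons_val] at hH
      have hpt : ∀ y, f y * g (-y + x) = (f y ^ a * g (-y + x) ^ b) ^ (1 / c)
          * (f y ^ a) ^ (1 / a - 1 / c) * (g (-y + x) ^ b) ^ (1 / b - 1 / c) := fun y => by
        rw [ENNReal.mul_rpow_of_nonneg _ _ (by positivity), mul_right_comm _ _ ((f y ^ a) ^ _),
          ← ENNReal.rpow_add_of_nonneg _ _ (by positivity) hA, mul_assoc,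
          ← ENNReal.rpow_add_of_nonneg _ _ (by positivity) hB, ← ENNReal.rpow_mul,
          ← ENNReal.rpow_mul]
        have ea : a * (1 / c + (1 / a - 1 / c)) = 1 := by field_simp; ring
        have eb : b * (1 / c + (1 / b - 1 / c)) = 1 := by field_simp; ring
        rw [ea, eb, ENNReal.rpow_one, ENNReal.rpow_one]
      have hle : (f ⋆ₗ g) x ≤ ((fun y => f y ^ a) ⋆ₗ (fun y => g y ^ b)) x ^ (1 / c)
          * I ^ (1 / a - 1 / c) * J ^ (1 / b - 1 / c) := by
        rw [lconvolution_def, lintegral_congr hpt]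
        refine hH.trans (le_of_eq ?_)
        rw [hJx, lconvolution_def]
      refine (ENNReal.rpow_le_rpow hle hc0.le).trans (le_of_eq ?_)
      rw [ENNReal.mul_rpow_of_nonneg _ _ hc0.le, ENNReal.mul_rpow_of_nonneg _ _ hc0.le,
        ← ENNReal.rpow_mul, ← ENNReal.rpow_mul, ← ENNReal.rpow_mul, one_div_mul_cancel hc0.ne',
        ENNReal.rpow_one, mul_assoc]
    · have hgx : Measurable fun y => g (-y + x) := hg.comp (hmp x).measurable
      fin_cases i
      · exact ((hf.pow_const a).mul (hgx.pow_const b)).aemeasurable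
      · exact (hf.pow_const a).aemeasurable
      · exact (hgx.pow_const b).aemeasurable
    · simp only [Fin.sum_univ_three, Matrix.cons_val_zero, Matrix.cons_val_one, Matrix.cons_val]
      linarith
    · fin_cases i
      · simp only [Fin.zero_eta, Matrix.cons_val_zero]; positivity
      · exact hA
      · exact hB
  have hIJ : ∫⁻ x, ((fun y => f y ^ a) ⋆ₗ (fun y => g y ^ b)) x = I * J := by
    simp only [lconvolution_def]
    rw [lintegral_lintegral_swap]
    · have : ∀ y, ∫⁻ x, f y ^ a * g (-y + x) ^ b = f y ^ a * J := fun y => by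
        rw [lintegral_const_mul (f := fun x => g (-y + x) ^ b) _ (by fun_prop),
          lintegral_add_left_eq_self (fun x => g x ^ b)]
      simp only [this]
      rw [lintegral_mul_const _ (hf.pow_const a)]
    · refine Measurable.aemeasurable ?_
      fun_prop
  have hint : ∫⁻ x, (f ⋆ₗ g) x ^ c ≤ I ^ (c / a) * J ^ (c / b) := by
    refine (lintegral_mono key).trans (le_of_eq ?_)
    rw [lintegral_mul_const _ (measurable_lconvolution _ (hf.pow_const a) (hg.pow_const b)), hIJ]
    have ea : c / a = 1 + (1 / a - 1 / c) * c := by field_simp; ring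
    have eb : c / b = 1 + (1 / b - 1 / c) * c := by field_simp; ring
    rw [ea, eb, ENNReal.rpow_add_of_nonneg _ _ zero_le_one (by positivity),
      ENNReal.rpow_add_of_nonneg _ _ zero_le_one (by positivity), ENNReal.rpow_one,
      ENNReal.rpow_one]
    ring
  refine (ENNReal.rpow_le_rpow hint (by positivity)).trans (le_of_eq ?_)
  rw [ENNReal.mul_rpow_of_nonneg _ _ (by positivity), ← ENNReal.rpow_mul, ← ENNReal.rpow_mul]
  congr 2 <;> field_simp

theorem eLpNorm_comp_add_right {d : ℕ} {p : ℝ≥0∞} {f : E d → ℝ≥0∞} (hf : Measurable f) (a : E d) :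
    eLpNorm (fun x => f (x + a)) p volume = eLpNorm f p volume :=
  eLpNorm_comp_measurePreserving hf.aestronglyMeasurable (measurePreserving_add_right volume a)

/-- Nonempty open sets have positive measure. This supplies the everywhere bound that Minkowski's
inequality requires at `p = ∞`. -/
theorem le_eLpNorm_top_of_continuous {d : ℕ} {f : E d → ℝ≥0∞} (hf : Continuous f) (x : E d) :
    f x ≤ eLpNorm f ∞ volume := by
  rw [eLpNorm_ennreal_top, ← iSup_eq_essSup]
  · exact le_iSup f x
  · intro x a ha
    exact ((isOpen_lt continuous_const hf).measure_pos volume ⟨x, ha⟩).ne'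

/-- For `p = ∞` continuity turns the essential supremum into a supremum over a countable dense set;
for finite `p` Tonelli's theorem applies. -/
theorem measurable_eLpNorm_left {d : ℕ} {p : ℝ≥0∞} (hp : 1 ≤ p) {F : E d → E d → ℝ≥0∞}
    (hF : Continuous (Function.uncurry F)) :
    Measurable fun ξ => eLpNorm (fun x => F x ξ) p volume := by
  have hc : ∀ ξ, Continuous fun x => F x ξ := fun ξ => hF.comp (Continuous.prodMk_left ξ)
  rcases eq_or_ne p ∞ with rfl | hp'
  · have e : (fun ξ => eLpNorm (fun x => F x ξ) ∞ volume)
        = fun ξ => ⨆ n, F (TopologicalSpace.denseSeq (E d) n) ξ := by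
      funext ξ
      refine le_antisymm ?_ (iSup_le fun n => le_eLpNorm_top_of_continuous (hc ξ) _)
      rw [eLpNorm_ennreal_top]
      refine essSup_le_of_ae_le _ (Eventually.of_forall fun x => ?_)
      have hcl : IsClosed {x | F x ξ ≤ ⨆ n, F (TopologicalSpace.denseSeq (E d) n) ξ} :=
        isClosed_le (hc ξ) continuous_const
      have : Set.range (TopologicalSpace.denseSeq (E d)) ⊆
          {x | F x ξ ≤ ⨆ n, F (TopologicalSpace.denseSeq (E d) n) ξ} := by
        rintro _ ⟨n, rfl⟩
        exact le_iSup (fun n => F (TopologicalSpace.denseSeq (E d) n) ξ) n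
      have h2 := hcl.closure_subset_iff.2 this
      rw [(TopologicalSpace.denseRange_denseSeq (E d)).closure_eq] at h2
      exact h2 (Set.mem_univ x)
    rw [e]
    exact .iSup fun n => (hF.comp (Continuous.prodMk_right _)).measurable
  · simp only [eLpNorm_ennreal hp hp']
    exact ((hF.measurable.pow_const _).lintegral_prod_left).pow_const _

/-- Mixed norm estimate for integral operators with a convolution kernel. -/
theorem mixed_convolution_le {d : ℕ} {p q : ℝ≥0∞} (hp : 1 ≤ p) (hq : 1 ≤ q)
    {F : E d → E d → ℝ≥0∞} (hF : Continuous (Function.uncurry F)) {k : E d → ℝ≥0∞}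
    (hk : Measurable k) :
    eLpNorm (fun η => eLpNorm
        (fun x => ∫⁻ ξ, ∫⁻ y, F (x - y) ξ * (k y * k (η - ξ))) p volume) q volume ≤
      (∫⁻ y, k y) * (∫⁻ y, k y) * eLpNorm (fun ξ => eLpNorm (fun x => F x ξ) p volume) q volume := by
  set N : E d → ℝ≥0∞ := fun ξ => eLpNorm (fun x => F x ξ) p volume with hN
  have hNm : Measurable N := measurable_eLpNorm_left hp hF
  have hc : ∀ ξ, Continuous fun x => F x ξ := fun ξ => hF.comp (Continuous.prodMk_left ξ)
  have hFm := hF.measurable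
  -- Minkowski's inequality over the pair `(ξ, y)`: translation invariance removes `y` from the
  -- inner norm, leaving a convolution in frequency.
  have h1 : ∀ η, eLpNorm (fun x => ∫⁻ ξ, ∫⁻ y, F (x - y) ξ * (k y * k (η - ξ))) p volume ≤
      (∫⁻ y, k y) * (N ⋆ₗ k) η := fun η => by
    have hm : Measurable fun z : E d × (E d × E d) =>
        F (z.1 - z.2.2) z.2.1 * (k z.2.2 * k (η - z.2.1)) := by
      have : Measurable fun z : E d × (E d × E d) => F (z.1 - z.2.2) z.2.1 :=
        hFm.comp (by fun_prop : Measurable fun z : E d × (E d × E d) => (z.1 - z.2.2, z.2.1))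
      fun_prop
    have e1 : ∀ x, ∫⁻ ξ, ∫⁻ y, F (x - y) ξ * (k y * k (η - ξ)) =
        ∫⁻ z : E d × E d, F (x - z.2) z.1 * (k z.2 * k (η - z.1)) := fun x => by
      have := hm.comp (measurable_prodMk_left (x := x))
      exact (lintegral_prod _ this.aemeasurable).symm
    simp only [e1]
    have hNk : Measurable fun z : E d × E d => N z.1 * (k z.2 * k (η - z.1)) := by fun_prop
    refine (eLpNorm_lintegral_le (ν := (volume : Measure (E d × E d))) hp hm (N := fun z => N z.1 * (k z.2 * k (η - z.1))) hNk
      (fun z => ?_) (fun hpt x z => ?_)).trans (le_of_eq ?_)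
    · have hmz : Measurable fun x => F (x + -z.2) z.1 := ((hc z.1).comp (by fun_prop)).measurable
      simp only [mul_comm _ (k z.2 * k (η - z.1)), sub_eq_add_neg _ z.2]
      rw [eLpNorm_ennreal_const_mul hp _ hmz,
        eLpNorm_comp_add_right (hc z.1).measurable]
    · subst hpt
      exact mul_le_mul' (le_eLpNorm_top_of_continuous (hc z.1) _) le_rfl
    · have hk2 : ∀ ξ, ∫⁻ y, N ξ * (k y * k (η - ξ)) = (∫⁻ y, k y) * (N ξ * k (η - ξ)) := fun ξ => by
        rw [lintegral_const_mul _ (by fun_prop), lintegral_mul_const _ hk]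
        ring
      refine (lintegral_prod _ hNk.aemeasurable).trans ?_
      simp only [hk2]
      rw [lintegral_const_mul _ (by fun_prop), lconvolution_def]
      simp only [sub_eq_neg_add]
  refine (eLpNorm_ennreal_mono h1).trans ?_
  rw [eLpNorm_ennreal_const_mul hq _ (measurable_lconvolution _ hNm hk), mul_assoc]
  refine mul_le_mul' le_rfl ?_
  refine (eLpNorm_lconvolution_le hq le_rfl hq (by rw [inv_one, add_comm]) hNm hk).trans ?_
  rw [mul_comm, eLpNorm_one_eq_lintegral_enorm]
  simp

end inequalities

end OmegaTempered

/-! ### Moderate weights, change of windows, and the convolution estimate. -/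

namespace OmegaTempered

open Real Filter Topology

section modulation

variable {d : ℕ} {ω : WeightFunction}

/-! ### Moderate weights -/

theorem weight_pair_le (ω : WeightFunction) (x ξ y η : E d) :
    ω (√(‖x‖ ^ 2 + ‖ξ‖ ^ 2)) ≤ ω (√(‖y‖ ^ 2 + ‖η‖ ^ 2)) + (ω ‖x - y‖ + ω ‖ξ - η‖) := by
  set s := √(‖y‖ ^ 2 + ‖η‖ ^ 2) with hs
  have hs0 : 0 ≤ s := sqrt_nonneg _
  have hs2 : s ^ 2 = ‖y‖ ^ 2 + ‖η‖ ^ 2 := sq_sqrt (by positivity)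
  have hy : ‖y‖ ≤ s := le_sqrt_of_sq_le (by nlinarith [sq_nonneg ‖η‖])
  have hη : ‖η‖ ≤ s := le_sqrt_of_sq_le (by nlinarith [sq_nonneg ‖y‖])
  have hx : ‖x‖ ≤ ‖x - y‖ + ‖y‖ := by simpa using norm_add_le (x - y) y
  have hξ : ‖ξ‖ ≤ ‖ξ - η‖ + ‖η‖ := by simpa using norm_add_le (ξ - η) η
  have h0 := norm_nonneg (x - y)
  have h1 := norm_nonneg (ξ - η)
  have h2 : √(‖x‖ ^ 2 + ‖ξ‖ ^ 2) ≤ s + (‖x - y‖ + ‖ξ - η‖) := by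
    refine sqrt_le_iff.2 ⟨by positivity, ?_⟩
    have e1 : ‖x‖ ^ 2 ≤ (‖x - y‖ + ‖y‖) ^ 2 := by gcongr
    have e2 : ‖ξ‖ ^ 2 ≤ (‖ξ - η‖ + ‖η‖) ^ 2 := by gcongr
    have e3 : ‖x - y‖ * ‖y‖ ≤ ‖x - y‖ * s := by gcongr
    have e4 : ‖ξ - η‖ * ‖η‖ ≤ ‖ξ - η‖ * s := by gcongr
    nlinarith [mul_nonneg h0 h1]
  refine (ω.mono (sqrt_nonneg _) (Set.mem_Ici.2 (by positivity)) h2).trans ?_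
  refine (ω.subadd _ _ hs0 (by positivity)).trans ?_
  gcongr
  exact ω.subadd _ _ h0 h1

theorem exp_le_exp_abs_mul {s u v w : ℝ} (h : u ≤ v + w) (h' : v ≤ u + w) :
    exp (s * u) ≤ exp (|s| * w) * exp (s * v) := by
  rw [← exp_add]
  gcongr
  rcases abs_cases s with ⟨hs, h0⟩ | ⟨hs, h0⟩ <;> rw [hs] <;> nlinarith

/-- Weights on the time-frequency plane that are moderate with respect to `e^{L ω}`. -/
structure ModerateWeight (ω : WeightFunction) (L : ℝ) (m : E d → E d → ℝ) : Prop where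
  nonneg : 0 ≤ L
  pos : ∀ x ξ, 0 < m x ξ
  continuous : Continuous (Function.uncurry m)
  le : ∀ x ξ y η, m x ξ ≤ exp (L * ω ‖x - y‖) * exp (L * ω ‖ξ - η‖) * m y η

theorem leftWeight_eq (lam mu : ℝ) (x ξ : E d) :
    leftWeight ω lam mu x ξ = exp (lam * ω ‖x‖) * exp (mu * ω ‖ξ‖) := by
  simp [leftWeight, mWeight]

theorem rightWeight_eq (lam mu : ℝ) (x ξ : E d) : rightWeight ω lam mu x ξ =
    exp (|lam| * ω ‖x‖) * (exp (|lam| * ω ‖ξ‖) * exp (-mu * ω ‖ξ‖)) := by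
  simp [rightWeight, mWeight, vWeight]

theorem moderateWeight_tensor (ω : WeightFunction) (s t : ℝ) :
    ModerateWeight ω (max |s| |t|)
      (fun x ξ : E d => exp (s * ω ‖x‖) * exp (t * ω ‖ξ‖)) := by
  have hw := continuous_weight (d := d) ω
  refine ⟨by positivity, fun x ξ => by positivity, ?_, fun x ξ y η => ?_⟩
  · have h1 : Continuous fun z : E d × E d => ω ‖z.1‖ := hw.comp continuous_fst
    have h2 : Continuous fun z : E d × E d => ω ‖z.2‖ := hw.comp continuous_snd
    simp only [Function.uncurry_def]
    fun_prop
  · have key : ∀ (s : ℝ) (x y : E d), exp (s * ω ‖x‖) ≤ exp (|s| * ω ‖x - y‖) * exp (s * ω ‖y‖) :=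
      fun s x y => exp_le_exp_abs_mul (by linarith [weight_le ω x y])
        (by rw [norm_sub_rev x y]; linarith [weight_le ω y x])
    calc _ ≤ (exp (|s| * ω ‖x - y‖) * exp (s * ω ‖y‖)) * (exp (|t| * ω ‖ξ - η‖) * exp (t * ω ‖η‖)) :=
          mul_le_mul (key s x y) (key t ξ η) (by positivity) (by positivity)
      _ ≤ (exp (max |s| |t| * ω ‖x - y‖) * exp (s * ω ‖y‖))
          * (exp (max |s| |t| * ω ‖ξ - η‖) * exp (t * ω ‖η‖)) := by
          have := weight_nonneg ω (x - y)
          have := weight_nonneg ω (ξ - η)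
          gcongr
          · exact le_max_left _ _
          · exact le_max_right _ _
      _ = _ := by ring

theorem moderateWeight_left (ω : WeightFunction) (lam mu : ℝ) :
    ModerateWeight ω (max |lam| |mu|) (leftWeight (d := d) ω lam mu) := by
  have : leftWeight (d := d) ω lam mu = fun x ξ => exp (lam * ω ‖x‖) * exp (mu * ω ‖ξ‖) := by
    funext x ξ; exact leftWeight_eq lam mu x ξ
  rw [this]
  exact moderateWeight_tensor ω lam mu

theorem rightWeight_eq' (lam mu : ℝ) (x ξ : E d) : rightWeight ω lam mu x ξ =
    exp (|lam| * ω ‖x‖) * exp ((|lam| - mu) * ω ‖ξ‖) := by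
  rw [rightWeight_eq, ← exp_add (|lam| * ω ‖ξ‖)]
  congr 2
  ring

theorem moderateWeight_right (ω : WeightFunction) (lam mu : ℝ) :
    ModerateWeight ω (max |(|lam|)| |(|lam| - mu)|) (rightWeight (d := d) ω lam mu) := by
  have : rightWeight (d := d) ω lam mu
      = fun x ξ => exp (|lam| * ω ‖x‖) * exp ((|lam| - mu) * ω ‖ξ‖) := by
    funext x ξ; exact rightWeight_eq' lam mu x ξ
  rw [this]
  exact moderateWeight_tensor ω _ _

theorem moderateWeight_mWeight (ω : WeightFunction) (lam : ℝ) :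
    ModerateWeight ω |lam| (mWeight (d := d) ω lam) := by
  refine ⟨abs_nonneg _, fun x ξ => exp_pos _, ?_, fun x ξ y η => ?_⟩
  · have h : Continuous fun z : E d × E d => ω (√(‖z.1‖ ^ 2 + ‖z.2‖ ^ 2)) :=
      ω.cont.comp_continuous (by fun_prop) fun z => sqrt_nonneg _
    simp only [Function.uncurry_def, mWeight]
    fun_prop
  · rw [← exp_add, ← mul_add]
    refine exp_le_exp_abs_mul (weight_pair_le ω x ξ y η) ?_
    rw [norm_sub_rev x y, norm_sub_rev ξ η]
    exact weight_pair_le ω y η x ξ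

/-- Moderateness compares `(x, ξ)` with `(y, 0)`: the displacement `ξ` in frequency produces the
factor `v_λ(0, ξ)`, and the weights in `μ` and `-μ` cancel. -/
theorem mWeight_le (lam mu : ℝ) (x y ξ : E d) :
    mWeight ω lam x ξ ≤ leftWeight ω lam mu y ξ * rightWeight ω lam mu (x - y) ξ := by
  have h1 := (moderateWeight_mWeight ω lam).le x ξ y 0
  have h2 : mWeight ω lam y 0 = exp (lam * ω ‖y‖) := by simp [mWeight]
  rw [sub_zero, h2] at h1
  refine h1.trans (le_of_eq ?_)
  rw [leftWeight_eq, rightWeight_eq]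
  have : exp (mu * ω ‖ξ‖) * exp (-mu * ω ‖ξ‖) = 1 := by
    rw [← exp_add, neg_mul, add_neg_cancel, exp_zero]
  linear_combination (-(exp (|lam| * ω ‖x - y‖) * exp (|lam| * ω ‖ξ‖) * exp (lam * ω ‖y‖))) * this

/-! ### Modulation norms in terms of regularisations -/

/-- The weighted modulus of `f * (M_ξ a)` at `x`. -/
noncomputable def weightedReg (m : E d → E d → ℝ) (a : TestSpace d ω) (f : TemperedDist d ω)
    (x ξ : E d) : ℝ≥0∞ := ENNReal.ofReal (m x ξ) * ‖regularize f (modulate ξ a) x‖ₑ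

/-- The mixed norm of the weighted moduli of `f * (M_ξ a)`. -/
noncomputable def regNorm (a : TestSpace d ω) (p q : ℝ≥0∞) (m : E d → E d → ℝ)
    (f : TemperedDist d ω) : ℝ≥0∞ :=
  eLpNorm (fun ξ => eLpNorm (fun x => weightedReg m a f x ξ) p volume) q volume

theorem modNorm_eq_regNorm {m : E d → E d → ℝ} (hm : ∀ x ξ, 0 < m x ξ) (φ : TestSpace d ω)
    (p q : ℝ≥0∞) (f : TemperedDist d ω) : modNorm φ p q m f = regNorm (star φ) p q m f := by
  have h : ∀ x ξ, weightedReg m (star φ) f x ξ = ‖(m x ξ : ℂ) * stft φ f x ξ‖ₑ := fun x ξ => by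
    rw [weightedReg, regularize_modulate_star, enorm_mul, enorm_mul, ← ofReal_norm (character ξ x),
      norm_character, ENNReal.ofReal_one, one_mul, ← ofReal_norm (m x ξ : ℂ), Complex.norm_real,
      norm_of_nonneg (hm x ξ).le]
  simp only [modNorm, mixedNorm, regNorm, h, eLpNorm_enorm]

theorem continuous_weightedReg {m : E d → E d → ℝ} (hm : Continuous (Function.uncurry m))
    (a : TestSpace d ω) (f : TemperedDist d ω) :
    Continuous (Function.uncurry (weightedReg m a f)) := by
  -- Multiplication on `[0, ∞]` is not continuous, so the product is formed in the reals first.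
  have h : Function.uncurry (weightedReg m a f) = fun z : E d × E d =>
      ENNReal.ofReal (max (m z.1 z.2) 0 * ‖regularize f (modulate z.2 a) z.1‖) := by
    funext z
    rw [ENNReal.ofReal_mul (le_max_right _ _), ofReal_norm]
    rcases le_total 0 (m z.1 z.2) with h | h
    · simp [Function.uncurry, weightedReg, max_eq_left h]
    · simp [Function.uncurry, weightedReg, max_eq_right h, ENNReal.ofReal_of_nonpos h]
  rw [h]
  exact ENNReal.continuous_ofReal.comp ((hm.max continuous_const).mul
    (continuous_regularize_modulate f a).norm)

theorem mem_modulationSpace_iff {φ : TestSpace d ω} {p q : ℝ≥0∞} {m : E d → E d → ℝ}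
    {f : TemperedDist d ω} : f ∈ modulationSpace φ p q m ↔ modNorm φ p q m f < ∞ :=
  ⟨fun h => h.2, fun h => ⟨(continuous_stft f φ).aestronglyMeasurable, h⟩⟩

/-- The weight `e^{-K ω}` as a function with values in `[0, ∞]`. -/
noncomputable def eDecay (ω : WeightFunction) (K : ℝ) (x : E d) : ℝ≥0∞ :=
  ENNReal.ofReal (exp (-(K * ω ‖x‖)))

theorem continuous_eDecay (K : ℝ) : Continuous (eDecay (d := d) ω K) := by
  have := continuous_weight (d := d) ω
  exact ENNReal.continuous_ofReal.comp (by fun_prop)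

theorem measurable_eDecay (K : ℝ) : Measurable (eDecay (d := d) ω K) :=
  (continuous_eDecay K).measurable

theorem lintegral_eDecay_lt_top {K : ℝ} (hK : critExp d ω ≤ K) :
    ∫⁻ x : E d, eDecay ω K x < ∞ := by
  have h := (integrable_exp_weight (d := d) hK).lintegral_lt_top
  exact h

theorem lintegral_eDecay_ne_top {K : ℝ} (hK : critExp d ω ≤ K) :
    ∫⁻ x : E d, eDecay ω K x ≠ ∞ := (lintegral_eDecay_lt_top hK).ne

/-- Change of the window. -/
theorem exists_regNorm_le {a : TestSpace d ω} (ha : a ≠ 0) (a' : TestSpace d ω) {p q : ℝ≥0∞}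
    (hp : 1 ≤ p) (hq : 1 ≤ q) {L : ℝ} {m : E d → E d → ℝ} (hm : ModerateWeight ω L m) :
    ∃ C : ℝ≥0, ∀ f : TemperedDist d ω, regNorm a' p q m f ≤ C * regNorm a p q m f := by
  obtain ⟨c, hc⟩ := exists_enorm_regularize_le (conv_star_apply_zero_ne ha)
  -- The part `L` of the exponent compensates the moderateness of `m`; the part `critExp` remains as
  -- an integrable kernel in each variable.
  obtain ⟨C₁, K', hC₁, h₁⟩ := exists_conv_modulate_le (star a)
    (add_nonneg hm.nonneg (critExp_pos (d := d) (ω := ω)).le)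
  set D := C₁ * testNorm K' a' with hD
  have hD0 : 0 ≤ D := mul_nonneg hC₁ (testNorm_nonneg _ _)
  set k : E d → ℝ≥0∞ := eDecay ω (critExp d ω) with hk
  have hkm : Measurable k := measurable_eDecay _
  have hki : ∫⁻ y, k y ≠ ∞ := lintegral_eDecay_ne_top le_rfl
  refine ⟨c * D.toNNReal * ((∫⁻ y, k y).toNNReal * (∫⁻ y, k y).toNNReal), fun f => ?_⟩
  have hpt : ∀ x η, weightedReg m a' f x η ≤
      (c * D.toNNReal : ℝ≥0) * ∫⁻ ξ, ∫⁻ y, weightedReg m a f (x - y) ξ * (k y * k (η - ξ)) := by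
    intro x η
    refine (mul_le_mul' le_rfl (hc f (modulate η a') x)).trans ?_
    rw [ENNReal.coe_mul, mul_left_comm, mul_assoc]
    refine mul_le_mul' le_rfl ?_
    rw [← lintegral_const_mul' _ _ ENNReal.ofReal_ne_top,
      ← lintegral_const_mul' _ _ ENNReal.coe_ne_top]
    refine lintegral_mono fun ξ => ?_
    rw [← lintegral_const_mul' _ _ ENNReal.ofReal_ne_top,
      ← lintegral_const_mul' _ _ ENNReal.coe_ne_top]
    refine lintegral_mono fun y => ?_
    have hb : ‖conv (modulate ξ (star a)) (modulate η a') y‖ ≤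
        D * exp (-((L + critExp d ω) * ω ‖η - ξ‖)) * exp (-((L + critExp d ω) * ω ‖y‖)) := by
      rw [norm_conv_modulate, norm_sub_rev η ξ]
      exact h₁ a' (ξ - η) y
    have hreal : m x η * ‖conv (modulate ξ (star a)) (modulate η a') y‖ ≤
        D * (m (x - y) ξ * (exp (-(critExp d ω * ω ‖y‖)) * exp (-(critExp d ω * ω ‖η - ξ‖)))) := by
      have hmle := hm.le x η (x - y) ξ
      rw [sub_sub_cancel] at hmle
      have hmp := hm.pos (x - y) ξ
      refine (mul_le_mul hmle hb (norm_nonneg _) (by positivity)).trans (le_of_eq ?_)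
      rw [exp_weight_add, exp_weight_add]
      have e1 : exp (L * ω ‖y‖) * exp (-(L * ω ‖y‖)) = 1 := by rw [← exp_add]; simp
      have e2 : exp (L * ω ‖η - ξ‖) * exp (-(L * ω ‖η - ξ‖)) = 1 := by rw [← exp_add]; simp
      generalize exp (L * ω ‖y‖) = A at *
      generalize exp (-(L * ω ‖y‖)) = A' at *
      generalize exp (L * ω ‖η - ξ‖) = B at *
      generalize exp (-(L * ω ‖η - ξ‖)) = B' at *
      generalize exp (-(critExp d ω * ω ‖y‖)) = P at *
      generalize exp (-(critExp d ω * ω ‖η - ξ‖)) = Q at *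
      linear_combination (D * m (x - y) ξ * P * Q * B * B') * e1 + (D * m (x - y) ξ * P * Q) * e2
    have henn := ENNReal.ofReal_le_ofReal hreal
    rw [ENNReal.ofReal_mul (hm.pos _ _).le, ofReal_norm, ENNReal.ofReal_mul hD0,
      ENNReal.ofReal_mul (hm.pos _ _).le, ENNReal.ofReal_mul (exp_pos _).le] at henn
    calc _ = ‖regularize f (modulate ξ a) (x - y)‖ₑ *
          (ENNReal.ofReal (m x η) * ‖conv (modulate ξ (star a)) (modulate η a') y‖ₑ) := by ring
      _ ≤ ‖regularize f (modulate ξ a) (x - y)‖ₑ * _ := mul_le_mul' le_rfl henn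
      _ = _ := by
        rw [weightedReg, hk, eDecay, eDecay]
        change _ = ENNReal.ofReal D * _
        ring
  have hmix := mixed_convolution_le hp hq (continuous_weightedReg hm.continuous a f) hkm
  calc regNorm a' p q m f ≤ eLpNorm (fun η => eLpNorm (fun x => (c * D.toNNReal : ℝ≥0) *
        ∫⁻ ξ, ∫⁻ y, weightedReg m a f (x - y) ξ * (k y * k (η - ξ))) p volume) q volume :=
        eLpNorm_ennreal_mono fun η => eLpNorm_ennreal_mono fun x => hpt x η
    _ ≤ (c * D.toNNReal : ℝ≥0) * ((∫⁻ y, k y) * (∫⁻ y, k y) * regNorm a p q m f) := by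
        simp only [eLpNorm_ennreal_coe_mul hp, eLpNorm_ennreal_coe_mul hq]
        exact mul_le_mul' le_rfl hmix
    _ = _ := by
        rw [ENNReal.coe_mul _ (_ * _), ENNReal.coe_mul (∫⁻ y, k y).toNNReal,
          ENNReal.coe_toNNReal hki]
        ring

/-! ### The norm inequality with constant one -/

theorem IsConvolution.regularize_conv_eq {f h u : TemperedDist d ω} (hu : IsConvolution f h u)
    (a b : TestSpace d ω) (x : E d) :
    regularize u (conv a b) x = ∫ y, regularize f a y * regularize h b (x - y) := by
  rw [(hu a b x).2, (regularize_conv' u a b x).2]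

/-- At fixed `ξ` the weighted modulus for `u` is dominated pointwise by the convolution of those for
`f` and `h`. Young in `x` and Hölder in `ξ` both have constant one. -/
theorem regNorm_conv_le {p q r s t t' : ℝ≥0∞} (hp : 1 ≤ p) (hq : 1 ≤ q) (hr : 1 ≤ r) (hs : 1 ≤ s)
    (ht : 1 ≤ t) (ht' : 1 ≤ t') (hpqr : p⁻¹ + q⁻¹ = 1 + r⁻¹) (htt' : t⁻¹ + t'⁻¹ = 1) (lam mu : ℝ)
    (a b : TestSpace d ω) {f h u : TemperedDist d ω} (hu : IsConvolution f h u) :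
    regNorm (conv a b) r s (mWeight ω lam) u ≤
      regNorm a p (s * t) (leftWeight ω lam mu) f * regNorm b q (s * t') (rightWeight ω lam mu) h := by
  have hl := moderateWeight_left (d := d) ω lam mu
  have hrw := moderateWeight_right (d := d) ω lam mu
  have cf := continuous_weightedReg hl.continuous a f
  have ch := continuous_weightedReg hrw.continuous b h
  have hcf : ∀ ξ, Measurable fun x => weightedReg (leftWeight ω lam mu) a f x ξ :=
    fun ξ => (cf.comp (Continuous.prodMk_left ξ)).measurable
  have hch : ∀ ξ, Measurable fun x => weightedReg (rightWeight ω lam mu) b h x ξ :=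
    fun ξ => (ch.comp (Continuous.prodMk_left ξ)).measurable
  have hpt : ∀ ξ x, weightedReg (mWeight ω lam) (conv a b) u x ξ ≤
      ((fun y => weightedReg (leftWeight ω lam mu) a f y ξ) ⋆ₗ
        (fun y => weightedReg (rightWeight ω lam mu) b h y ξ)) x := fun ξ x => by
    rw [weightedReg, modulate_conv, hu.regularize_conv_eq, lconvolution_def]
    have hm : Measurable fun y => ‖regularize f (modulate ξ a) y *
        regularize h (modulate ξ b) (x - y)‖ₑ :=
      ((continuous_regularize f _).mul ((continuous_regularize h _).comp
        (by fun_prop))).measurable.enorm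
    refine (mul_le_mul' le_rfl (enorm_integral_le_lintegral_enorm _)).trans ?_
    rw [← lintegral_const_mul _ hm]
    refine lintegral_mono fun y => ?_
    rw [weightedReg, weightedReg, neg_add_eq_sub, enorm_mul]
    have h1 := ENNReal.ofReal_le_ofReal (mWeight_le (ω := ω) lam mu x y ξ)
    rw [ENNReal.ofReal_mul (hl.pos _ _).le] at h1
    refine (mul_le_mul' h1 le_rfl).trans (le_of_eq ?_)
    ring
  have hs0 : s ≠ 0 := (zero_lt_one.trans_le hs).ne'
  have ht0 : t ≠ 0 := (zero_lt_one.trans_le ht).ne'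
  have ht0' : t' ≠ 0 := (zero_lt_one.trans_le ht').ne'
  have hexp : (s * t)⁻¹ + (s * t')⁻¹ = s⁻¹ := by
    rw [ENNReal.mul_inv (Or.inl hs0) (Or.inr ht0), ENNReal.mul_inv (Or.inl hs0) (Or.inr ht0'),
      ← mul_add, htt', mul_one]
  calc regNorm (conv a b) r s (mWeight ω lam) u ≤ eLpNorm (fun ξ =>
        eLpNorm (fun x => weightedReg (leftWeight ω lam mu) a f x ξ) p volume *
        eLpNorm (fun x => weightedReg (rightWeight ω lam mu) b h x ξ) q volume) s volume :=
        eLpNorm_ennreal_mono fun ξ => (eLpNorm_ennreal_mono (hpt ξ)).trans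
          (eLpNorm_lconvolution_le hp hq hr hpqr (hcf ξ) (hch ξ))
    _ ≤ _ := eLpNorm_ennreal_mul_le (one_le_mul hs ht) (one_le_mul hs ht') hs hexp
        (measurable_eLpNorm_left hp cf) (measurable_eLpNorm_left hq ch)

/-! ### Arbitrary windows on the target space -/

/-- The convolution of two nonzero windows vanishes when their transforms have disjoint supports; a
frequency shift makes the transforms overlap. -/
theorem exists_modulate_conv_ne_zero {a b : TestSpace d ω} (ha : a ≠ 0) (hb : b ≠ 0) :
    ∃ ζ, conv a (modulate ζ b) ≠ 0 := by
  obtain ⟨ξ, hξ⟩ := exists_hat_ne_zero ha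
  obtain ⟨η, hη⟩ := exists_hat_ne_zero hb
  refine ⟨ξ - η, fun h => ?_⟩
  have h1 : hat (conv a (modulate (ξ - η) b)) ξ = 0 := by
    rw [h]
    simp [hat, show ((0 : TestSpace d ω) : E d → ℂ) = 0 from rfl]
  rw [hat_conv_apply, hat_modulate_apply, sub_sub_cancel] at h1
  exact (mul_ne_zero hξ hη) h1

/-- The sharp estimate is used for the nonzero window `a * M_ζ b`; changes of window on the target
and on the second factor give the constant. -/
theorem exists_regNorm_conv_le {p q r s t t' : ℝ≥0∞} (hp : 1 ≤ p) (hq : 1 ≤ q) (hr : 1 ≤ r)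
    (hs : 1 ≤ s) (ht : 1 ≤ t) (ht' : 1 ≤ t') (hpqr : p⁻¹ + q⁻¹ = 1 + r⁻¹) (htt' : t⁻¹ + t'⁻¹ = 1)
    (lam mu : ℝ) {a b : TestSpace d ω} (ha : a ≠ 0) (hb : b ≠ 0) (a' : TestSpace d ω) :
    ∃ C : ℝ≥0, ∀ f h u : TemperedDist d ω, IsConvolution f h u →
      regNorm a' r s (mWeight ω lam) u ≤ C * (regNorm a p (s * t) (leftWeight ω lam mu) f *
        regNorm b q (s * t') (rightWeight ω lam mu) h) := by
  obtain ⟨ζ, hζ⟩ := exists_modulate_conv_ne_zero ha hb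
  obtain ⟨C₁, h₁⟩ := exists_regNorm_le hζ a' hr hs (moderateWeight_mWeight (d := d) ω lam)
  obtain ⟨C₂, h₂⟩ := exists_regNorm_le hb (modulate ζ b) hq (one_le_mul hs ht')
    (moderateWeight_right (d := d) ω lam mu)
  refine ⟨C₁ * C₂, fun f h u hu => ?_⟩
  calc _ ≤ C₁ * regNorm (conv a (modulate ζ b)) r s (mWeight ω lam) u := h₁ u
    _ ≤ C₁ * (regNorm a p (s * t) (leftWeight ω lam mu) f *
        regNorm (modulate ζ b) q (s * t') (rightWeight ω lam mu) h) :=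
        mul_le_mul' le_rfl (regNorm_conv_le hp hq hr hs ht ht' hpqr htt' lam mu _ _ hu)
    _ ≤ C₁ * (regNorm a p (s * t) (leftWeight ω lam mu) f *
        (C₂ * regNorm b q (s * t') (rightWeight ω lam mu) h)) := by
        gcongr; exact h₂ h
    _ = _ := by rw [ENNReal.coe_mul]; ring

end modulation

end OmegaTempered

/-! ### Frequency averages as majorants of regularisations. -/

namespace OmegaTempered

open Real Filter Topology

section existence

variable {d : ℕ} {ω : WeightFunction}

/-! ### Frequency averages -/

/-- The average of `|f * (M_ξ a)|` over all frequencies, weighted by `e^{-K ω(ξ)}`. -/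
noncomputable def freqAverage (K : ℝ) (a : TestSpace d ω) (f : TemperedDist d ω) (y : E d) : ℝ≥0∞ :=
  ∫⁻ ξ, ‖regularize f (modulate ξ a) y‖ₑ * eDecay ω K ξ

theorem measurable_regularize_mul_eDecay (K : ℝ) (a : TestSpace d ω) (f : TemperedDist d ω) :
    Measurable fun z : E d × E d => ‖regularize f (modulate z.2 a) z.1‖ₑ * eDecay ω K z.2 :=
  (continuous_regularize_modulate f a).measurable.enorm.mul
    ((measurable_eDecay K).comp measurable_snd)

theorem lintegral_regularize_mul_eDecay_mul (K : ℝ) (a : TestSpace d ω) (f : TemperedDist d ω)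
    (y : E d) {c : ℝ≥0∞} (hc : c ≠ ∞) (r : ℝ≥0∞) :
    ∫⁻ ξ, c * (‖regularize f (modulate ξ a) y‖ₑ * eDecay ω K ξ) * r = c * (freqAverage K a f y * r) := by
  have h := (measurable_regularize_mul_eDecay K a f).comp
    (measurable_prodMk_left : Measurable fun ξ : E d => (y, ξ))
  simp only [Function.comp_def] at h
  rw [lintegral_mul_const _ (h.const_mul c), lintegral_const_mul' _ _ hc, freqAverage, mul_assoc]

theorem measurable_freqAverage (K : ℝ) (a : TestSpace d ω) (f : TemperedDist d ω) :
    Measurable (freqAverage K a f) :=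
  (measurable_regularize_mul_eDecay K a f).lintegral_prod_right'

theorem eDecay_anti {K K' : ℝ} (h : K ≤ K') (x : E d) : eDecay ω K' x ≤ eDecay ω K x := by
  have := weight_nonneg ω x
  exact ENNReal.ofReal_le_ofReal (by gcongr)

theorem eDecay_ne_top (K : ℝ) (x : E d) : eDecay ω K x ≠ ∞ := ENNReal.ofReal_ne_top

theorem eDecay_le_one {K : ℝ} (hK : 0 ≤ K) (x : E d) : eDecay ω K x ≤ 1 := by
  have := mul_nonneg hK (weight_nonneg ω x)
  rw [eDecay, ← ENNReal.ofReal_one]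
  exact ENNReal.ofReal_le_ofReal (exp_le_one_iff.2 (by linarith))

theorem eDecay_add (K L : ℝ) (x : E d) : eDecay ω (K + L) x = eDecay ω K x * eDecay ω L x := by
  rw [eDecay, exp_weight_add, ENNReal.ofReal_mul (exp_pos _).le]; rfl

theorem eLpNorm_eDecay_lt_top {q : ℝ≥0∞} (hq : 1 ≤ q) {K : ℝ} (hK : critExp d ω ≤ K) :
    eLpNorm (eDecay (d := d) ω K) q volume < ∞ := by
  have hK0 := critExp_pos.le.trans hK
  rcases eq_or_ne q ∞ with rfl | hq'
  · rw [eLpNorm_ennreal_top]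
    exact (essSup_le_of_ae_le _ (Eventually.of_forall fun x => eDecay_le_one hK0 x)).trans_lt
      ENNReal.one_lt_top
  · rw [eLpNorm_ennreal hq hq']
    have h1 := one_le_toReal hq hq'
    refine ENNReal.rpow_lt_top_of_nonneg (by positivity)
      (ne_top_of_le_ne_top (lintegral_eDecay_ne_top hK) (lintegral_mono fun x => ?_))
    simpa using ENNReal.rpow_le_rpow_of_exponent_ge (eDecay_le_one hK0 x) h1

theorem exists_conjugate_exponent {q : ℝ≥0∞} (hq : 1 ≤ q) : ∃ q' : ℝ≥0∞, 1 ≤ q' ∧ q⁻¹ + q'⁻¹ = 1 := by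
  have h : q⁻¹ ≤ 1 := by simpa using hq
  refine ⟨(1 - q⁻¹)⁻¹, ?_, ?_⟩
  · rw [ENNReal.one_le_inv]; exact tsub_le_self
  · rw [inv_inv, add_tsub_cancel_of_le h]

/-- Minkowski moves the `L^p` norm inside the frequency integral, and Hölder pairs the resulting
`L^q` function with `e^{-critExp ω}`. The part `|t|` of the exponent pays for the frequency weight.
-/
theorem eLpNorm_freqAverage_lt_top {p q : ℝ≥0∞} (hp : 1 ≤ p) (hq : 1 ≤ q) {s t K : ℝ}
    (hK : |t| + critExp d ω ≤ K) {a : TestSpace d ω} {f : TemperedDist d ω}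
    (hf : regNorm a p q (fun x ξ => exp (s * ω ‖x‖) * exp (t * ω ‖ξ‖)) f < ∞) :
    eLpNorm (fun y => ENNReal.ofReal (exp (s * ω ‖y‖)) * freqAverage K a f y) p volume < ∞ := by
  obtain ⟨q', hq', hqq⟩ := exists_conjugate_exponent hq
  set m : E d → E d → ℝ := fun x ξ => exp (s * ω ‖x‖) * exp (t * ω ‖ξ‖) with hm
  have hmod : ModerateWeight ω _ m := moderateWeight_tensor ω s t
  have hc := continuous_weightedReg hmod.continuous a f
  have hk := measurable_eDecay (d := d) (ω := ω) (critExp d ω)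
  set N : E d → ℝ≥0∞ := fun ξ => eLpNorm (fun x => weightedReg m a f x ξ) p volume with hN
  have hNm : Measurable N := measurable_eLpNorm_left hp hc
  have hle : ∀ y, ENNReal.ofReal (exp (s * ω ‖y‖)) * freqAverage K a f y ≤
      ∫⁻ ξ, weightedReg m a f y ξ * eDecay ω (critExp d ω) ξ := fun y => by
    rw [freqAverage, ← lintegral_const_mul' _ _ ENNReal.ofReal_ne_top]
    refine lintegral_mono fun ξ => ?_
    have h1 : eDecay ω K ξ ≤ ENNReal.ofReal (exp (t * ω ‖ξ‖)) * eDecay ω (critExp d ω) ξ := by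
      rw [eDecay, eDecay, ← ENNReal.ofReal_mul (exp_pos _).le, ← exp_add]
      refine ENNReal.ofReal_le_ofReal (exp_le_exp.2 ?_)
      have := weight_nonneg ω ξ
      have := neg_abs_le t
      nlinarith
    rw [weightedReg, hm, ENNReal.ofReal_mul (exp_pos _).le]
    calc _ ≤ ENNReal.ofReal (exp (s * ω ‖y‖)) * (‖regularize f (modulate ξ a) y‖ₑ *
          (ENNReal.ofReal (exp (t * ω ‖ξ‖)) * eDecay ω (critExp d ω) ξ)) := by gcongr
      _ = _ := by ring
  refine (eLpNorm_ennreal_mono hle).trans_lt ?_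
  have hF : Measurable (Function.uncurry fun x ξ : E d =>
      weightedReg m a f x ξ * eDecay ω (critExp d ω) ξ) :=
    hc.measurable.mul (hk.comp measurable_snd)
  refine (eLpNorm_lintegral_le (ν := (volume : Measure (E d))) hp hF
    (N := fun ξ => N ξ * eDecay ω (critExp d ω) ξ)
    (hNm.mul hk) (fun ξ => ?_) (fun hpt x ξ => ?_)).trans_lt ?_
  · simp only [mul_comm _ (eDecay ω (critExp d ω) ξ)]
    rw [eLpNorm_ennreal_const_mul (f := fun x => weightedReg m a f x ξ) hp _
      (hc.comp (Continuous.prodMk_left ξ)).measurable]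
  · subst hpt
    exact mul_le_mul' (le_eLpNorm_top_of_continuous (hc.comp (Continuous.prodMk_left ξ)) x) le_rfl
  · exact (lintegral_mul_le_eLpNorm hq hq' hqq hNm hk).trans_lt
      (ENNReal.mul_lt_top hf (eLpNorm_eDecay_lt_top hq' le_rfl))

theorem exp_eDecay_le {lam K : ℝ} (x z : E d) :
    ENNReal.ofReal (exp (|lam| * ω ‖z‖)) * eDecay ω (|lam| + K) (-z + x) ≤
      ENNReal.ofReal (exp (|lam| * ω ‖x‖)) * eDecay ω K (-z + x) := by
  rw [eDecay, eDecay, ← ENNReal.ofReal_mul (exp_pos _).le, ← ENNReal.ofReal_mul (exp_pos _).le,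
    ← exp_add, ← exp_add]
  refine ENNReal.ofReal_le_ofReal (exp_le_exp.2 ?_)
  have h := weight_le ω z x
  rw [neg_add_eq_sub, norm_sub_rev x z]
  have := abs_nonneg lam
  nlinarith

/-- Up to the factor `e^{|λ|ω}`, `A ⋆ B` is bounded by the convolution of the weighted functions,
which is in `L^r` by Young. The exponential kernel absorbs that factor and still lies in the dual
`L^{r'}`, so the value is finite at every point. -/
theorem lconvolution_lt_top {p q r : ℝ≥0∞} (hp : 1 ≤ p) (hq : 1 ≤ q) (hr : 1 ≤ r)
    (hpqr : p⁻¹ + q⁻¹ = 1 + r⁻¹) {lam K : ℝ} (hK : critExp d ω ≤ K) {A B : E d → ℝ≥0∞}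
    (hA : Measurable A) (hB : Measurable B)
    (hA' : eLpNorm (fun y => ENNReal.ofReal (exp (lam * ω ‖y‖)) * A y) p volume < ∞)
    (hB' : eLpNorm (fun y => ENNReal.ofReal (exp (|lam| * ω ‖y‖)) * B y) q volume < ∞) (x : E d) :
    ((A ⋆ₗ B) ⋆ₗ eDecay ω (|lam| + K)) x < ∞ := by
  have hw : Measurable fun y : E d => ω ‖y‖ := (continuous_weight ω).measurable
  set A' : E d → ℝ≥0∞ := fun y => ENNReal.ofReal (exp (lam * ω ‖y‖)) * A y
  set B' : E d → ℝ≥0∞ := fun y => ENNReal.ofReal (exp (|lam| * ω ‖y‖)) * B y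
  have hAm : Measurable A' := by fun_prop
  have hBm : Measurable B' := by fun_prop
  have hk := measurable_eDecay (d := d) (ω := ω) K
  obtain ⟨r', hr', hrr⟩ := exists_conjugate_exponent hr
  have h1 : ∀ z, (A ⋆ₗ B) z ≤ ENNReal.ofReal (exp (|lam| * ω ‖z‖)) * (A' ⋆ₗ B') z := fun z => by
    rw [lconvolution_def, lconvolution_def, ← lintegral_const_mul' _ _ ENNReal.ofReal_ne_top]
    refine lintegral_mono fun y => ?_
    -- From `ω(y) ≤ ω(z) + ω(y - z)`, which covers negative `λ`.
    have h2 : (1 : ℝ≥0∞) ≤ ENNReal.ofReal (exp (|lam| * ω ‖z‖)) *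
        (ENNReal.ofReal (exp (lam * ω ‖y‖)) * ENNReal.ofReal (exp (|lam| * ω ‖-y + z‖))) := by
      rw [← ENNReal.ofReal_mul (exp_pos _).le, ← ENNReal.ofReal_mul (exp_pos _).le, ← exp_add,
        ← exp_add, ← ENNReal.ofReal_one]
      refine ENNReal.ofReal_le_ofReal (one_le_exp ?_)
      have h3 := weight_le ω y z
      rw [norm_sub_rev y z, ← neg_add_eq_sub y z] at h3
      have h4 := neg_abs_le lam
      have h5 := abs_nonneg lam
      have h6 := weight_nonneg ω y
      nlinarith
    calc A y * B (-y + z) ≤ _ * (A y * B (-y + z)) := le_mul_of_one_le_left' h2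
      _ = _ := by simp only [A', B']; ring
  rw [lconvolution_def]
  calc _ ≤ ∫⁻ z, ENNReal.ofReal (exp (|lam| * ω ‖x‖)) * ((A' ⋆ₗ B') z * eDecay ω K (-z + x)) := by
        refine lintegral_mono fun z => ?_
        refine (mul_le_mul' (h1 z) le_rfl).trans ?_
        rw [mul_right_comm, mul_comm ((A' ⋆ₗ B') z), ← mul_assoc]
        exact mul_le_mul' (exp_eDecay_le x z) le_rfl
    _ = ENNReal.ofReal (exp (|lam| * ω ‖x‖)) * ∫⁻ z, (A' ⋆ₗ B') z * eDecay ω K (-z + x) :=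
        lintegral_const_mul' _ _ ENNReal.ofReal_ne_top
    _ < ∞ := by
        refine ENNReal.mul_lt_top ENNReal.ofReal_lt_top ?_
        have hk' : Measurable fun z => eDecay ω K (-z + x) := by fun_prop
        refine (lintegral_mul_le_eLpNorm hr hr' hrr (measurable_lconvolution _ hAm hBm)
          hk').trans_lt ?_
        refine ENNReal.mul_lt_top ((eLpNorm_lconvolution_le hp hq hr hpqr hAm hBm).trans_lt
          (ENNReal.mul_lt_top hA' hB')) ?_
        have hmp : MeasurePreserving (fun y : E d => -y + x) volume volume :=
          (measurePreserving_add_right volume x).comp (Measure.measurePreserving_neg volume)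
        have := eLpNorm_comp_measurePreserving (p := r') hk.aestronglyMeasurable hmp
        refine lt_of_eq_of_lt this (eLpNorm_eDecay_lt_top hr' hK)

theorem lconvolution_eDecay_le {K : ℝ} (hK : 0 ≤ K) (x : E d) :
    (eDecay ω (K + critExp d ω) ⋆ₗ eDecay ω (K + critExp d ω)) x ≤
      (∫⁻ y : E d, eDecay ω (critExp d ω) y) * eDecay ω K x := by
  rw [lconvolution_def, ← lintegral_mul_const' _ _ (eDecay_ne_top K x)]
  refine lintegral_mono fun y => ?_
  refine (mul_le_mul' (eDecay_add K _ y).le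
    (eDecay_anti (le_add_of_nonneg_right critExp_pos.le) _)).trans ?_
  rw [mul_right_comm, mul_comm (eDecay ω (critExp d ω) y)]
  refine mul_le_mul' ?_ le_rfl
  rw [eDecay, eDecay, ← ENNReal.ofReal_mul (exp_pos _).le, neg_add_eq_sub]
  exact ENNReal.ofReal_le_ofReal (exp_weight_mul_le hK x y)

theorem lconvolution_mono {f₁ f₂ g₁ g₂ : E d → ℝ≥0∞} (hf : ∀ x, f₁ x ≤ f₂ x)
    (hg : ∀ x, g₁ x ≤ g₂ x) (x : E d) : (f₁ ⋆ₗ g₁) x ≤ (f₂ ⋆ₗ g₂) x :=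
  lintegral_mono fun _ => mul_le_mul' (hf _) (hg _)

theorem measurable_eDecay_mul_regularize_sub (K : ℝ) (b : TestSpace d ω) (h : TemperedDist d ω)
    (x : E d) : Measurable fun z : E d × E d =>
      eDecay ω K z.2 * (‖regularize h (modulate z.1 b) (x - z.2)‖ₑ * eDecay ω K z.1) := by
  have hx : Continuous fun z : E d × E d => (x - z.2, z.1) :=
    (continuous_const.sub continuous_snd).prodMk continuous_fst
  have hr := (continuous_regularize_modulate h b).comp hx
  simp only [Function.comp_def] at hr
  exact ((measurable_eDecay K).comp measurable_snd).mul
    (hr.measurable.enorm.mul ((measurable_eDecay K).comp measurable_fst))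

/-- Pointwise estimate of a regularisation by a frequency average. -/
theorem exists_enorm_regularize_le_lconvolution {b : TestSpace d ω} (hb : b ≠ 0) {K : ℝ}
    (hK : 0 ≤ K) : ∃ (C : ℝ≥0) (K' : ℝ), ∀ (h : TemperedDist d ω) (θ : TestSpace d ω) (x : E d),
      ‖regularize h θ x‖ₑ ≤ C * ENNReal.ofReal (testNorm K' θ) *
        (freqAverage K b h ⋆ₗ eDecay ω K) x := by
  obtain ⟨c, hc⟩ := exists_enorm_regularize_le (conv_star_apply_zero_ne hb)
  obtain ⟨C₁, K', hC₁, h₁⟩ := exists_conv_modulate_le (star b) hK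
  refine ⟨c * C₁.toNNReal, K', fun h θ x => (hc h θ x).trans ?_⟩
  rw [ENNReal.coe_mul, mul_assoc (c : ℝ≥0∞), mul_assoc (c : ℝ≥0∞)]
  refine mul_le_mul' le_rfl ?_
  have hle : ∀ ξ y, ‖regularize h (modulate ξ b) (x - y)‖ₑ * ‖conv (modulate ξ (star b)) θ y‖ₑ ≤
      (C₁.toNNReal * ENNReal.ofReal (testNorm K' θ)) *
        (eDecay ω K y * (‖regularize h (modulate ξ b) (x - y)‖ₑ * eDecay ω K ξ)) := fun ξ y => by
    have h2 := ENNReal.ofReal_le_ofReal (h₁ θ ξ y)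
    rw [ofReal_norm, ENNReal.ofReal_mul (mul_nonneg (mul_nonneg hC₁ (testNorm_nonneg _ _))
      (exp_pos _).le), ENNReal.ofReal_mul (mul_nonneg hC₁ (testNorm_nonneg _ _)),
      ENNReal.ofReal_mul hC₁] at h2
    refine (mul_le_mul' le_rfl h2).trans (le_of_eq ?_)
    rw [eDecay, eDecay]
    change _ = ENNReal.ofReal C₁ * _ * _
    ring
  refine (lintegral_mono fun ξ => lintegral_mono fun y => hle ξ y).trans (le_of_eq ?_)
  have hfin : (C₁.toNNReal * ENNReal.ofReal (testNorm K' θ) : ℝ≥0∞) ≠ ∞ :=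
    ENNReal.mul_ne_top ENNReal.coe_ne_top ENNReal.ofReal_ne_top
  simp only [lintegral_const_mul' _ _ hfin]
  congr 1
  -- Integrating first over `ξ` produces the frequency average at `x - y`.
  rw [lconvolution_comm, lintegral_lintegral_swap, lconvolution_def]
  · refine lintegral_congr fun y => ?_
    rw [lintegral_const_mul' _ _ (eDecay_ne_top K y), neg_add_eq_sub, freqAverage]
  · exact (measurable_eDecay_mul_regularize_sub K b h x).aemeasurable

/-! ### Measurability of parametrised convolutions -/

/-- A parameter integral of a jointly continuous integrand; joint measurability is all that Fubini's
theorem will ask for. -/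
theorem stronglyMeasurable_conv_modulate (b χ : TestSpace d ω) :
    StronglyMeasurable fun z : E d × E d => conv (modulate z.1 b) χ z.2 := by
  have h : Continuous fun w : (E d × E d) × E d =>
      character w.1.1 w.2 * b w.2 * χ (w.1.2 - w.2) :=
    ((continuous_character₂.comp (by fun_prop :
      Continuous fun w : (E d × E d) × E d => (w.1.1, w.2))).mul
      (b.continuous.comp continuous_snd)).mul (χ.continuous.comp (by fun_prop))
  exact h.stronglyMeasurable.integral_prod_right (ν := volume)

theorem stronglyMeasurable_regularize_conv_modulate (h : TemperedDist d ω) (b χ : TestSpace d ω) :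
    StronglyMeasurable fun z : E d × E d => regularize h (conv (modulate z.1 b) χ) z.2 := by
  have hc : Continuous fun w : (E d × E d) × E d =>
      regularize h χ (w.1.2 - w.2) * (character w.1.1 w.2 * b w.2) :=
    ((continuous_regularize h χ).comp (by fun_prop)).mul
      ((continuous_character₂.comp (by fun_prop :
        Continuous fun w : (E d × E d) × E d => (w.1.1, w.2))).mul (b.continuous.comp continuous_snd))
  have e : (fun z : E d × E d => regularize h (conv (modulate z.1 b) χ) z.2) = fun z =>
      ∫ y, regularize h χ (z.2 - y) * (character z.1 y * b y) := by
    funext z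
    rw [conv_comm, (regularize_conv h χ (modulate z.1 b) z.2).2]
    rfl
  rw [e]
  exact hc.stronglyMeasurable.integral_prod_right (ν := volume)

end existence

end OmegaTempered

/-! ### Construction and uniqueness of the convolution. -/

namespace OmegaTempered

open Real Filter Topology

section convolution

variable {d : ℕ} {ω : WeightFunction}

/-! ### Finiteness of the dominating convolutions -/

theorem lconvolution_freqAverage_lt_top {p q r s s' : ℝ≥0∞} (hp : 1 ≤ p) (hq : 1 ≤ q)
    (hr : 1 ≤ r) (hs : 1 ≤ s) (hs' : 1 ≤ s') (hpqr : p⁻¹ + q⁻¹ = 1 + r⁻¹) (lam mu : ℝ)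
    {a b : TestSpace d ω} {f h : TemperedDist d ω}
    (hf : regNorm a p s (leftWeight ω lam mu) f < ∞)
    (hh : regNorm b q s' (rightWeight ω lam mu) h < ∞) :
    ∃ K : ℝ, 0 ≤ K ∧
      (∀ x, (freqAverage K a f ⋆ₗ (freqAverage K b h ⋆ₗ eDecay ω K)) x < ∞) ∧
      ∀ x, (freqAverage K a f ⋆ₗ ((freqAverage K b h ⋆ₗ eDecay ω K) ⋆ₗ eDecay ω K)) x < ∞ := by
  have hcr := critExp_pos (d := d) (ω := ω)
  have h0 := abs_nonneg lam
  have h1 := abs_nonneg mu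
  -- Large enough for the frequency weights `|μ|` and `||λ| - μ|` and for the spatial loss `|λ|`,
  -- each with a spare `critExp`. The further `critExp` in `K` is lost when two exponential kernels
  -- are merged into one.
  set L := 2 * |lam| + |mu| + critExp d ω with hL
  set K := L + critExp d ω with hK
  have hLK : 0 ≤ L := by positivity
  have hA := measurable_freqAverage K a f
  have hB := measurable_freqAverage K b h
  have hk := measurable_eDecay (d := d) (ω := ω) K
  rw [funext₂ (leftWeight_eq lam mu)] at hf
  rw [funext₂ (rightWeight_eq' lam mu)] at hh
  have h2 : ∀ x, ((freqAverage K a f ⋆ₗ freqAverage K b h) ⋆ₗ eDecay ω L) x < ∞ := fun x => by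
    refine lt_of_le_of_lt (lconvolution_mono (fun _ => le_rfl)
      (fun y => eDecay_anti (K := |lam| + critExp d ω) (by linarith) y) x) ?_
    refine lconvolution_lt_top hp hq hr hpqr le_rfl hA hB
      (eLpNorm_freqAverage_lt_top hp hs (by linarith) hf)
      (eLpNorm_freqAverage_lt_top hq hs' ?_ hh) x
    have := abs_sub |lam| mu
    rw [abs_abs] at this
    linarith
  refine ⟨K, by positivity, fun x => ?_, fun x => ?_⟩
  · rw [lconvolution_assoc hA hB hk]
    exact lt_of_le_of_lt (lconvolution_mono (fun _ => le_rfl)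
      (fun y => eDecay_anti (by linarith) y) x) (h2 x)
  · rw [← lconvolution_assoc hB hk hk, lconvolution_assoc hA hB (measurable_lconvolution _ hk hk)]
    refine lt_of_le_of_lt (lconvolution_mono (fun _ => le_rfl)
      (fun y => lconvolution_eDecay_le hLK y) x) ?_
    simp only [lconvolution_def, mul_left_comm _ (∫⁻ y : E d, eDecay ω (critExp d ω) y)]
    rw [lintegral_const_mul' _ _ (lintegral_eDecay_ne_top le_rfl)]
    exact ENNReal.mul_lt_top (lintegral_eDecay_lt_top le_rfl) (h2 x)

/-! ### The convolution as an integral over the time-frequency plane -/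

/-- The integrand `(f * M_ξ a)(y) (h * (M_ξ b * χ))(x - y)`, with `z = (y, ξ)`. -/
noncomputable def convIntegrand (a b : TestSpace d ω) (f h : TemperedDist d ω)
    (χ : TestSpace d ω) (x : E d) (z : E d × E d) : ℂ :=
  regularize f (modulate z.2 a) z.1 * regularize h (conv (modulate z.2 b) χ) (x - z.1)

theorem stronglyMeasurable_convIntegrand (a b : TestSpace d ω) (f h : TemperedDist d ω)
    (χ : TestSpace d ω) (x : E d) : StronglyMeasurable (convIntegrand a b f h χ x) := by
  have hx : Measurable fun z : E d × E d => (z.2, x - z.1) :=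
    measurable_snd.prodMk (measurable_fst.const_sub x)
  have h1 := (stronglyMeasurable_regularize_conv_modulate h b χ).comp_measurable hx
  exact (continuous_regularize_modulate f a).stronglyMeasurable.mul h1

/-- The test function `M_ξ b₁ * χ` has norms decaying in `ξ`; this factor later turns the
`ξ`-integral over `f` into a frequency average. -/
theorem exists_enorm_regularize_conv_modulate_le {b : TestSpace d ω} (hb : b ≠ 0)
    (b₁ : TestSpace d ω) {K : ℝ} (hK : 0 ≤ K) : ∃ (C : ℝ≥0) (K' : ℝ),
      ∀ (h : TemperedDist d ω) (χ : TestSpace d ω) (ξ x : E d),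
        ‖regularize h (conv (modulate ξ b₁) χ) x‖ₑ ≤ C * ENNReal.ofReal (testNorm K' χ) *
          eDecay ω K ξ * (freqAverage K b h ⋆ₗ eDecay ω K) x := by
  obtain ⟨C₁, L, h₁⟩ := exists_enorm_regularize_le_lconvolution hb hK
  obtain ⟨C₂, K', hC₂, h₂⟩ := exists_testNorm_conv_modulate_le b₁ (le_max_right L 0) hK
  refine ⟨C₁ * C₂.toNNReal, K', fun h χ ξ x => (h₁ h _ x).trans (mul_le_mul' ?_ le_rfl)⟩
  have h3 := ENNReal.ofReal_le_ofReal ((testNorm_mono (le_max_left L 0) _).trans (h₂ χ ξ))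
  rw [ENNReal.ofReal_mul (mul_nonneg hC₂ (testNorm_nonneg _ _)), ENNReal.ofReal_mul hC₂] at h3
  refine (mul_le_mul' le_rfl h3).trans (le_of_eq ?_)
  rw [ENNReal.coe_mul, eDecay]
  change _ = C₁ * ENNReal.ofReal C₂ * _ * _
  ring

theorem exists_lintegral_convIntegrand_le (a : TestSpace d ω) {b : TestSpace d ω} (hb : b ≠ 0)
    (b₁ : TestSpace d ω) {K : ℝ} (hK : 0 ≤ K) : ∃ (C : ℝ≥0) (K' : ℝ),
      ∀ (f h : TemperedDist d ω) (χ : TestSpace d ω) (x : E d),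
        ∫⁻ z, ‖convIntegrand a b₁ f h χ x z‖ₑ ≤ C * ENNReal.ofReal (testNorm K' χ) *
          (freqAverage K a f ⋆ₗ (freqAverage K b h ⋆ₗ eDecay ω K)) x := by
  obtain ⟨C, K', hC⟩ := exists_enorm_regularize_conv_modulate_le hb b₁ hK
  refine ⟨C, K', fun f h χ x => ?_⟩
  have hfin : (C * ENNReal.ofReal (testNorm K' χ) : ℝ≥0∞) ≠ ∞ :=
    ENNReal.mul_ne_top ENNReal.coe_ne_top ENNReal.ofReal_ne_top
  rw [Measure.volume_eq_prod, lintegral_prod _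
    (stronglyMeasurable_convIntegrand a b₁ f h χ x).measurable.enorm.aemeasurable,
    lconvolution_def, ← lintegral_const_mul' _ _ hfin]
  refine lintegral_mono fun y => ?_
  rw [← lintegral_regularize_mul_eDecay_mul K a f y hfin]
  refine lintegral_mono fun ξ => ?_
  rw [convIntegrand, enorm_mul, neg_add_eq_sub]
  refine (mul_le_mul' le_rfl (hC h χ ξ (x - y))).trans (le_of_eq ?_)
  ring

/-- Translation covariance: a functional defined by the integral at the origin has regularisations
given by the integral at every `x`. -/
theorem convIntegrand_translate_reflect (a b : TestSpace d ω) (f h : TemperedDist d ω)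
    (χ : TestSpace d ω) (x : E d) :
    convIntegrand a b f h (reflect (translate x (reflect χ))) 0 = convIntegrand a b f h χ x := by
  have : reflect (translate x (reflect χ)) = translate (-x) χ := by
    ext y
    change χ (-(-y - x)) = χ (y - -x)
    exact congrArg χ.1 (by abel)
  funext z
  rw [convIntegrand, this, ← translate_conv, regularize_translate, convIntegrand]
  congr 2
  abel

/-- The candidate for `f * h`. The integral is linear in `χ`, and its bound by a single weighted
norm of `χ` gives continuity. -/
theorem exists_temperedDist_eq_integral {a b : TestSpace d ω} (hb : b ≠ 0) (b₁ : TestSpace d ω)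
    {K : ℝ} (hK : 0 ≤ K) {f h : TemperedDist d ω}
    (hfin : ∀ x, (freqAverage K a f ⋆ₗ (freqAverage K b h ⋆ₗ eDecay ω K)) x < ∞) (c : ℂ) :
    ∃ u : TemperedDist d ω, ∀ χ x, regularize u χ x = c * ∫ z, convIntegrand a b₁ f h χ x z := by
  obtain ⟨C, K', hC⟩ := exists_lintegral_convIntegrand_le a hb b₁ hK
  have hi : ∀ χ, Integrable (convIntegrand a b₁ f h χ 0) := fun χ =>
    ⟨(stronglyMeasurable_convIntegrand a b₁ f h χ 0).aestronglyMeasurable,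
      (hC f h χ 0).trans_lt (ENNReal.mul_lt_top (ENNReal.mul_lt_top ENNReal.coe_lt_top
        ENNReal.ofReal_lt_top) (hfin 0))⟩
  have hadd : ∀ χ₁ χ₂ z, convIntegrand a b₁ f h (reflect (χ₁ + χ₂)) 0 z =
      convIntegrand a b₁ f h (reflect χ₁) 0 z + convIntegrand a b₁ f h (reflect χ₂) 0 z := by
    intro χ₁ χ₂ z
    change _ * regularizeAt h _ (conv _ (reflect χ₁ + reflect χ₂)) = _
    rw [conv_add_right, map_add, mul_add]
    rfl
  have hsmul : ∀ (k : ℂ) χ z, convIntegrand a b₁ f h (reflect (k • χ)) 0 z =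
      k * convIntegrand a b₁ f h (reflect χ) 0 z := by
    intro k χ z
    change _ * regularizeAt h _ (conv _ (k • reflect χ)) = _
    rw [conv_smul_right, map_smul, smul_eq_mul, mul_left_comm]
    rfl
  let g : TestSpace d ω →ₗ[ℂ] ℂ :=
    { toFun := fun χ => c * ∫ z, convIntegrand a b₁ f h (reflect χ) 0 z
      map_add' := fun χ₁ χ₂ => by
        simp only [hadd]
        rw [integral_add (hi _) (hi _), mul_add]
      map_smul' := fun k χ => by
        simp only [hsmul]
        rw [integral_const_mul, mul_left_comm]
        rfl }
  set T := ((freqAverage K a f ⋆ₗ (freqAverage K b h ⋆ₗ eDecay ω K)) 0).toReal with hT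
  have hT0 : 0 ≤ T := ENNReal.toReal_nonneg
  have hg : Continuous g := by
    refine continuous_of_testNorm_bound g (K := K') (C := ‖c‖ * (C * T)) (by positivity) fun χ => ?_
    change ‖c * ∫ z, convIntegrand a b₁ f h (reflect χ) 0 z‖ ≤ _
    rw [norm_mul, mul_assoc]
    refine mul_le_mul_of_nonneg_left ?_ (norm_nonneg c)
    refine (norm_integral_le_lintegral_norm _).trans ?_
    simp only [ofReal_norm]
    have h1 := testNorm_nonneg K' (reflect χ)
    refine (ENNReal.toReal_mono (ENNReal.mul_lt_top (ENNReal.mul_lt_top ENNReal.coe_lt_top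
        ENNReal.ofReal_lt_top) (hfin 0)).ne (hC f h (reflect χ) 0)).trans ?_
    rw [ENNReal.toReal_mul, ENNReal.toReal_mul, ENNReal.toReal_ofReal h1, ENNReal.coe_toReal, ← hT,
      mul_right_comm]
    have := testNorm_reflect_le K' χ
    gcongr
  refine ⟨⟨g, hg⟩, fun χ x => ?_⟩
  rw [← convIntegrand_translate_reflect]
  rfl

/-! ### Existence and uniqueness of the convolution -/

theorem integrable_regularize_mul_regularize {a b : TestSpace d ω} (ha : a ≠ 0) (hb : b ≠ 0)
    {K : ℝ} (hK : 0 ≤ K) {f h : TemperedDist d ω}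
    (hfin : ∀ x, (freqAverage K a f ⋆ₗ ((freqAverage K b h ⋆ₗ eDecay ω K) ⋆ₗ eDecay ω K)) x < ∞)
    (φ ψ : TestSpace d ω) (x : E d) :
    Integrable fun y => regularize f φ y * regularize h ψ (x - y) := by
  have hA := measurable_freqAverage K a f
  have hB := measurable_freqAverage K b h
  have hk := measurable_eDecay (d := d) (ω := ω) K
  obtain ⟨C₁, K₁, h₁⟩ := exists_enorm_regularize_le_lconvolution ha hK
  obtain ⟨C₂, K₂, h₂⟩ := exists_enorm_regularize_le_lconvolution hb hK
  have hx : Continuous fun y : E d => x - y := continuous_const.sub continuous_id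
  refine ⟨((continuous_regularize f φ).mul
    ((continuous_regularize h ψ).comp hx)).aestronglyMeasurable, ?_⟩
  have h3 := hfin x
  -- Regroups the finite quantity so that one kernel goes with each average, matching the majorants
  -- of `f * φ` and `h * ψ`.
  rw [lconvolution_comm (f := freqAverage K b h ⋆ₗ eDecay ω K),
    lconvolution_assoc hA hk (measurable_lconvolution _ hB hk), lconvolution_def] at h3
  set c₁ : ℝ≥0∞ := C₁ * ENNReal.ofReal (testNorm K₁ φ)
  set c₂ : ℝ≥0∞ := C₂ * ENNReal.ofReal (testNorm K₂ ψ)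
  have hc : c₁ * c₂ < ∞ := ENNReal.mul_lt_top (ENNReal.mul_lt_top ENNReal.coe_lt_top
    ENNReal.ofReal_lt_top) (ENNReal.mul_lt_top ENNReal.coe_lt_top ENNReal.ofReal_lt_top)
  refine lt_of_le_of_lt ?_ (ENNReal.mul_lt_top hc h3)
  rw [← lintegral_const_mul' _ _ hc.ne]
  refine lintegral_mono fun y => ?_
  rw [enorm_mul, neg_add_eq_sub]
  refine (mul_le_mul' (h₁ f φ y) (h₂ h ψ (x - y))).trans (le_of_eq ?_)
  ring

theorem stronglyMeasurable_regularize_mul_conv (a b : TestSpace d ω) (f h : TemperedDist d ω)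
    (φ ψ : TestSpace d ω) (x : E d) :
    StronglyMeasurable fun Z : (E d × E d) × E d => regularize f (modulate Z.1.2 a) Z.1.1 *
      (regularize h ψ Z.2 * conv (modulate Z.1.2 b) φ (x - Z.1.1 - Z.2)) := by
  have hx : Measurable fun Z : (E d × E d) × E d => (Z.1.2, x - Z.1.1 - Z.2) :=
    measurable_fst.snd.prodMk ((measurable_fst.fst.const_sub x).sub measurable_snd)
  have h1 := (continuous_regularize_modulate f a).stronglyMeasurable.comp_measurable
    (measurable_fst : Measurable fun Z : (E d × E d) × E d => Z.1)
  have h2 := (continuous_regularize h ψ).stronglyMeasurable.comp_measurable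
    (measurable_snd : Measurable fun Z : (E d × E d) × E d => Z.2)
  have h3 := (stronglyMeasurable_conv_modulate b φ).comp_measurable hx
  simp only [Function.comp_def] at h1 h2 h3
  exact h1.mul (h2.mul h3)

theorem integrable_convIntegrand_prod (a : TestSpace d ω) {b : TestSpace d ω} (hb : b ≠ 0)
    (b₁ : TestSpace d ω) {K : ℝ} (hK : 0 ≤ K) {f h : TemperedDist d ω}
    (hfin : ∀ x, (freqAverage K a f ⋆ₗ ((freqAverage K b h ⋆ₗ eDecay ω K) ⋆ₗ eDecay ω K)) x < ∞)
    (φ ψ : TestSpace d ω) (x : E d) :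
    Integrable fun Z : (E d × E d) × E d => regularize f (modulate Z.1.2 a) Z.1.1 *
      (regularize h ψ Z.2 * conv (modulate Z.1.2 b₁) φ (x - Z.1.1 - Z.2)) := by
  have hB := measurable_freqAverage K b h
  have hk := measurable_eDecay (d := d) (ω := ω) K
  obtain ⟨C₁, K₁, hC₁, h₁⟩ := exists_conv_modulate_le b₁ hK
  obtain ⟨C₂, K₂, h₂⟩ := exists_enorm_regularize_le_lconvolution hb hK
  have hm := stronglyMeasurable_regularize_mul_conv a b₁ f h φ ψ x
  refine ⟨hm.aestronglyMeasurable, ?_⟩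
  set c₁ : ℝ≥0∞ := ENNReal.ofReal (C₁ * testNorm K₁ φ) with hc₁
  set c₂ : ℝ≥0∞ := C₂ * ENNReal.ofReal (testNorm K₂ ψ)
  have hc : c₁ * c₂ < ∞ := ENNReal.mul_lt_top ENNReal.ofReal_lt_top
    (ENNReal.mul_lt_top ENNReal.coe_lt_top ENNReal.ofReal_lt_top)
  have hconv : ∀ ξ y, ‖conv (modulate ξ b₁) φ y‖ₑ ≤ c₁ * eDecay ω K ξ * eDecay ω K y := fun ξ y => by
    have h3 := ENNReal.ofReal_le_ofReal (h₁ φ ξ y)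
    have h4 := mul_nonneg hC₁ (testNorm_nonneg K₁ φ)
    rwa [ofReal_norm, ENNReal.ofReal_mul (mul_nonneg h4 (exp_pos _).le),
      ENNReal.ofReal_mul h4] at h3
  refine lt_of_le_of_lt ?_ (ENNReal.mul_lt_top hc (hfin x))
  rw [Measure.volume_eq_prod, lintegral_prod _ hm.measurable.enorm.aemeasurable,
    Measure.volume_eq_prod, lintegral_prod _
      hm.measurable.enorm.lintegral_prod_right'.aemeasurable,
    lconvolution_def, ← lintegral_const_mul' _ _ hc.ne]
  refine lintegral_mono fun y => ?_
  rw [← lintegral_regularize_mul_eDecay_mul K a f y hc.ne]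
  refine lintegral_mono fun ξ => ?_
  have hmw : Measurable fun w => (freqAverage K b h ⋆ₗ eDecay ω K) w * eDecay ω K (-w + (-y + x)) :=
    (measurable_lconvolution _ hB hk).mul (hk.comp (measurable_neg.add_const _))
  rw [lconvolution_def, ← lintegral_const_mul _ hmw]
  refine lintegral_mono fun w => ?_
  simp only [enorm_mul]
  refine (mul_le_mul' le_rfl (mul_le_mul' (h₂ h ψ w) (hconv ξ _))).trans (le_of_eq ?_)
  rw [show x - y - w = -w + (-y + x) by abel]
  ring

/-- Expanding `h * (M_ξ b₁ * φ * ψ)` as an integral over `w` and integrating over `w` last leaves,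
at fixed `w`, the reproducing integral for `f * φ` at `x - w`. -/
theorem integral_convIntegrand_conv (a : TestSpace d ω) {b : TestSpace d ω} (hb : b ≠ 0)
    (b₁ : TestSpace d ω) {K : ℝ} (hK : 0 ≤ K) {f h : TemperedDist d ω}
    (hfin : ∀ x, (freqAverage K a f ⋆ₗ ((freqAverage K b h ⋆ₗ eDecay ω K) ⋆ₗ eDecay ω K)) x < ∞)
    (φ ψ : TestSpace d ω) (x : E d) :
    ∫ z, convIntegrand a b₁ f h (conv φ ψ) x z = (2 * π) ^ d * conv a b₁ 0 *
      ∫ y, regularize f φ y * regularize h ψ (x - y) := by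
  have hint := integrable_convIntegrand_prod a hb b₁ hK hfin φ ψ x
  have h1 : ∀ z, convIntegrand a b₁ f h (conv φ ψ) x z = ∫ w, regularize f (modulate z.2 a) z.1 *
      (regularize h ψ w * conv (modulate z.2 b₁) φ (x - z.1 - w)) := fun z => by
    rw [convIntegrand, ← conv_assoc, conv_comm _ ψ, (regularize_conv' h ψ _ _).2,
      integral_const_mul]
  simp only [h1]
  rw [integral_integral_swap hint]
  -- Only for almost every `w`, because integrability of the slices comes from Fubini's theorem.
  have h2 : ∀ᵐ w : E d, ∫ z : E d × E d, regularize f (modulate z.2 a) z.1 *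
      (regularize h ψ w * conv (modulate z.2 b₁) φ (x - z.1 - w)) =
      (2 * π) ^ d * conv a b₁ 0 * (regularize f φ (x - w) * regularize h ψ w) := by
    filter_upwards [hint.prod_left_ae] with w hw
    rw [Measure.volume_eq_prod, integral_prod_symm _ hw]
    have h3 : ∀ ξ, ∫ y, regularize f (modulate ξ a) y *
        (regularize h ψ w * conv (modulate ξ b₁) φ (x - y - w)) =
        regularize f (conv (modulate ξ (conv a b₁)) φ) (x - w) * regularize h ψ w := fun ξ => by
      rw [modulate_conv, conv_assoc, (regularize_conv' f _ _ _).2, ← integral_mul_const]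
      refine integral_congr_ae (Eventually.of_forall fun y => ?_)
      simp only [sub_right_comm x y w]
      ring
    simp only [h3]
    rw [integral_mul_const, ← (regularize_reproducing f (conv a b₁) φ (x - w)).2, mul_assoc]
  rw [integral_congr_ae h2, integral_const_mul,
    ← integral_sub_left_eq_self (fun y => regularize f φ y * regularize h ψ (x - y)) volume x]
  simp only [sub_sub_cancel]

theorem existsUnique_isConvolution {p q r s s' : ℝ≥0∞} (hp : 1 ≤ p) (hq : 1 ≤ q)
    (hr : 1 ≤ r) (hs : 1 ≤ s) (hs' : 1 ≤ s') (hpqr : p⁻¹ + q⁻¹ = 1 + r⁻¹) (lam mu : ℝ)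
    {a b : TestSpace d ω} (ha : a ≠ 0) (hb : b ≠ 0) {f h : TemperedDist d ω}
    (hf : regNorm a p s (leftWeight ω lam mu) f < ∞)
    (hh : regNorm b q s' (rightWeight ω lam mu) h < ∞) :
    ∃! u : TemperedDist d ω, IsConvolution f h u := by
  obtain ⟨K, hK, h1, h2⟩ := lconvolution_freqAverage_lt_top hp hq hr hs hs' hpqr lam mu hf hh
  have hc : (2 * π) ^ d * conv a (star a) 0 ≠ 0 :=
    mul_ne_zero (two_pi_pow_ne_zero d) (conv_star_apply_zero_ne ha)
  obtain ⟨u, hu⟩ := exists_temperedDist_eq_integral hb (star a) hK h1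
    ((2 * π) ^ d * conv a (star a) 0)⁻¹
  refine ⟨u, fun φ ψ x => ⟨integrable_regularize_mul_regularize ha hb hK h2 φ ψ x, ?_⟩,
    fun v hv => TemperedDist.eq_of_regularize_conv ha fun φ ψ x => ?_⟩
  · rw [← (regularize_conv' u φ ψ x).2, hu,
      integral_convIntegrand_conv a hb (star a) hK h2, inv_mul_cancel_left₀ hc]
  · rw [hv.regularize_conv_eq, hu, integral_convIntegrand_conv a hb (star a) hK h2,
      inv_mul_cancel_left₀ hc]

end convolution

end OmegaTempered
-- The proposition.
theorem mainTheorem4 {d : ℕ} (ω : OmegaTempered.WeightFunction)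
    (p q r s t t' : ℝ≥0∞)
    (hp : 1 ≤ p) (hq : 1 ≤ q) (hr : 1 ≤ r) (hs : 1 ≤ s) (ht : 1 ≤ t) (ht' : 1 ≤ t')
    (hpqr : p⁻¹ + q⁻¹ = 1 + r⁻¹) (htt' : t⁻¹ + t'⁻¹ = 1) (lam mu : ℝ)
    (φ₁ φ₂ : OmegaTempered.TestSpace d ω) (hφ₁ : φ₁ ≠ 0) (hφ₂ : φ₂ ≠ 0) :
    -- the convolution of two elements of the modulation spaces exists and is unique
    (∀ f ∈ OmegaTempered.modulationSpace φ₁ p (s * t) (OmegaTempered.leftWeight ω lam mu),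
      ∀ h ∈ OmegaTempered.modulationSpace φ₂ q (s * t') (OmegaTempered.rightWeight ω lam mu),
      ∃! u : OmegaTempered.TemperedDist d ω, OmegaTempered.IsConvolution f h u) ∧
    -- continuous embedding, for every window used in the norm of the target space
    (∀ φ₃ : OmegaTempered.TestSpace d ω, φ₃ ≠ 0 → ∃ C : ℝ≥0,
      ∀ f ∈ OmegaTempered.modulationSpace φ₁ p (s * t) (OmegaTempered.leftWeight ω lam mu),
      ∀ h ∈ OmegaTempered.modulationSpace φ₂ q (s * t') (OmegaTempered.rightWeight ω lam mu),
      ∀ u : OmegaTempered.TemperedDist d ω, OmegaTempered.IsConvolution f h u →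
        u ∈ OmegaTempered.modulationSpace φ₃ r s (OmegaTempered.mWeight ω lam) ∧
        OmegaTempered.modNorm φ₃ r s (OmegaTempered.mWeight ω lam) u ≤
          C * (OmegaTempered.modNorm φ₁ p (s * t) (OmegaTempered.leftWeight ω lam mu) f *
            OmegaTempered.modNorm φ₂ q (s * t') (OmegaTempered.rightWeight ω lam mu) h)) ∧
    -- the norm inequality with constant one, for the window `φ₁ * φ₂` on the target space
    (∀ φ₃ : OmegaTempered.TestSpace d ω, φ₃ ≠ 0 →
      (∀ x, φ₃ x = ∫ y, φ₁ y * φ₂ (x - y)) →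
      ∀ f ∈ OmegaTempered.modulationSpace φ₁ p (s * t) (OmegaTempered.leftWeight ω lam mu),
      ∀ h ∈ OmegaTempered.modulationSpace φ₂ q (s * t') (OmegaTempered.rightWeight ω lam mu),
      ∀ u : OmegaTempered.TemperedDist d ω, OmegaTempered.IsConvolution f h u →
        OmegaTempered.modNorm φ₃ r s (OmegaTempered.mWeight ω lam) u ≤
          OmegaTempered.modNorm φ₁ p (s * t) (OmegaTempered.leftWeight ω lam mu) f *
            OmegaTempered.modNorm φ₂ q (s * t') (OmegaTempered.rightWeight ω lam mu) h) := by
  have hl : ∀ x ξ, 0 < OmegaTempered.leftWeight (d := d) ω lam mu x ξ :=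
    (OmegaTempered.moderateWeight_left ω lam mu).pos
  have hrw : ∀ x ξ, 0 < OmegaTempered.rightWeight (d := d) ω lam mu x ξ :=
    (OmegaTempered.moderateWeight_right ω lam mu).pos
  have hm : ∀ x ξ, 0 < OmegaTempered.mWeight (d := d) ω lam x ξ :=
    (OmegaTempered.moderateWeight_mWeight ω lam).pos
  have h₁ := OmegaTempered.star_ne_zero hφ₁
  have h₂ := OmegaTempered.star_ne_zero hφ₂
  simp only [OmegaTempered.mem_modulationSpace_iff, OmegaTempered.modNorm_eq_regNorm hl,
    OmegaTempered.modNorm_eq_regNorm hrw, OmegaTempered.modNorm_eq_regNorm hm]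
  refine ⟨fun f hf h hh => OmegaTempered.existsUnique_isConvolution hp hq hr (one_le_mul hs ht)
    (one_le_mul hs ht') hpqr lam mu h₁ h₂ hf hh, fun φ₃ _ => ?_,
    fun φ₃ _ hφ₃ f _ h _ u hu => ?_⟩
  · obtain ⟨C, hC⟩ := OmegaTempered.exists_regNorm_conv_le hp hq hr hs ht ht' hpqr htt' lam mu h₁ h₂
      (OmegaTempered.star φ₃)
    exact ⟨C, fun f hf h hh u hu => ⟨(hC f h u hu).trans_lt
      (ENNReal.mul_lt_top ENNReal.coe_lt_top (ENNReal.mul_lt_top hf hh)), hC f h u hu⟩⟩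
  · have : φ₃ = OmegaTempered.conv φ₁ φ₂ :=
      OmegaTempered.TestSpace.ext fun x => (hφ₃ x).trans (OmegaTempered.conv_apply φ₁ φ₂ x).symm
    -- The involution respects convolution, so the window `φ₁ * φ₂` corresponds exactly to the
    -- product of the two regularising windows.
    rw [this, OmegaTempered.star_conv]
    exact OmegaTempered.regNorm_conv_le hp hq hr hs ht ht' hpqr htt' lam mu _ _ hu
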